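/- **Simons' theorem.** Let $2\le n\le 6$ and let $\Sigma\subset\mathbb{R}^{n+1}$ be a closed set with $\Sigma\setminus\{0\}\neq\emptyset$ that is a cone with vertex at the origin, i.e. $t\Sigma\subset\Sigma$ for all $t>0$. Suppose that $\Sigma\setminus\{0\}$ is a smooth embedded hypersurface, oriented by a smooth unit normal field $\nu$, with second fundamental form $II$. Suppose moreover that 1. $\Sigma\setminus\{0\}$ is minimal: its mean curvature $H=\operatorname{tr} II$ vanishes identically; 2. $\Sigma\setminus\{0\}$ is stable: with $c^2=|II|^2$ the sum of the squares of the principal curvatures and $\nabla_\Sigma$ the tangential gradient, $$\int_{\Sigma}\left(|\nabla_\Sigma\varphi|^2-c^2\varphi^2\right)\ge 0\qquad\text{for every }\varphi\in C_c^\infty(\Sigma\setminus\{0\}),$$ where the integral is with respect to $n$-dimensional area. Then $\Sigma$ is a hyperplane through the origin. -/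

import Mathlib

open MeasureTheory
open scoped ContDiff Gradient

noncomputable section

namespace Hypersurface

/-- `S` is a smooth embedded hypersurface of `ℝⁿ⁺¹`, oriented by the unit normal field `ν`.
Near each of its points, `S` is the zero set of a smooth function `F` whose gradient does not
vanish on `S`, and `ν = ∇F / |∇F|` on `S`. The field `ν` is smooth along `S`, that is, it is
given as a smooth field on a neighbourhood of `S`; its values off `S` play no role. -/
structure IsOriented {n : ℕ} (S : Set (EuclideanSpace ℝ (Fin (n + 1))))
    (ν : EuclideanSpace ℝ (Fin (n + 1)) → EuclideanSpace ℝ (Fin (n + 1))) : Prop where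
  smooth_normal : ∃ V, IsOpen V ∧ S ⊆ V ∧ ContDiffOn ℝ ∞ ν V
  local_defining : ∀ p ∈ S, ∃ (U : Set (EuclideanSpace ℝ (Fin (n + 1))))
    (F : EuclideanSpace ℝ (Fin (n + 1)) → ℝ), IsOpen U ∧ p ∈ U ∧ ContDiffOn ℝ ∞ F U ∧
      S ∩ U = {x | x ∈ U ∧ F x = 0} ∧
      ∀ x ∈ S ∩ U, ∇ F x ≠ 0 ∧ ν x = (‖∇ F x‖)⁻¹ • ∇ F x

/-- Orthogonal projection of `ℝⁿ⁺¹` onto the tangent space `ν(x)^⊥` at `x`. -/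
def tangentProj {n : ℕ} (ν : EuclideanSpace ℝ (Fin (n + 1)) → EuclideanSpace ℝ (Fin (n + 1)))
    (x : EuclideanSpace ℝ (Fin (n + 1))) :
    EuclideanSpace ℝ (Fin (n + 1)) →L[ℝ] EuclideanSpace ℝ (Fin (n + 1)) :=
  (ℝ ∙ ν x)ᗮ.starProjection

/-- Second fundamental form at `x`, as the endomorphism `v ↦ -P (Dν(x) (P v))` of `ℝⁿ⁺¹`, where
`P` is the projection onto the tangent space. On the tangent space it is the shape operator, and
it kills the normal line, so that its nonzero eigenvalues are the nonzero principal curvatures. -/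
def secondFundamentalForm {n : ℕ}
    (ν : EuclideanSpace ℝ (Fin (n + 1)) → EuclideanSpace ℝ (Fin (n + 1)))
    (x : EuclideanSpace ℝ (Fin (n + 1))) :
    EuclideanSpace ℝ (Fin (n + 1)) →L[ℝ] EuclideanSpace ℝ (Fin (n + 1)) :=
  -(tangentProj ν x ∘L fderiv ℝ ν x ∘L tangentProj ν x)

/-- Mean curvature `H`: the sum of the principal curvatures. -/
def meanCurvature {n : ℕ}
    (ν : EuclideanSpace ℝ (Fin (n + 1)) → EuclideanSpace ℝ (Fin (n + 1)))
    (x : EuclideanSpace ℝ (Fin (n + 1))) : ℝ :=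
  LinearMap.trace ℝ (EuclideanSpace ℝ (Fin (n + 1))) (secondFundamentalForm ν x).toLinearMap

/-- `c² = |II|²`: the squared Hilbert–Schmidt norm of the second fundamental form, which is the
sum of the squares of the principal curvatures. -/
def curvatureSq {n : ℕ}
    (ν : EuclideanSpace ℝ (Fin (n + 1)) → EuclideanSpace ℝ (Fin (n + 1)))
    (x : EuclideanSpace ℝ (Fin (n + 1))) : ℝ :=
  ∑ i, ‖secondFundamentalForm ν x (EuclideanSpace.basisFun (Fin (n + 1)) ℝ i)‖ ^ 2

/-- Tangential gradient `∇_S φ`: the tangential part of the gradient of `φ`. -/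
def tangentialGradient {n : ℕ}
    (ν : EuclideanSpace ℝ (Fin (n + 1)) → EuclideanSpace ℝ (Fin (n + 1)))
    (φ : EuclideanSpace ℝ (Fin (n + 1)) → ℝ) (x : EuclideanSpace ℝ (Fin (n + 1))) :
    EuclideanSpace ℝ (Fin (n + 1)) :=
  tangentProj ν x (∇ φ x)

/-- `S` is minimal: its mean curvature vanishes. -/
def IsMinimal {n : ℕ} (S : Set (EuclideanSpace ℝ (Fin (n + 1))))
    (ν : EuclideanSpace ℝ (Fin (n + 1)) → EuclideanSpace ℝ (Fin (n + 1))) : Prop :=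
  ∀ x ∈ S, meanCurvature ν x = 0

/-- `S` is stable: `∫_S (|∇_S φ|² - c² φ²) ≥ 0` for all `φ ∈ C_c^∞(S)`, where the integral is with
respect to the `n`-dimensional area. A compactly supported smooth function on the embedded
hypersurface `S` is the same as the restriction to `S` of a smooth function on `ℝⁿ⁺¹` whose
support meets `S` in a compact set. -/
def IsStable {n : ℕ} (S : Set (EuclideanSpace ℝ (Fin (n + 1))))
    (ν : EuclideanSpace ℝ (Fin (n + 1)) → EuclideanSpace ℝ (Fin (n + 1))) : Prop :=
  ∀ φ : EuclideanSpace ℝ (Fin (n + 1)) → ℝ, ContDiff ℝ ∞ φ → HasCompactSupport φ →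
    IsCompact (S ∩ tsupport φ) →
    0 ≤ ∫ x in S, (‖tangentialGradient ν φ x‖ ^ 2 - curvatureSq ν x * φ x ^ 2) ∂μHE[n]

/-- `K` is a cone with vertex at the origin: it is closed and invariant under dilations. -/
def IsClosedCone {n : ℕ} (K : Set (EuclideanSpace ℝ (Fin (n + 1)))) : Prop :=
  IsClosed K ∧ ∀ t : ℝ, 0 < t → ∀ x ∈ K, t • x ∈ K

end Hypersurface

end

/-! Write u = |II|² and r = |x|. Three facts about a minimal cone are played against stability.

Simons' identity says ½Δu = |∇II|² - u². On a cone, II annihilates the radial direction and is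
homogeneous of degree -1, and this improves Kato's inequality to |∇II|² ≥ |∇√u|² + 2u/r². Test
stability with √u Q(log r) and integrate by parts: the terms in u² cancel, and 0 ≤ ∫ u r⁻² (Q'² -
2Q²) remains, with Q and Q' taken at log r. As √u need not be smooth at zeros of u, the test
function is built from √(u + ε), and ε tends to 0.

Moreover u is homogeneous of degree -2. The divergence theorem for the field u H(log r) x then shows
that integration against u, on functions of t = log r, is m e^((n-2)t) dt for a constant m. With a =
(n-4)/2 and Q = e^(-at) ψ, the stability inequality becomes m ∫ (ψ'² - (2 - a²) ψ²) ≥ 0. For 2 ≤ n ≤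
6 one has a² ≤ 1, and a sufficiently stretched bump has ∫ ψ'² < ∫ ψ². Hence m ≤ 0, and u = 0 because
u ≥ 0.

Then ν is locally constant and the cone agrees near each point with its tangent plane. Openness and
closedness in the punctured plane, which is connected since n ≥ 2, give the whole plane. Two such
planes would meet away from the origin, where the normal is unique, so there is only one.

The calculus is extrinsic. The components δ_i of the tangential gradient are derivations of the
algebra of functions on the cone that extend smoothly, and everything up to Kato's inequality is
algebra from their rules (`IsMinimalConeCalculus`). The divergence theorem for Hausdorff area is
derived from graph charts, an area formula (`IsGraphChart.comap_eq`) and a partition of unity. The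
main steps are `laplacian_shapeNormSq`, `kato_cone`, `IsOriented.integral_div_eq_zero`,
`IsOriented.radialIntegral_stability`, `IsOriented.radialIntegral_homogeneity`, `exp_mul_sq_nonpos`
and `IsOriented.tangentPlane_subset`. -/

noncomputable section

/-! ### Algebra of tangential derivatives and Simons' identity -/

namespace Hypersurface

/-- The algebraic rules of tangential differentiation on a minimal cone: `A` plays the role of the
ring of smooth functions on the cone, `δ i` of the `i`-th component of the tangential gradient,
`ν i` and `x i` of the components of the unit normal and of the position vector. -/
structure IsMinimalConeCalculus {ι A : Type*} [Fintype ι] [DecidableEq ι] [CommRing A]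
    [Algebra ℝ A] (δ : ι → Derivation ℝ A A) (ν x : ι → A) : Prop where
  unit : ∑ i, ν i * ν i = 1
  normal : ∀ f, ∑ i, ν i * δ i f = 0
  symm : ∀ i j, δ i (ν j) = δ j (ν i)
  comm : ∀ i j f, δ i (δ j f) - δ j (δ i f) =
    ∑ h, (ν i * δ j (ν h) - ν j * δ i (ν h)) * δ h f
  minimal : ∑ i, δ i (ν i) = 0
  position : ∀ i j, δ i (x j) = (if i = j then 1 else 0) - ν i * ν j
  cone : ∑ i, x i * ν i = 0

/-- The square of the second fundamental form. -/
def shapeSq {ι A : Type*} [Fintype ι] [CommRing A] [Algebra ℝ A]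
    (δ : ι → Derivation ℝ A A) (ν : ι → A) (i j : ι) : A :=
  ∑ h, δ i (ν h) * δ h (ν j)

/-- The squared norm of the second fundamental form. -/
def shapeNormSq {ι A : Type*} [Fintype ι] [CommRing A] [Algebra ℝ A]
    (δ : ι → Derivation ℝ A A) (ν : ι → A) : A :=
  ∑ i, ∑ j, δ i (ν j) * δ i (ν j)

namespace IsMinimalConeCalculus

variable {ι A : Type*} [Fintype ι] [DecidableEq ι] [CommRing A] [Algebra ℝ A]
  {δ : ι → Derivation ℝ A A} {ν x : ι → A} (h : IsMinimalConeCalculus δ ν x)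

include h

theorem sum_normal_mul_shape (i : ι) : ∑ j, ν j * δ i (ν j) = 0 := by
  simp_rw [h.symm i]; exact h.normal _

theorem shapeSq_symm (i j : ι) : shapeSq δ ν i j = shapeSq δ ν j i := by
  unfold shapeSq
  refine Finset.sum_congr rfl fun k _ => ?_
  rw [h.symm i k, h.symm k j, mul_comm]

theorem sum_normal_mul_shapeSq (j : ι) : ∑ i, ν i * shapeSq δ ν i j = 0 := by
  unfold shapeSq
  simp_rw [Finset.mul_sum, ← mul_assoc]
  rw [Finset.sum_comm]
  simp_rw [← Finset.sum_mul, h.normal, zero_mul, Finset.sum_const_zero]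

/-- The commutation rule applied to ν_j. Every term on the right carries a normal factor, so the
tangential part of δ_k δ_i ν_j is symmetric in all three indices, which is the Codazzi equation. -/
theorem codazzi (k i j : ι) : δ k (δ i (ν j)) - δ i (δ k (ν j)) =
    ν k * shapeSq δ ν i j - ν i * shapeSq δ ν k j := by
  rw [h.comm, shapeSq, shapeSq, Finset.mul_sum, Finset.mul_sum, ← Finset.sum_sub_distrib]
  exact Finset.sum_congr rfl fun _ _ => by ring

/-- Differentiate ∑ ν_i δ_i ν_j = 0. The shape operator is tangential but its ambient derivative is
not; these normal components account for the `shapeSq` terms in Simons' identity. -/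
theorem sum_normal_mul_deriv_shape (k j : ι) :
    ∑ i, ν i * δ k (δ i (ν j)) = - shapeSq δ ν k j := by
  have := congrArg (δ k) (h.normal (ν j))
  simp only [map_sum, Derivation.leibniz, smul_eq_mul, map_zero, Finset.sum_add_distrib] at this
  rw [eq_neg_iff_add_eq_zero, ← this, shapeSq]
  simp_rw [mul_comm]

/-- Differentiating x · ν = 0 shows that the rulings of the cone are null directions of the second
fundamental form. -/
theorem sum_position_mul_shape (i : ι) : ∑ j, x j * δ i (ν j) = 0 := by
  have := congrArg (δ i) h.cone
  simp only [map_sum, Derivation.leibniz, smul_eq_mul, map_zero, Finset.sum_add_distrib,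
    h.position, mul_sub, mul_ite, mul_one, mul_zero, Finset.sum_sub_distrib, Finset.sum_ite_eq,
    Finset.mem_univ, if_true] at this
  have e : ∑ j, ν j * (ν i * ν j) = ν i := by
    calc _ = ν i * ∑ j, ν j * ν j := by
          rw [Finset.mul_sum]; exact Finset.sum_congr rfl fun _ _ => by ring
      _ = _ := by rw [h.unit, mul_one]
  rw [e] at this
  linear_combination this

theorem sum_position_mul_deriv_shape (k i : ι) :
    ∑ j, x j * δ k (δ i (ν j)) = - δ i (ν k) := by
  have := congrArg (δ k) (h.sum_position_mul_shape i)
  simp only [map_sum, Derivation.leibniz, smul_eq_mul, map_zero, Finset.sum_add_distrib,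
    h.position, mul_sub, mul_ite, mul_one, mul_zero, Finset.sum_sub_distrib, Finset.sum_ite_eq,
    Finset.mem_univ, if_true] at this
  have e : ∑ j, δ i (ν j) * (ν k * ν j) = 0 := by
    rw [← mul_zero (ν k), ← h.sum_normal_mul_shape i, Finset.mul_sum]
    exact Finset.sum_congr rfl fun _ _ => by ring
  rw [e] at this
  linear_combination this

theorem sum_position_mul_normal_mul (a : A) : ∑ j, x j * (ν j * a) = 0 := by
  rw [← zero_mul a, ← h.cone, Finset.sum_mul]
  exact Finset.sum_congr rfl fun _ _ => by ring

theorem sum_position_mul_shapeSq (j : ι) : ∑ i, x i * shapeSq δ ν i j = 0 := by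
  unfold shapeSq
  simp_rw [Finset.mul_sum, ← mul_assoc]
  rw [Finset.sum_comm]
  simp_rw [← Finset.sum_mul]
  refine Finset.sum_eq_zero fun k _ => ?_
  simp_rw [fun i => h.symm i k]
  rw [h.sum_position_mul_shape, zero_mul]

/-- Euler's relation for the homogeneity of degree -1 of the curvature of a cone. Codazzi moves the
radial contraction from the differentiation index to a matrix index, and the normal corrections
vanish because x · ν = 0 and x is a null direction. -/
theorem sum_position_mul_radial_deriv_shape (i j : ι) :
    ∑ k, x k * δ k (δ i (ν j)) = - δ i (ν j) := by
  have e (k) : δ k (δ i (ν j)) = δ i (δ j (ν k)) + (ν k * shapeSq δ ν i j - ν i * shapeSq δ ν k j) := by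
    rw [← h.codazzi, h.symm j k]; ring
  have e2 : ∑ k, x k * (ν i * shapeSq δ ν k j) = 0 := by
    rw [← mul_zero (ν i), ← h.sum_position_mul_shapeSq j, Finset.mul_sum]
    exact Finset.sum_congr rfl fun _ _ => by ring
  simp_rw [e, mul_add, mul_sub, Finset.sum_add_distrib, Finset.sum_sub_distrib]
  rw [h.sum_position_mul_deriv_shape, h.sum_position_mul_normal_mul, e2, h.symm j i]
  ring

theorem sum_position_mul_deriv_shapeNormSq :
    ∑ k, x k * δ k (shapeNormSq δ ν) = - (2 * shapeNormSq δ ν) := by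
  unfold shapeNormSq
  simp only [map_sum, Derivation.leibniz, smul_eq_mul, Finset.mul_sum]
  rw [Finset.sum_comm, ← Finset.sum_neg_distrib]
  refine Finset.sum_congr rfl fun i _ => ?_
  rw [Finset.sum_comm, ← Finset.sum_neg_distrib]
  refine Finset.sum_congr rfl fun j _ => ?_
  have := h.sum_position_mul_radial_deriv_shape i j
  calc _ = 2 * δ i (ν j) * ∑ k, x k * δ k (δ i (ν j)) := by
        rw [Finset.mul_sum]; exact Finset.sum_congr rfl fun _ _ => by ring
    _ = _ := by rw [this]; ring

/-- The Jacobi equation Δν = -|II|² ν. Codazzi turns the left side into the derivative of the mean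
curvature, which is zero, plus a trace of the squared form. -/
theorem sum_deriv_shape (j : ι) :
    ∑ k, δ k (δ k (ν j)) = - (ν j * shapeNormSq δ ν) := by
  have e (k) : δ k (δ k (ν j)) = δ j (δ k (ν k)) + (ν k * shapeSq δ ν j k - ν j * shapeSq δ ν k k) := by
    rw [← h.codazzi, h.symm k j]; ring
  simp_rw [e, Finset.sum_add_distrib, Finset.sum_sub_distrib, ← map_sum, h.minimal]
  simp_rw [fun k => h.shapeSq_symm j k, h.sum_normal_mul_shapeSq, ← Finset.mul_sum]
  have : ∑ k, shapeSq δ ν k k = shapeNormSq δ ν := by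
    unfold shapeSq shapeNormSq
    exact Finset.sum_congr rfl fun i _ => Finset.sum_congr rfl fun j _ => by rw [h.symm j i]
  rw [this, map_zero]; ring

/-- Simons' formula for the Laplacian of the second fundamental form, up to normal components. -/
theorem laplacian_shape : ∃ R : ι → A, ∀ i j, ∑ k, δ k (δ k (δ i (ν j))) =
    - (shapeNormSq δ ν * δ i (ν j)) - 2 * ∑ l, δ i (ν l) * shapeSq δ ν l j
      - ν j * δ i (shapeNormSq δ ν) - ν i * R j := by
  -- The witness collects all terms with a factor ν_i; its value is irrelevant, since contraction
  -- with a tangential tensor removes them.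
  refine ⟨fun j => ∑ k, δ k (shapeSq δ ν k j) +
    ∑ k, ∑ l, δ k (ν l) * δ l (δ k (ν j)), fun i j => ?_⟩
  have e (k) : δ k (δ i (ν j)) = δ i (δ k (ν j)) +
      (ν k * shapeSq δ ν i j - ν i * shapeSq δ ν k j) := by
    rw [← h.codazzi]; ring
  -- Commuting δ_k past δ_i brings the Laplacian of ν_j to the front, which `sum_deriv_shape`
  -- evaluates.
  have e2 : ∑ k, δ k (δ i (δ k (ν j))) = - δ i (ν j * shapeNormSq δ ν) +
      ∑ k, ∑ l, (ν k * δ i (ν l) - ν i * δ k (ν l)) * δ l (δ k (ν j)) := by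
    rw [← map_neg, ← h.sum_deriv_shape, map_sum, ← Finset.sum_add_distrib]
    refine Finset.sum_congr rfl fun k _ => ?_
    rw [← h.comm]; ring
  have e3 : ∑ k, ∑ l, (ν k * δ i (ν l)) * δ l (δ k (ν j)) =
      - ∑ l, δ i (ν l) * shapeSq δ ν l j := by
    rw [Finset.sum_comm, ← Finset.sum_neg_distrib]
    refine Finset.sum_congr rfl fun l _ => ?_
    rw [← mul_neg, ← h.sum_normal_mul_deriv_shape, Finset.mul_sum]
    exact Finset.sum_congr rfl fun _ _ => by ring
  have e4 : ∑ k, ∑ l, (ν i * δ k (ν l)) * δ l (δ k (ν j)) =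
      ν i * ∑ k, ∑ l, δ k (ν l) * δ l (δ k (ν j)) := by
    simp_rw [Finset.mul_sum, mul_assoc]
  have e5 : ∑ k, shapeSq δ ν i j * δ k (ν k) = 0 := by
    rw [← Finset.mul_sum, h.minimal, mul_zero]
  have e6 : ∑ k, shapeSq δ ν k j * δ k (ν i) = ∑ l, δ i (ν l) * shapeSq δ ν l j := by
    refine Finset.sum_congr rfl fun k _ => ?_
    rw [h.symm k i, mul_comm]
  simp_rw [fun k => congrArg (δ k) (e k), map_add, map_sub, Derivation.leibniz, smul_eq_mul,
    Finset.sum_add_distrib, Finset.sum_sub_distrib, Finset.sum_add_distrib]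
  rw [e2, h.normal, e5, e6]
  simp_rw [sub_mul, Finset.sum_sub_distrib]
  rw [e3, e4, Derivation.leibniz, smul_eq_mul, smul_eq_mul, ← Finset.mul_sum]
  ring

/-- The contraction with δ_i ν_j, tangential in both indices, kills the two normal terms of
`laplacian_shape`. -/
theorem sum_shape_mul_laplacian_shape :
    ∑ i, ∑ j, δ i (ν j) * ∑ k, δ k (δ k (δ i (ν j))) =
      - (shapeNormSq δ ν * shapeNormSq δ ν) - 2 * ∑ i, ∑ j, shapeSq δ ν i j * shapeSq δ ν i j := by
  obtain ⟨R, hR⟩ := h.laplacian_shape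
  have e1 : ∑ i, ∑ j, δ i (ν j) * (ν j * δ i (shapeNormSq δ ν)) = 0 := by
    refine Finset.sum_eq_zero fun i _ => ?_
    rw [← zero_mul (δ i (shapeNormSq δ ν)), ← h.sum_normal_mul_shape i, Finset.sum_mul]
    exact Finset.sum_congr rfl fun _ _ => by ring
  have e2 : ∑ i, ∑ j, δ i (ν j) * (ν i * R j) = 0 := by
    rw [Finset.sum_comm]
    refine Finset.sum_eq_zero fun j _ => ?_
    rw [← zero_mul (R j), ← h.normal (ν j), Finset.sum_mul]
    exact Finset.sum_congr rfl fun _ _ => by ring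
  have e3 : ∑ i, ∑ j, δ i (ν j) * ∑ l, δ i (ν l) * shapeSq δ ν l j =
      ∑ i, ∑ j, shapeSq δ ν i j * shapeSq δ ν i j := by
    have : ∀ l j, shapeSq δ ν l j = ∑ i, δ i (ν l) * δ i (ν j) := fun l j =>
      Finset.sum_congr rfl fun i _ => by rw [h.symm l i]
    calc _ = ∑ i, ∑ j, ∑ l, (δ i (ν l) * δ i (ν j)) * shapeSq δ ν l j := by
          simp_rw [Finset.mul_sum]
          refine Finset.sum_congr rfl fun _ _ => Finset.sum_congr rfl fun _ _ =>
            Finset.sum_congr rfl fun _ _ => by ring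
      _ = ∑ i, ∑ l, ∑ j, (δ i (ν l) * δ i (ν j)) * shapeSq δ ν l j :=
          Finset.sum_congr rfl fun _ _ => Finset.sum_comm
      _ = ∑ l, ∑ j, ∑ i, (δ i (ν l) * δ i (ν j)) * shapeSq δ ν l j := by
          rw [Finset.sum_comm]
          exact Finset.sum_congr rfl fun _ _ => Finset.sum_comm
      _ = _ := by
          simp_rw [← Finset.sum_mul, ← this]
  simp_rw [hR, mul_sub, Finset.sum_sub_distrib]
  rw [e1, e2, ← e3, shapeNormSq]
  simp_rw [Finset.mul_sum, Finset.sum_mul, mul_neg, Finset.sum_neg_distrib]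
  simp only [sub_zero]
  congr 1
  · congr 1
    simp_rw [Finset.mul_sum]
    refine Finset.sum_congr rfl fun _ _ => Finset.sum_congr rfl fun _ _ =>
      Finset.sum_congr rfl fun _ _ => Finset.sum_congr rfl fun _ _ => by ring
  · refine Finset.sum_congr rfl fun _ _ => Finset.sum_congr rfl fun _ _ =>
      Finset.sum_congr rfl fun _ _ => by ring

/-- Simons' identity. -/
theorem laplacian_shapeNormSq : ∑ k, δ k (δ k (shapeNormSq δ ν)) =
    2 * (∑ k, ∑ i, ∑ j, δ k (δ i (ν j)) * δ k (δ i (ν j))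
      - 2 * ∑ i, ∑ j, shapeSq δ ν i j * shapeSq δ ν i j - shapeNormSq δ ν * shapeNormSq δ ν) := by
  have e1 (k) : δ k (δ k (shapeNormSq δ ν)) = 2 * ∑ i, ∑ j, δ k (δ i (ν j)) * δ k (δ i (ν j)) +
      2 * ∑ i, ∑ j, δ i (ν j) * δ k (δ k (δ i (ν j))) := by
    simp only [shapeNormSq, map_sum, Derivation.leibniz, smul_eq_mul, map_add, Finset.mul_sum,
      ← Finset.sum_add_distrib]
    exact Finset.sum_congr rfl fun _ _ => Finset.sum_congr rfl fun _ _ => by ring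
  have e2 : ∑ k, ∑ i, ∑ j, δ i (ν j) * δ k (δ k (δ i (ν j))) =
      ∑ i, ∑ j, δ i (ν j) * ∑ k, δ k (δ k (δ i (ν j))) := by
    simp_rw [Finset.mul_sum]
    rw [Finset.sum_comm]
    exact Finset.sum_congr rfl fun _ _ => Finset.sum_comm
  simp_rw [e1, Finset.sum_add_distrib, ← Finset.mul_sum, e2, h.sum_shape_mul_laplacian_shape]
  ring

end IsMinimalConeCalculus

/-! ### Improved Kato inequality on a cone -/

/-- The algebraic content of the improved Kato inequality on a cone: `D` is the derivative of the
second fundamental form `b`, `b2` is its square, `N` the normal and `y` the position vector. -/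
theorem kato_cone {ι : Type*} [Fintype ι] (N y : ι → ℝ) (b b2 : ι → ι → ℝ)
    (D : ι → ι → ι → ℝ) (hN : ∑ i, N i * N i = 1) (hNb : ∀ i, ∑ j, N j * b i j = 0)
    (hNb2 : ∀ i, ∑ j, N j * b2 i j = 0) (hyN : ∑ i, y i * N i = 0)
    (hyb : ∀ i, ∑ j, y j * b i j = 0) (hb : ∀ i j, b i j = b j i) (hb2 : ∀ i j, b2 i j = b2 j i)
    (hD : ∀ k i j, D k i j = D k j i)
    (hDc : ∀ k i j, D k i j - D i k j = N k * b2 i j - N i * b2 k j)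
    (hND : ∀ k j, ∑ i, N i * D k i j = - b2 k j) (hyD : ∀ k i, ∑ j, y j * D k i j = - b i k)
    (hy : 0 < ∑ i, y i * y i) :
    2 * (∑ i, ∑ j, b i j * b i j) / ∑ i, y i * y i ≤
      ∑ k, ∑ i, ∑ j, D k i j * D k i j - 2 * ∑ i, ∑ j, b2 i j * b2 i j ∧
    ∑ k, (∑ i, ∑ j, D k i j * b i j) ^ 2 ≤ (∑ i, ∑ j, b i j * b i j) *
      (∑ k, ∑ i, ∑ j, D k i j * D k i j - 2 * ∑ i, ∑ j, b2 i j * b2 i j) -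
      2 * (∑ i, ∑ j, b i j * b i j) ^ 2 / ∑ i, y i * y i := by
  set r := ∑ i, y i * y i with hr
  set u := ∑ i, ∑ j, b i j * b i j with hu
  -- The tangential part of `D`, that is, the covariant derivative of the second fundamental form.
  -- It is totally symmetric, and the normal part taken away has squared norm 2 |b2|², which is the
  -- correction in Simons' identity.
  let T : ι → ι → ι → ℝ := fun k i j => D k i j + N i * b2 k j + N j * b2 k i
  have hT1 (k i j) : T k i j = T k j i := by simp only [T, hD k i j]; ring
  have hT2 (k i j) : T k i j = T i k j := by
    simp only [T]; rw [hb2 k i]; linarith [hDc k i j]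
  have hyT (k i) : ∑ j, y j * T k i j = - b k i := by
    have e1 : ∑ j, y j * (N i * b2 k j) = 0 := by
      have : ∑ j, y j * b2 k j = 0 := by
        have : ∀ j, b2 k j = - ∑ l, N l * D k l j := fun j => by rw [hND]; ring
        simp_rw [this, mul_neg, Finset.mul_sum, Finset.sum_neg_distrib]
        rw [Finset.sum_comm]
        have : ∀ l, ∑ j, y j * (N l * D k l j) = - (N l * b k l) := fun l => by
          rw [hb k l, ← mul_neg, ← hyD, Finset.mul_sum]
          exact Finset.sum_congr rfl fun _ _ => by ring
        simp_rw [this, Finset.sum_neg_distrib, hNb, neg_zero]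
      rw [← mul_zero (N i), ← this, Finset.mul_sum]
      exact Finset.sum_congr rfl fun _ _ => by ring
    have e2 : ∑ j, y j * (N j * b2 k i) = 0 := by
      rw [← zero_mul (b2 k i), ← hyN, Finset.sum_mul]
      exact Finset.sum_congr rfl fun _ _ => by ring
    simp only [T, mul_add, Finset.sum_add_distrib, e1, e2, hyD, hb k i]
    ring
  have hTb (k) : ∑ i, ∑ j, T k i j * b i j = ∑ i, ∑ j, D k i j * b i j := by
    have e1 : ∑ i, ∑ j, (N i * b2 k j) * b i j = 0 := by
      rw [Finset.sum_comm]
      refine Finset.sum_eq_zero fun j _ => ?_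
      rw [← mul_zero (b2 k j), ← hNb j, Finset.mul_sum]
      exact Finset.sum_congr rfl fun i _ => by rw [hb i j]; ring
    have e2 : ∑ i, ∑ j, (N j * b2 k i) * b i j = 0 := by
      refine Finset.sum_eq_zero fun i _ => ?_
      rw [← mul_zero (b2 k i), ← hNb i, Finset.mul_sum]
      exact Finset.sum_congr rfl fun i _ => by ring
    simp only [T, add_mul, Finset.sum_add_distrib, e1, e2, add_zero]
  have hTT : ∑ k, ∑ i, ∑ j, T k i j * T k i j =
      ∑ k, ∑ i, ∑ j, D k i j * D k i j - 2 * ∑ i, ∑ j, b2 i j * b2 i j := by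
    rw [Finset.mul_sum, ← Finset.sum_sub_distrib]
    refine Finset.sum_congr rfl fun k _ => ?_
    have e1 : ∑ i, ∑ j, (N i * b2 k j) * D k i j = - ∑ j, b2 k j * b2 k j := by
      rw [Finset.sum_comm, ← Finset.sum_neg_distrib]
      refine Finset.sum_congr rfl fun j _ => ?_
      rw [← mul_neg, ← hND, Finset.mul_sum]
      exact Finset.sum_congr rfl fun _ _ => by ring
    have e1' : ∑ i, ∑ j, (N j * b2 k i) * D k i j = - ∑ j, b2 k j * b2 k j := by
      rw [Finset.sum_comm, ← e1]
      refine Finset.sum_congr rfl fun _ _ => Finset.sum_congr rfl fun _ _ => by rw [hD]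
    have e2 : ∑ i, ∑ j, (N i * b2 k j) * (N i * b2 k j) = ∑ j, b2 k j * b2 k j := by
      rw [← one_mul (∑ j, b2 k j * b2 k j), ← hN, Finset.sum_mul_sum]
      exact Finset.sum_congr rfl fun _ _ => Finset.sum_congr rfl fun _ _ => by ring
    have e2' : ∑ i, ∑ j, (N j * b2 k i) * (N j * b2 k i) = ∑ j, b2 k j * b2 k j := by
      rw [Finset.sum_comm, ← e2]
    have e3 : ∑ i, ∑ j, (N i * b2 k j) * (N j * b2 k i) = 0 := by
      refine Finset.sum_eq_zero fun i _ => ?_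
      rw [← mul_zero (N i * b2 k i), ← hNb2 k, Finset.mul_sum]
      exact Finset.sum_congr rfl fun i _ => by ring
    have : ∑ i, ∑ j, T k i j * T k i j = ∑ i, ∑ j, D k i j * D k i j
        + 2 * ∑ i, ∑ j, (N i * b2 k j) * D k i j + 2 * ∑ i, ∑ j, (N j * b2 k i) * D k i j
        + ∑ i, ∑ j, (N i * b2 k j) * (N i * b2 k j) + ∑ i, ∑ j, (N j * b2 k i) * (N j * b2 k i)
        + 2 * ∑ i, ∑ j, (N i * b2 k j) * (N j * b2 k i) := by
      simp only [Finset.mul_sum, ← Finset.sum_add_distrib, T]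
      exact Finset.sum_congr rfl fun _ _ => Finset.sum_congr rfl fun _ _ => by ring
    rw [this, e1, e1', e2, e2', e3]; ring
  rw [← hTT]
  simp_rw [← hTb]
  clear_value T
  -- The part of `T` orthogonal to `y` in every slot: contraction of `T` with `y` gives -b, so the
  -- radial part is minus the symmetrization of y ⊗ b over r = |y|².
  let M : ι → ι → ι → ℝ := fun k i j => T k i j + (y k * b i j + y i * b k j + y j * b k i) / r
  have hMb (k) : ∑ i, ∑ j, M k i j * b i j = ∑ i, ∑ j, T k i j * b i j + y k * u / r := by
    have e1 : ∑ i, ∑ j, (y i * b k j) * b i j = 0 := by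
      rw [Finset.sum_comm]
      refine Finset.sum_eq_zero fun j _ => ?_
      rw [← mul_zero (b k j), ← hyb j, Finset.mul_sum]
      exact Finset.sum_congr rfl fun i _ => by rw [hb i j]; ring
    have e2 : ∑ i, ∑ j, (y j * b k i) * b i j = 0 := by
      refine Finset.sum_eq_zero fun i _ => ?_
      rw [← mul_zero (b k i), ← hyb i, Finset.mul_sum]
      exact Finset.sum_congr rfl fun i _ => by ring
    have : ∑ i, ∑ j, M k i j * b i j = ∑ i, ∑ j, T k i j * b i j + y k / r * u
        + 1 / r * ∑ i, ∑ j, (y i * b k j) * b i j + 1 / r * ∑ i, ∑ j, (y j * b k i) * b i j := by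
      simp only [Finset.mul_sum, ← Finset.sum_add_distrib, M, hu]
      exact Finset.sum_congr rfl fun _ _ => Finset.sum_congr rfl fun _ _ => by ring
    rw [this, e1, e2]; ring
  have hMM : ∑ k, ∑ i, ∑ j, M k i j * M k i j =
      ∑ k, ∑ i, ∑ j, T k i j * T k i j - 3 * u / r := by
    have e1 : ∑ k, ∑ i, ∑ j, T k i j * (y j * b k i) = - u := by
      rw [hu, ← Finset.sum_neg_distrib]
      refine Finset.sum_congr rfl fun k _ => ?_
      rw [← Finset.sum_neg_distrib]
      refine Finset.sum_congr rfl fun i _ => ?_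
      rw [← mul_neg, ← hyT, Finset.mul_sum]
      exact Finset.sum_congr rfl fun _ _ => by ring
    have e2 : ∑ k, ∑ i, ∑ j, T k i j * (y i * b k j) = - u := by
      rw [← e1]
      refine Finset.sum_congr rfl fun k _ => ?_
      rw [Finset.sum_comm]
      exact Finset.sum_congr rfl fun _ _ => Finset.sum_congr rfl fun _ _ => by rw [hT1]
    have e3 : ∑ k, ∑ i, ∑ j, T k i j * (y k * b i j) = - u := by
      rw [← e2, Finset.sum_comm]
      exact Finset.sum_congr rfl fun _ _ => Finset.sum_congr rfl fun _ _ =>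
        Finset.sum_congr rfl fun _ _ => by rw [hT2]
    have f1 : ∑ k, ∑ i, ∑ j, (y k * b i j) * (y k * b i j) = r * u := by
      rw [hr, hu, Finset.sum_mul]
      simp_rw [Finset.mul_sum]
      exact Finset.sum_congr rfl fun _ _ => Finset.sum_congr rfl fun _ _ =>
        Finset.sum_congr rfl fun _ _ => by ring
    have f2 : ∑ k, ∑ i, ∑ j, (y i * b k j) * (y i * b k j) = r * u := by
      rw [← f1, Finset.sum_comm]
    have f3 : ∑ k, ∑ i, ∑ j, (y j * b k i) * (y j * b k i) = r * u := by
      rw [← f2]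
      exact Finset.sum_congr rfl fun _ _ => Finset.sum_comm
    have g1 : ∑ k, ∑ i, ∑ j, (y k * b i j) * (y i * b k j) = 0 := by
      refine Finset.sum_eq_zero fun k _ => ?_
      rw [Finset.sum_comm]
      refine Finset.sum_eq_zero fun j _ => ?_
      rw [← mul_zero (y k * b k j), ← hyb j, Finset.mul_sum]
      exact Finset.sum_congr rfl fun i _ => by rw [hb i j]; ring
    have g2 : ∑ k, ∑ i, ∑ j, (y k * b i j) * (y j * b k i) = 0 := by
      refine Finset.sum_eq_zero fun k _ => Finset.sum_eq_zero fun i _ => ?_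
      rw [← mul_zero (y k * b k i), ← hyb i, Finset.mul_sum]
      exact Finset.sum_congr rfl fun i _ => by ring
    have g3 : ∑ k, ∑ i, ∑ j, (y i * b k j) * (y j * b k i) = 0 := by
      refine Finset.sum_eq_zero fun k _ => Finset.sum_eq_zero fun i _ => ?_
      rw [← mul_zero (y i * b k i), ← hyb k, Finset.mul_sum]
      exact Finset.sum_congr rfl fun i _ => by ring
    have : ∑ k, ∑ i, ∑ j, M k i j * M k i j = ∑ k, ∑ i, ∑ j, T k i j * T k i j
        + 2 / r * ∑ k, ∑ i, ∑ j, T k i j * (y j * b k i)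
        + 2 / r * ∑ k, ∑ i, ∑ j, T k i j * (y i * b k j)
        + 2 / r * ∑ k, ∑ i, ∑ j, T k i j * (y k * b i j)
        + 1 / r ^ 2 * ∑ k, ∑ i, ∑ j, (y k * b i j) * (y k * b i j)
        + 1 / r ^ 2 * ∑ k, ∑ i, ∑ j, (y i * b k j) * (y i * b k j)
        + 1 / r ^ 2 * ∑ k, ∑ i, ∑ j, (y j * b k i) * (y j * b k i)
        + 2 / r ^ 2 * ∑ k, ∑ i, ∑ j, (y k * b i j) * (y i * b k j)
        + 2 / r ^ 2 * ∑ k, ∑ i, ∑ j, (y k * b i j) * (y j * b k i)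
        + 2 / r ^ 2 * ∑ k, ∑ i, ∑ j, (y i * b k j) * (y j * b k i) := by
      simp only [Finset.mul_sum, ← Finset.sum_add_distrib, M]
      exact Finset.sum_congr rfl fun _ _ => Finset.sum_congr rfl fun _ _ =>
        Finset.sum_congr rfl fun _ _ => by ring
    rw [this, e1, e2, e3, f1, f2, f3, g1, g2, g3]
    field_simp
    ring
  -- Cauchy–Schwarz is applied after removal of the radial part. That part contributes 3u/r to |T|²,
  -- one for each slot, but only u²/r to the sum of squares on the left; the difference is the gain
  -- of 2.
  have hcs : ∑ k, (∑ i, ∑ j, M k i j * b i j) ^ 2 ≤ u * ∑ k, ∑ i, ∑ j, M k i j * M k i j := by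
    rw [Finset.mul_sum]
    refine Finset.sum_le_sum fun k _ => ?_
    have := Finset.sum_mul_sq_le_sq_mul_sq (Finset.univ : Finset (ι × ι))
      (fun p => M k p.1 p.2) (fun p => b p.1 p.2)
    simp only [Fintype.sum_prod_type] at this
    simp only [hu, ← sq]
    linarith
  have hyτ : ∑ k, y k * ∑ i, ∑ j, T k i j * b i j = - u := by
    have : ∀ k i j, y k * (T k i j * b i j) = (y k * T i j k) * b i j := fun k i j => by
      rw [hT2 k i j, hT1 i k j]; ring
    simp_rw [Finset.mul_sum, this]
    rw [Finset.sum_comm, hu, ← Finset.sum_neg_distrib]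
    refine Finset.sum_congr rfl fun i _ => ?_
    rw [Finset.sum_comm, ← Finset.sum_neg_distrib]
    refine Finset.sum_congr rfl fun j _ => ?_
    rw [← Finset.sum_mul, hyT]; ring
  have hu0 : 0 ≤ u := Finset.sum_nonneg fun i _ => Finset.sum_nonneg fun j _ => mul_self_nonneg _
  have hM0 : 0 ≤ ∑ k, ∑ i, ∑ j, M k i j * M k i j := Finset.sum_nonneg fun k _ =>
    Finset.sum_nonneg fun i _ => Finset.sum_nonneg fun j _ => mul_self_nonneg _
  clear_value u r
  have hsq : ∑ k, (∑ i, ∑ j, M k i j * b i j) ^ 2 =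
      ∑ k, (∑ i, ∑ j, T k i j * b i j) ^ 2 - u ^ 2 / r := by
    have : ∑ k, (∑ i, ∑ j, M k i j * b i j) ^ 2 = ∑ k, (∑ i, ∑ j, T k i j * b i j) ^ 2
        + 2 * u / r * ∑ k, y k * ∑ i, ∑ j, T k i j * b i j
        + u ^ 2 / r ^ 2 * ∑ k, y k * y k := by
      simp_rw [hMb]
      rw [Finset.mul_sum, Finset.mul_sum, ← Finset.sum_add_distrib, ← Finset.sum_add_distrib]
      exact Finset.sum_congr rfl fun _ _ => by ring
    rw [this, hyτ, ← hr]
    field_simp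
    ring
  rw [hMM, sub_nonneg] at hM0
  refine ⟨(div_le_div_of_nonneg_right (by linarith) hy.le).trans hM0, ?_⟩
  rw [hsq, hMM] at hcs
  have : u * (∑ k, ∑ i, ∑ j, T k i j * T k i j - 3 * u / r) =
    u * ∑ k, ∑ i, ∑ j, T k i j * T k i j - 3 * (u ^ 2 / r) := by ring
  rw [this] at hcs
  have : 2 * u ^ 2 / r = 2 * (u ^ 2 / r) := by ring
  rw [this]; linarith

/-- The improved Kato inequality and Simons' identity on a minimal cone, evaluated at a point. -/
theorem IsMinimalConeCalculus.kato {ι A : Type*} [Fintype ι] [DecidableEq ι] [CommRing A]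
    [Algebra ℝ A] {δ : ι → Derivation ℝ A A} {ν x : ι → A} (h : IsMinimalConeCalculus δ ν x)
    (ev : A →+* ℝ) (hx : 0 < ∑ i, ev (x i) * ev (x i)) :
    2 * ev (shapeNormSq δ ν) / ∑ i, ev (x i) * ev (x i) ≤
      ev (∑ k, δ k (δ k (shapeNormSq δ ν))) / 2 + ev (shapeNormSq δ ν) ^ 2 ∧
    ∑ k, ev (δ k (shapeNormSq δ ν)) ^ 2 ≤ 4 * (ev (shapeNormSq δ ν) *
      (ev (∑ k, δ k (δ k (shapeNormSq δ ν))) / 2 + ev (shapeNormSq δ ν) ^ 2) -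
      2 * ev (shapeNormSq δ ν) ^ 2 / ∑ i, ev (x i) * ev (x i)) := by
  have E {a b : A} (hab : a = b) : ev a = ev b := congrArg ev hab
  obtain ⟨key', key⟩ := kato_cone (fun i => ev (ν i)) (fun i => ev (x i)) (fun i j => ev (δ i (ν j)))
    (fun i j => ev (shapeSq δ ν i j)) (fun k i j => ev (δ k (δ i (ν j))))
    (by simpa using E h.unit) (fun i => by simpa using E (h.sum_normal_mul_shape i))
    (fun i => by
      simp_rw [h.shapeSq_symm i]; simpa using E (h.sum_normal_mul_shapeSq i))
    (by simpa using E h.cone) (fun i => by simpa using E (h.sum_position_mul_shape i))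
    (fun i j => E (h.symm i j)) (fun i j => E (h.shapeSq_symm i j))
    (fun k i j => by rw [h.symm i j]) (fun k i j => by simpa using E (h.codazzi k i j))
    (fun k j => by simpa using E (h.sum_normal_mul_deriv_shape k j))
    (fun k i => by simpa using E (h.sum_position_mul_deriv_shape k i)) hx
  have hu : ∑ i, ∑ j, ev (δ i (ν j)) * ev (δ i (ν j)) = ev (shapeNormSq δ ν) := by
    simp [shapeNormSq]
  have hd (k) : ev (δ k (shapeNormSq δ ν)) =
      2 * ∑ i, ∑ j, ev (δ k (δ i (ν j))) * ev (δ i (ν j)) := by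
    simp only [shapeNormSq, map_sum, Derivation.leibniz, smul_eq_mul, map_add, map_mul,
      Finset.mul_sum]
    exact Finset.sum_congr rfl fun _ _ => Finset.sum_congr rfl fun _ _ => by ring
  have hs := E h.laplacian_shapeNormSq
  simp only [map_mul, map_sub, map_ofNat] at hs
  have h3 : ev (∑ k, ∑ i, ∑ j, δ k (δ i (ν j)) * δ k (δ i (ν j))) =
      ∑ k, ∑ i, ∑ j, ev (δ k (δ i (ν j))) * ev (δ k (δ i (ν j))) := by simp
  have h4 : ev (∑ i, ∑ j, shapeSq δ ν i j * shapeSq δ ν i j) =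
      ∑ i, ∑ j, ev (shapeSq δ ν i j) * ev (shapeSq δ ν i j) := by simp
  rw [hu] at key key'
  rw [hs, h3, h4]
  refine ⟨by linear_combination key', ?_⟩
  simp_rw [hd, mul_pow, ← Finset.mul_sum]
  linear_combination 4 * key

end Hypersurface

end

/-! ### Tangential calculus on an oriented hypersurface -/

noncomputable section

open Filter Topology
open scoped RealInnerProductSpace

namespace Hypersurface

variable {n : ℕ} {S : Set (EuclideanSpace ℝ (Fin (n + 1)))}
  {ν : EuclideanSpace ℝ (Fin (n + 1)) → EuclideanSpace ℝ (Fin (n + 1))}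

theorem IsOriented.exists_local_defining (h : IsOriented S ν)
    {p : EuclideanSpace ℝ (Fin (n + 1))} (hp : p ∈ S) :
    ∃ (U : Set (EuclideanSpace ℝ (Fin (n + 1)))) (F : EuclideanSpace ℝ (Fin (n + 1)) → ℝ),
      IsOpen U ∧ p ∈ U ∧ ContDiffOn ℝ ∞ F U ∧ S ∩ U = {x | x ∈ U ∧ F x = 0} ∧
      ∀ x ∈ S ∩ U, ‖∇ F x‖ ≠ 0 ∧ (∀ v, fderiv ℝ F x v = ‖∇ F x‖ * ⟪ν x, v⟫) := by
  obtain ⟨U, F, hU, hpU, hF, hSU, hν⟩ := h.local_defining p hp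
  refine ⟨U, F, hU, hpU, hF, hSU, fun x hx => ?_⟩
  have h0 : ‖∇ F x‖ ≠ 0 := norm_ne_zero_iff.2 (hν x hx).1
  refine ⟨h0, fun v => ?_⟩
  rw [(hν x hx).2, real_inner_smul_left, inner_gradient_left, mul_inv_cancel_left₀ h0]

theorem IsOriented.norm_eq_one (h : IsOriented S ν) {x : EuclideanSpace ℝ (Fin (n + 1))}
    (hx : x ∈ S) : ‖ν x‖ = 1 := by
  obtain ⟨U, F, hU, hpU, hF, hSU, hν⟩ := h.local_defining x hx
  obtain ⟨h0, h1⟩ := hν x ⟨hx, hpU⟩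
  rw [h1, norm_smul, norm_inv, norm_norm, inv_mul_cancel₀ (norm_ne_zero_iff.2 h0)]

theorem IsOriented.inner_self (h : IsOriented S ν) {x : EuclideanSpace ℝ (Fin (n + 1))}
    (hx : x ∈ S) : ⟪ν x, ν x⟫ = 1 := by
  rw [real_inner_self_eq_norm_sq, h.norm_eq_one hx, one_pow]

theorem IsOriented.contDiffAt (h : IsOriented S ν) {x : EuclideanSpace ℝ (Fin (n + 1))}
    (hx : x ∈ S) : ContDiffAt ℝ ∞ ν x := by
  obtain ⟨V, hV, hSV, hν⟩ := h.smooth_normal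
  exact hν.contDiffAt (hV.mem_nhds (hSV hx))

/-- The tangential derivatives of a function at a point of `S` only depend on its values on `S`. -/
theorem IsOriented.fderiv_eq (h : IsOriented S ν) {p : EuclideanSpace ℝ (Fin (n + 1))}
    (hp : p ∈ S) {f g : EuclideanSpace ℝ (Fin (n + 1)) → ℝ} (hf : ContDiffAt ℝ 1 f p)
    (hg : ContDiffAt ℝ 1 g p) (hfg : f =ᶠ[𝓝[S] p] g) {v : EuclideanSpace ℝ (Fin (n + 1))}
    (hv : ⟪ν p, v⟫ = 0) : fderiv ℝ f p v = fderiv ℝ g p v := by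
  obtain ⟨U, F, hU, hpU, hF, hSU, hν⟩ := h.exists_local_defining hp
  obtain ⟨h0, h1⟩ := hν p ⟨hp, hpU⟩
  have hFp : F p = 0 := (hSU.subset ⟨hp, hpU⟩).2
  have hnhds : 𝓝[{x | F x = F p}] p = 𝓝[S] p := by
    refine nhdsWithin_eq_nhdsWithin hpU hU ?_
    rw [hSU, hFp]
    ext x; exact and_comm
  have hfgp : f p = g p := hfg.self_of_nhdsWithin hp
  -- As f - g vanishes on S near p, the point p is an extremum of f - g under the constraint F = F
  -- p. Lagrange's rule makes d(f - g) a multiple of dF, which annihilates tangent vectors; the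
  -- multiplier of d(f - g) is nonzero because dF(ν) ≠ 0.
  have hext : IsLocalExtrOn (f - g) {x | F x = F p} p := by
    left
    change ∀ᶠ x in 𝓝[{x | F x = F p}] p, _
    rw [hnhds]
    filter_upwards [hfg] with x hx
    simp [hx, hfgp]
  have hFs := (hF.contDiffAt (hU.mem_nhds hpU)).hasStrictFDerivAt (by simp)
  have hfs := (hf.hasStrictFDerivAt one_ne_zero).sub (hg.hasStrictFDerivAt one_ne_zero)
  obtain ⟨a, b, hab, e⟩ := hext.exists_multipliers_of_hasStrictFDerivAt_1d hFs hfs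
  have hb : b ≠ 0 := by
    rintro rfl
    have := DFunLike.congr_fun e (ν p)
    simp only [zero_smul, add_zero, smul_apply, h1, h.inner_self hp, mul_one,
      smul_eq_mul, zero_apply, mul_eq_zero, h0, or_false] at this
    simp [this] at hab
  have := DFunLike.congr_fun e v
  simp only [add_apply, smul_apply, h1, hv, mul_zero,
    zero_add, sub_apply, zero_apply,
    smul_eq_mul, mul_eq_zero, hb, false_or] at this
  linarith

/-- The algebra of smooth functions on `S`: those which extend smoothly to a neighbourhood. -/
def smoothFunctions (S : Set (EuclideanSpace ℝ (Fin (n + 1)))) : Subalgebra ℝ (S → ℝ) where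
  carrier := {f | ∃ (V : Set (EuclideanSpace ℝ (Fin (n + 1))))
    (g : EuclideanSpace ℝ (Fin (n + 1)) → ℝ), IsOpen V ∧ S ⊆ V ∧ ContDiffOn ℝ ∞ g V ∧
      ∀ x : S, g x = f x}
  mul_mem' := by
    rintro f₁ f₂ ⟨V₁, g₁, hV₁, hS₁, hg₁, h₁⟩ ⟨V₂, g₂, hV₂, hS₂, hg₂, h₂⟩
    exact ⟨V₁ ∩ V₂, fun x => g₁ x * g₂ x, hV₁.inter hV₂, Set.subset_inter hS₁ hS₂,
      (hg₁.mono Set.inter_subset_left).mul (hg₂.mono Set.inter_subset_right),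
      fun x => by simp [h₁, h₂]⟩
  add_mem' := by
    rintro f₁ f₂ ⟨V₁, g₁, hV₁, hS₁, hg₁, h₁⟩ ⟨V₂, g₂, hV₂, hS₂, hg₂, h₂⟩
    exact ⟨V₁ ∩ V₂, fun x => g₁ x + g₂ x, hV₁.inter hV₂, Set.subset_inter hS₁ hS₂,
      (hg₁.mono Set.inter_subset_left).add (hg₂.mono Set.inter_subset_right),
      fun x => by simp [h₁, h₂]⟩
  algebraMap_mem' r :=
    ⟨Set.univ, fun _ => r, isOpen_univ, Set.subset_univ _, contDiffOn_const, fun x => rfl⟩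

namespace smoothFunctions

/-- A smooth extension of a smooth function on `S`. -/
def extension (f : smoothFunctions S) : EuclideanSpace ℝ (Fin (n + 1)) → ℝ :=
  f.2.choose_spec.choose

theorem extension_spec (f : smoothFunctions S) : ∃ V : Set (EuclideanSpace ℝ (Fin (n + 1))),
    IsOpen V ∧ S ⊆ V ∧ ContDiffOn ℝ ∞ (extension f) V ∧
      ∀ x : S, extension f x = (f : S → ℝ) x :=
  ⟨f.2.choose, f.2.choose_spec.choose_spec⟩

theorem extension_apply (f : smoothFunctions S) (x : S) : extension f x = (f : S → ℝ) x := by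
  obtain ⟨V, -, -, -, h⟩ := extension_spec f
  exact h x

theorem contDiffAt_extension (f : smoothFunctions S) (x : S) :
    ContDiffAt ℝ ∞ (extension f) x := by
  obtain ⟨V, hV, hSV, h, -⟩ := extension_spec f
  exact h.contDiffAt (hV.mem_nhds (hSV x.2))

theorem continuous (f : smoothFunctions S) : Continuous (f : S → ℝ) := by
  rw [continuous_iff_continuousAt]
  intro x
  have : ContinuousAt (fun y : S => extension f y) x :=
    (contDiffAt_extension f x).continuousAt.comp continuousAt_subtype_val
  simpa only [extension_apply] using this

/-- A smooth function on the ambient space, restricted to `S`. -/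
def restrict (g : EuclideanSpace ℝ (Fin (n + 1)) → ℝ) {V : Set (EuclideanSpace ℝ (Fin (n + 1)))}
    (hV : IsOpen V) (hS : S ⊆ V) (hg : ContDiffOn ℝ ∞ g V) : smoothFunctions S :=
  ⟨fun x => g x, V, g, hV, hS, hg, fun _ => rfl⟩

/-- Evaluation at a point. -/
def eval (x : S) : smoothFunctions S →+* ℝ where
  toFun f := (f : S → ℝ) x
  map_one' := rfl
  map_mul' _ _ := rfl
  map_zero' := rfl
  map_add' _ _ := rfl

theorem eval_apply (x : S) (f : smoothFunctions S) : eval x f = (f : S → ℝ) x := rfl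

end smoothFunctions

open smoothFunctions

/-- The tangential part of the `i`-th coordinate vector. -/
def tangentVector (ν : EuclideanSpace ℝ (Fin (n + 1)) → EuclideanSpace ℝ (Fin (n + 1)))
    (i : Fin (n + 1)) (x : EuclideanSpace ℝ (Fin (n + 1))) : EuclideanSpace ℝ (Fin (n + 1)) :=
  EuclideanSpace.single i 1 - ν x i • ν x

theorem IsOriented.inner_tangentVector (h : IsOriented S ν) {x : EuclideanSpace ℝ (Fin (n + 1))}
    (hx : x ∈ S) (i : Fin (n + 1)) : ⟪ν x, tangentVector ν i x⟫ = 0 := by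
  rw [tangentVector, inner_sub_right, real_inner_smul_right, h.inner_self hx,
    EuclideanSpace.inner_single_right]
  simp

theorem tangentVector_apply (i j : Fin (n + 1)) (x : EuclideanSpace ℝ (Fin (n + 1))) :
    tangentVector ν i x j = (if i = j then 1 else 0) - ν x i * ν x j := by
  simp [tangentVector, eq_comm]

theorem IsOriented.tangentialDeriv_aux (h : IsOriented S ν) (i : Fin (n + 1))
    (f : smoothFunctions S) : (fun x : S => fderiv ℝ (extension f) x (tangentVector ν i x)) ∈
      smoothFunctions S := by
  obtain ⟨V, hV, hSV, hf, -⟩ := extension_spec f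
  obtain ⟨V', hV', hSV', hν⟩ := h.smooth_normal
  refine ⟨V ∩ V', fun x => fderiv ℝ (extension f) x (tangentVector ν i x), hV.inter hV',
    Set.subset_inter hSV hSV', ?_, fun _ => rfl⟩
  have h1 : ContDiffOn ℝ ∞ (fderiv ℝ (extension f)) (V ∩ V') :=
    (hf.fderiv_of_isOpen hV (by simp)).mono Set.inter_subset_left
  have h2 : ContDiffOn ℝ ∞ ν (V ∩ V') := hν.mono Set.inter_subset_right
  have h3 : ContDiffOn ℝ ∞ (fun x => ν x i) (V ∩ V') := contDiffOn_euclidean.1 h2 i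
  exact h1.clm_apply (contDiffOn_const.sub (h3.smul h2))

/-- The `i`-th component of the tangential gradient, as a derivation of the smooth functions. -/
def IsOriented.tangentialDeriv (h : IsOriented S ν) (i : Fin (n + 1)) :
    Derivation ℝ (smoothFunctions S) (smoothFunctions S) := by
  have key (f : smoothFunctions S) (g : EuclideanSpace ℝ (Fin (n + 1)) → ℝ) (x : S)
      (hg : ContDiffAt ℝ 1 g x) (hfg : ∀ y : S, g y = (f : S → ℝ) y) :
      fderiv ℝ (extension f) x (tangentVector ν i x) = fderiv ℝ g x (tangentVector ν i x) := by
    refine h.fderiv_eq x.2 ((contDiffAt_extension f x).of_le (by simp)) hg ?_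
      (h.inner_tangentVector x.2 i)
    filter_upwards [self_mem_nhdsWithin] with y hy
    rw [hfg ⟨y, hy⟩, ← extension_apply]
  have hd (f : smoothFunctions S) (x : S) : DifferentiableAt ℝ (extension f) x :=
    (contDiffAt_extension f x).differentiableAt (by simp)
  have hc (f : smoothFunctions S) (x : S) : ContDiffAt ℝ 1 (extension f) x :=
    (contDiffAt_extension f x).of_le (by simp)
  refine Derivation.mk' ⟨⟨fun f => ⟨_, h.tangentialDeriv_aux i f⟩, fun f g => ?_⟩,
    fun c f => ?_⟩ fun f g => ?_
  · ext x
    change fderiv ℝ (extension (f + g)) x _ =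
      fderiv ℝ (extension f) x _ + fderiv ℝ (extension g) x _
    rw [key (f + g) (extension f + extension g) x ((hc f x).add (hc g x))
      (fun y => by simp [extension_apply]), fderiv_add (hd f x) (hd g x)]
    rfl
  · ext x
    change fderiv ℝ (extension (c • f)) x _ = c * fderiv ℝ (extension f) x _
    rw [key (c • f) (c • extension f) x ((hc f x).const_smul c)
      (fun y => by simp [extension_apply]), fderiv_const_smul (hd f x)]
    rfl
  · ext x
    change fderiv ℝ (extension (f * g)) x _ =
      (f : S → ℝ) x * fderiv ℝ (extension g) x _ + (g : S → ℝ) x * fderiv ℝ (extension f) x _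
    rw [key (f * g) (fun y => extension f y * extension g y) x ((hc f x).mul (hc g x))
      (fun y => by simp [extension_apply]), fderiv_fun_mul (hd f x) (hd g x),
      extension_apply, extension_apply]
    rfl

theorem IsOriented.tangentialDeriv_apply_extension (h : IsOriented S ν) (i : Fin (n + 1))
    (f : smoothFunctions S) (x : S) :
    (h.tangentialDeriv i f : S → ℝ) x = fderiv ℝ (extension f) x (tangentVector ν i x) := rfl

theorem IsOriented.fderiv_extension (h : IsOriented S ν) (f : smoothFunctions S) (x : S)
    {g : EuclideanSpace ℝ (Fin (n + 1)) → ℝ} (hg : ContDiffAt ℝ 1 g x)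
    (hfg : ∀ᶠ y : S in 𝓝 x, g y = (f : S → ℝ) y) {v : EuclideanSpace ℝ (Fin (n + 1))}
    (hv : ⟪ν x, v⟫ = 0) : fderiv ℝ (extension f) x v = fderiv ℝ g x v := by
  refine h.fderiv_eq x.2 ((contDiffAt_extension f x).of_le (by simp)) hg ?_ hv
  rw [EventuallyEq, ← map_nhds_subtype_val, eventually_map]
  filter_upwards [hfg] with y hy
  rw [hy, extension_apply]

theorem IsOriented.tangentialDeriv_apply (h : IsOriented S ν) (i : Fin (n + 1))
    (f : smoothFunctions S) (x : S) {g : EuclideanSpace ℝ (Fin (n + 1)) → ℝ}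
    (hg : ContDiffAt ℝ 1 g x) (hfg : ∀ᶠ y : S in 𝓝 x, g y = (f : S → ℝ) y) :
    (h.tangentialDeriv i f : S → ℝ) x = fderiv ℝ g x (tangentVector ν i x) :=
  h.fderiv_extension f x hg hfg (h.inner_tangentVector x.2 i)

theorem IsOriented.contDiffAt_apply (h : IsOriented S ν) (i : Fin (n + 1)) (x : S) :
    ContDiffAt ℝ ∞ (fun y => ν y i) x := contDiffAt_euclidean.1 (h.contDiffAt x.2) i

/-- The components of the unit normal. -/
def IsOriented.normalFun (h : IsOriented S ν) (i : Fin (n + 1)) : smoothFunctions S :=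
  ⟨fun x => ν x i, by
    obtain ⟨V, hV, hSV, hν⟩ := h.smooth_normal
    exact ⟨V, fun x => ν x i, hV, hSV, contDiffOn_euclidean.1 hν i, fun _ => rfl⟩⟩

/-- The coordinate functions. -/
def coordFun (S : Set (EuclideanSpace ℝ (Fin (n + 1)))) (i : Fin (n + 1)) : smoothFunctions S :=
  restrict (fun x => x i) isOpen_univ (Set.subset_univ _)
    (contDiffOn_euclidean.1 contDiffOn_id i)

theorem IsOriented.normalFun_apply (h : IsOriented S ν) (i : Fin (n + 1)) (x : S) :
    (h.normalFun i : S → ℝ) x = ν x i := rfl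

theorem coordFun_apply (i : Fin (n + 1)) (x : S) : (coordFun S i : S → ℝ) x =
    (x : EuclideanSpace ℝ (Fin (n + 1))) i := rfl

theorem fderiv_ofLp {f : EuclideanSpace ℝ (Fin (n + 1)) → EuclideanSpace ℝ (Fin (n + 1))}
    {x : EuclideanSpace ℝ (Fin (n + 1))} (hf : DifferentiableAt ℝ f x) (i : Fin (n + 1))
    (v : EuclideanSpace ℝ (Fin (n + 1))) : fderiv ℝ (fun y => f y i) x v = fderiv ℝ f x v i := by
  have := ((EuclideanSpace.proj (𝕜 := ℝ) i).hasFDerivAt.comp x hf.hasFDerivAt).fderiv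
  exact DFunLike.congr_fun this v

theorem IsOriented.tangentialDeriv_normalFun (h : IsOriented S ν) (i j : Fin (n + 1)) (x : S) :
    (h.tangentialDeriv i (h.normalFun j) : S → ℝ) x = fderiv ℝ ν x (tangentVector ν i x) j := by
  rw [h.tangentialDeriv_apply i _ x ((h.contDiffAt_apply j x).of_le (by simp))
    (Eventually.of_forall fun _ => rfl),
    fderiv_ofLp ((h.contDiffAt x.2).differentiableAt (by simp))]

theorem IsOriented.sum_normalFun_mul_self (h : IsOriented S ν) :
    ∑ i, h.normalFun i * h.normalFun i = 1 := by
  ext x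
  have := h.inner_self x.2
  rw [PiLp.inner_apply] at this
  simpa [h.normalFun_apply, sq] using this

theorem sum_apply_smul_tangentVector {x : EuclideanSpace ℝ (Fin (n + 1))}
    (v : EuclideanSpace ℝ (Fin (n + 1))) :
    ∑ i, v i • tangentVector ν i x = v - ⟪ν x, v⟫ • ν x := by
  have h1 : ∑ i, v i • EuclideanSpace.single i (1 : ℝ) = v := by
    simpa using (EuclideanSpace.basisFun (Fin (n + 1)) ℝ).sum_repr v
  simp_rw [tangentVector, smul_sub, Finset.sum_sub_distrib, h1, smul_smul, ← Finset.sum_smul]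
  rw [PiLp.inner_apply]
  rfl

theorem IsOriented.sum_mul_tangentialDeriv (h : IsOriented S ν) (f : smoothFunctions S) (x : S)
    {v : EuclideanSpace ℝ (Fin (n + 1))} (hv : ⟪ν x, v⟫ = 0) :
    ∑ i, v i * (h.tangentialDeriv i f : S → ℝ) x = fderiv ℝ (extension f) x v := by
  simp_rw [h.tangentialDeriv_apply_extension, ← smul_eq_mul, ← map_smul, ← map_sum,
    sum_apply_smul_tangentVector, hv, zero_smul, sub_zero]

theorem IsOriented.sum_normalFun_mul_tangentialDeriv (h : IsOriented S ν)
    (f : smoothFunctions S) : ∑ i, h.normalFun i * h.tangentialDeriv i f = 0 := by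
  ext x
  change eval x _ = eval x 0
  simp only [map_sum, map_mul, eval_apply, h.normalFun_apply, h.tangentialDeriv_apply_extension]
  simp_rw [← smul_eq_mul, ← map_smul, ← map_sum, sum_apply_smul_tangentVector, h.inner_self x.2,
    one_smul, sub_self, map_zero]
  rfl

theorem IsOriented.tangentialDeriv_coordFun (h : IsOriented S ν) (i j : Fin (n + 1)) :
    h.tangentialDeriv i (coordFun S j) =
      (if i = j then 1 else 0) - h.normalFun i * h.normalFun j := by
  ext x
  have hc : ContDiffAt ℝ 1 (fun y : EuclideanSpace ℝ (Fin (n + 1)) => y j) x :=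
    contDiffAt_euclidean.1 contDiffAt_id j
  rw [h.tangentialDeriv_apply i _ x hc (Eventually.of_forall fun _ => rfl)]
  change fderiv ℝ (fun y : EuclideanSpace ℝ (Fin (n + 1)) => (id y).ofLp j) x _ = _
  rw [fderiv_ofLp differentiableAt_id, fderiv_id]
  simp only [ContinuousLinearMap.id_apply, tangentVector_apply]
  split_ifs <;> rfl

theorem IsOriented.inner_fderiv_normal (h : IsOriented S ν) (x : S)
    {v : EuclideanSpace ℝ (Fin (n + 1))} (hv : ⟪ν x, v⟫ = 0) : ⟪ν x, fderiv ℝ ν x v⟫ = 0 := by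
  have hd : DifferentiableAt ℝ ν x := (h.contDiffAt x.2).differentiableAt (by simp)
  have h1 : ContDiffAt ℝ 1 ν x := (h.contDiffAt x.2).of_le (by simp)
  have := h.fderiv_eq x.2 (f := fun y => ⟪ν y, ν y⟫) (g := fun _ => 1) (h1.inner ℝ h1)
    contDiffAt_const (by
      filter_upwards [self_mem_nhdsWithin] with y hy
      exact h.inner_self hy) hv
  rw [fderiv_inner_apply ℝ hd hd] at this
  simp only [fderiv_fun_const, Pi.zero_apply, zero_apply] at this
  rw [real_inner_comm (ν x) (fderiv ℝ ν x v)] at this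
  linarith

/-- The second fundamental form is symmetric. -/
theorem IsOriented.inner_fderiv_symm (h : IsOriented S ν) (x : S)
    {v w : EuclideanSpace ℝ (Fin (n + 1))} (hv : ⟪ν x, v⟫ = 0) (hw : ⟪ν x, w⟫ = 0) :
    ⟪fderiv ℝ ν x v, w⟫ = ⟪fderiv ℝ ν x w, v⟫ := by
  obtain ⟨U, F, hU, hpU, hF, hSU, hν⟩ := h.exists_local_defining x.2
  have hF0 : ContDiffAt ℝ ∞ F x := hF.contDiffAt (hU.mem_nhds hpU)
  have hF1 : ContDiffAt ℝ 1 (fderiv ℝ F) x := hF0.fderiv_right (by norm_cast)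
  have hd : DifferentiableAt ℝ ν x := (h.contDiffAt x.2).differentiableAt (by simp)
  have h1 : ContDiffAt ℝ 1 ν x := (h.contDiffAt x.2).of_le (by simp)
  have hsymm := hF0.isSymmSndFDerivAt (by simp; norm_cast)
  obtain ⟨h0, e0⟩ := hν x ⟨x.2, hpU⟩
  have key (v w : EuclideanSpace ℝ (Fin (n + 1))) (hv : ⟪ν x, v⟫ = 0) (hw : ⟪ν x, w⟫ = 0) :
      ‖∇ F x‖ * ⟪fderiv ℝ ν x v, w⟫ = fderiv ℝ (fderiv ℝ F) x v w := by
    have h2 : ContDiffAt ℝ 1 (fun y => fderiv ℝ F y (ν y)) x := hF1.clm_apply h1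
    -- Along S one has dF(w) = dF(ν) ⟨ν, w⟩. Differentiated in the tangential direction v at x,
    -- where ⟨ν, w⟩ = 0, this identifies the form, up to the factor |∇F|, with the symmetric Hessian
    -- of F.
    have := h.fderiv_eq x.2 (f := fun y => fderiv ℝ F y (ν y) * ⟪ν y, w⟫)
      (g := fun y => fderiv ℝ F y w) (h2.mul (h1.inner ℝ contDiffAt_const))
      (hF1.clm_apply contDiffAt_const) (by
        filter_upwards [self_mem_nhdsWithin, mem_nhdsWithin_of_mem_nhds (hU.mem_nhds hpU)]
          with y hy hyU
        rw [(hν y ⟨hy, hyU⟩).2, (hν y ⟨hy, hyU⟩).2, h.inner_self hy, mul_one]) hv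
    rw [fderiv_fun_mul (h2.differentiableAt one_ne_zero)
      ((h1.inner ℝ contDiffAt_const).differentiableAt one_ne_zero)] at this
    rw [fderiv_clm_apply (hF1.differentiableAt one_ne_zero) (differentiableAt_const w)] at this
    simp only [add_apply, smul_apply, hw, zero_smul,
      add_zero, e0, h.inner_self x.2, mul_one,
      fderiv_inner_apply ℝ hd (differentiableAt_const w)] at this
    simpa using this
  refine mul_left_cancel₀ h0 ?_
  rw [key v w hv hw, key w v hw hv, hsymm]

theorem IsOriented.tangentialDeriv_normalFun_symm (h : IsOriented S ν) (i j : Fin (n + 1)) :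
    h.tangentialDeriv i (h.normalFun j) = h.tangentialDeriv j (h.normalFun i) := by
  ext x
  have key (i j : Fin (n + 1)) : fderiv ℝ ν x (tangentVector ν i x) j =
      ⟪fderiv ℝ ν x (tangentVector ν i x), tangentVector ν j x⟫ := by
    rw [tangentVector.eq_1 ν j, inner_sub_right, real_inner_smul_right, real_inner_comm (ν x),
      h.inner_fderiv_normal x (h.inner_tangentVector x.2 i), EuclideanSpace.inner_single_right]
    simp
  rw [h.tangentialDeriv_normalFun, h.tangentialDeriv_normalFun, key, key,
    h.inner_fderiv_symm x (h.inner_tangentVector x.2 i) (h.inner_tangentVector x.2 j)]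

/-- The second derivatives of an extension cancel by symmetry. Its derivative along ν, which depends
on the extension, is multiplied by δ_i ν_j and cancels by symmetry of the shape operator. What
survives comes from differentiating ν inside the projected coordinate vectors. -/
theorem IsOriented.tangentialDeriv_comm (h : IsOriented S ν) (i j : Fin (n + 1))
    (f : smoothFunctions S) :
    h.tangentialDeriv i (h.tangentialDeriv j f) - h.tangentialDeriv j (h.tangentialDeriv i f) =
    ∑ k, (h.normalFun i * h.tangentialDeriv j (h.normalFun k) -
      h.normalFun j * h.tangentialDeriv i (h.normalFun k)) * h.tangentialDeriv k f := by
  ext x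
  have hd : DifferentiableAt ℝ ν x := (h.contDiffAt x.2).differentiableAt (by simp)
  have hf := contDiffAt_extension f x
  have hf1 : ContDiffAt ℝ 1 (fderiv ℝ (extension f)) x := hf.fderiv_right (by norm_cast)
  have h1 : ContDiffAt ℝ 1 ν x := (h.contDiffAt x.2).of_le (by simp)
  have hsymm := hf.isSymmSndFDerivAt (by simp; norm_cast)
  have h2 (i) : ContDiffAt ℝ 1 (tangentVector ν i) x :=
    contDiffAt_const.sub (((h.contDiffAt_apply i x).of_le (by simp)).smul h1)
  have key (i j : Fin (n + 1)) :
      (h.tangentialDeriv i (h.tangentialDeriv j f) : S → ℝ) x =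
      fderiv ℝ (fderiv ℝ (extension f)) x (tangentVector ν i x) (tangentVector ν j x) -
      ν x j * fderiv ℝ (extension f) x (fderiv ℝ ν x (tangentVector ν i x)) -
      fderiv ℝ ν x (tangentVector ν i x) j * fderiv ℝ (extension f) x (ν x) := by
    rw [h.tangentialDeriv_apply i _ x (hf1.clm_apply (h2 j)) (Eventually.of_forall fun _ => rfl),
      fderiv_clm_apply (hf1.differentiableAt one_ne_zero) ((h2 j).differentiableAt one_ne_zero)]
    have e : fderiv ℝ (tangentVector ν j) x = - (ν x j • fderiv ℝ ν x +
        (fderiv ℝ (fun y => ν y j) x).smulRight (ν x)) := by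
      have e1 : tangentVector ν j = fun y => EuclideanSpace.single j 1 - ν y j • ν y := rfl
      rw [e1, fderiv_const_sub, fderiv_fun_smul
        ((h.contDiffAt_apply j x).differentiableAt (by simp)) hd]
    rw [e]
    simp only [add_apply, ContinuousLinearMap.comp_apply,
      ContinuousLinearMap.flip_apply, neg_apply,
      smul_apply, ContinuousLinearMap.smulRight_apply, map_neg, map_add,
      map_smul, smul_eq_mul, fderiv_ofLp hd]
    ring
  have hs (i) : fderiv ℝ (extension f) x (fderiv ℝ ν x (tangentVector ν i x)) =
      ∑ k, (h.tangentialDeriv i (h.normalFun k) : S → ℝ) x * (h.tangentialDeriv k f : S → ℝ) x := by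
    rw [← h.sum_mul_tangentialDeriv f x
      (h.inner_fderiv_normal x (h.inner_tangentVector x.2 i))]
    simp_rw [h.tangentialDeriv_normalFun]
  have hB : fderiv ℝ ν x (tangentVector ν i x) j = fderiv ℝ ν x (tangentVector ν j x) i := by
    rw [← h.tangentialDeriv_normalFun, ← h.tangentialDeriv_normalFun,
      h.tangentialDeriv_normalFun_symm]
  simp only [AddSubgroupClass.coe_sub, Pi.sub_apply, AddSubmonoidClass.coe_finsetSum,
    Finset.sum_apply, MulMemClass.coe_mul, Pi.mul_apply, h.normalFun_apply]
  rw [key, key, hs, hs, hB, hsymm, Finset.mul_sum, Finset.mul_sum]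
  simp only [sub_mul, Finset.sum_sub_distrib, mul_assoc]
  ring

theorem IsOriented.tangentProj_apply (h : IsOriented S ν) {x : EuclideanSpace ℝ (Fin (n + 1))}
    (hx : x ∈ S) (v : EuclideanSpace ℝ (Fin (n + 1))) :
    tangentProj ν x v = v - ⟪ν x, v⟫ • ν x := by
  rw [tangentProj, Submodule.starProjection_orthogonal, sub_apply,
    Submodule.starProjection_unit_singleton ℝ (h.norm_eq_one hx)]
  rfl

theorem IsOriented.tangentProj_single (h : IsOriented S ν) {x : EuclideanSpace ℝ (Fin (n + 1))}
    (hx : x ∈ S) (i : Fin (n + 1)) :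
    tangentProj ν x (EuclideanSpace.single i 1) = tangentVector ν i x := by
  rw [h.tangentProj_apply hx, EuclideanSpace.inner_single_right, tangentVector]
  simp

theorem IsOriented.secondFundamentalForm_single (h : IsOriented S ν) (x : S) (i : Fin (n + 1)) :
    secondFundamentalForm ν x (EuclideanSpace.single i 1) =
      - fderiv ℝ ν x (tangentVector ν i x) := by
  simp only [secondFundamentalForm, neg_apply, ContinuousLinearMap.comp_apply,
    h.tangentProj_single x.2]
  rw [h.tangentProj_apply x.2, h.inner_fderiv_normal x (h.inner_tangentVector x.2 i), zero_smul,
    sub_zero]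

theorem IsOriented.curvatureSq_eq (h : IsOriented S ν) (x : S) :
    curvatureSq ν x = ((shapeNormSq h.tangentialDeriv h.normalFun : smoothFunctions S) : S → ℝ) x := by
  change _ = eval x (shapeNormSq h.tangentialDeriv h.normalFun)
  simp only [curvatureSq, EuclideanSpace.basisFun_apply, h.secondFundamentalForm_single, norm_neg,
    EuclideanSpace.real_norm_sq_eq, shapeNormSq, map_sum, map_mul, eval_apply,
    h.tangentialDeriv_normalFun]
  simp only [sq]

theorem IsOriented.meanCurvature_eq (h : IsOriented S ν) (x : S) :
    meanCurvature ν x = - (∑ i, h.tangentialDeriv i (h.normalFun i) : S → ℝ) x := by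
  rw [meanCurvature, LinearMap.trace_eq_sum_inner _ (EuclideanSpace.basisFun (Fin (n + 1)) ℝ)]
  simp only [EuclideanSpace.basisFun_apply, ContinuousLinearMap.coe_coe,
    h.secondFundamentalForm_single, EuclideanSpace.inner_single_left, Finset.sum_apply,
    h.tangentialDeriv_normalFun]
  simp

theorem IsOriented.norm_tangentialGradient_sq (h : IsOriented S ν) (f : smoothFunctions S) (x : S)
    {g : EuclideanSpace ℝ (Fin (n + 1)) → ℝ} (hg : ContDiffAt ℝ 1 g x)
    (hfg : ∀ᶠ y : S in 𝓝 x, g y = (f : S → ℝ) y) :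
    ‖tangentialGradient ν g x‖ ^ 2 = ∑ i, (h.tangentialDeriv i f : S → ℝ) x ^ 2 := by
  rw [EuclideanSpace.real_norm_sq_eq, tangentialGradient]
  refine Finset.sum_congr rfl fun i _ => ?_
  rw [h.tangentialDeriv_apply i f x hg hfg, h.tangentProj_apply x.2, ← inner_gradient_left,
    tangentVector, inner_sub_right, real_inner_smul_right, EuclideanSpace.inner_single_right]
  simp [mul_comm]

/-- On a cone, the position vector is tangential. -/
theorem IsOriented.inner_position (h : IsOriented S ν)
    (hS : ∀ t : ℝ, 0 < t → ∀ x ∈ S, t • x ∈ S) {x : EuclideanSpace ℝ (Fin (n + 1))}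
    (hx : x ∈ S) : ⟪ν x, x⟫ = 0 := by
  obtain ⟨U, F, hU, hpU, hF, hSU, hν⟩ := h.exists_local_defining hx
  obtain ⟨h0, e0⟩ := hν x ⟨hx, hpU⟩
  have hd : HasFDerivAt F (fderiv ℝ F x) ((1 : ℝ) • x) := by
    rw [one_smul]
    exact ((hF.contDiffAt (hU.mem_nhds hpU)).differentiableAt (by simp)).hasFDerivAt
  have hl : HasDerivAt (fun t : ℝ => t • x) x 1 := by
    simpa using (hasDerivAt_id (1 : ℝ)).smul_const x
  have hd1 := hd.comp_hasDerivAt 1 hl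
  have hev : (F ∘ fun t : ℝ => t • x) =ᶠ[𝓝 1] fun _ => 0 := by
    have : ContinuousAt (fun t : ℝ => t • x) 1 := by fun_prop
    filter_upwards [this.preimage_mem_nhds (by simpa using hU.mem_nhds hpU),
      lt_mem_nhds (zero_lt_one (α := ℝ))] with t ht ht0
    exact (hSU.subset ⟨hS t ht0 x hx, ht⟩).2
  have := hd1.unique ((hasDerivAt_const 1 0).congr_of_eventuallyEq hev)
  rw [e0] at this
  exact (mul_eq_zero.1 this).resolve_left h0

theorem IsOriented.isMinimalConeCalculus (h : IsOriented S ν)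
    (hS : ∀ t : ℝ, 0 < t → ∀ x ∈ S, t • x ∈ S) (hmin : IsMinimal S ν) :
    IsMinimalConeCalculus h.tangentialDeriv h.normalFun (coordFun S) where
  unit := h.sum_normalFun_mul_self
  normal := h.sum_normalFun_mul_tangentialDeriv
  symm := h.tangentialDeriv_normalFun_symm
  comm := h.tangentialDeriv_comm
  minimal := by
    ext x
    have h1 := h.meanCurvature_eq x
    rw [hmin x x.2, Finset.sum_apply] at h1
    change eval x _ = 0
    rw [map_sum]
    exact (neg_eq_zero.1 h1.symm)
  position := h.tangentialDeriv_coordFun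
  cone := by
    ext x
    change eval x _ = 0
    have := h.inner_position hS x.2
    rw [PiLp.inner_apply] at this
    simpa [eval_apply, coordFun_apply, h.normalFun_apply] using this

end Hypersurface

end

/-! ### Graph charts -/

noncomputable section

open Filter Topology
open scoped RealInnerProductSpace

namespace Hypersurface

variable {n : ℕ} {S : Set (EuclideanSpace ℝ (Fin (n + 1)))}
  {ν : EuclideanSpace ℝ (Fin (n + 1)) → EuclideanSpace ℝ (Fin (n + 1))}

/-- The derivative of a graph map over `e^⊥` at a point where the unit normal is `m`. -/
def graphDeriv (m e : EuclideanSpace ℝ (Fin (n + 1))) :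
    (ℝ ∙ e)ᗮ →L[ℝ] EuclideanSpace ℝ (Fin (n + 1)) :=
  (ℝ ∙ e)ᗮ.subtypeL - ((⟪m, e⟫)⁻¹ • (innerSL ℝ m ∘L (ℝ ∙ e)ᗮ.subtypeL)).smulRight e

theorem graphDeriv_apply (m e : EuclideanSpace ℝ (Fin (n + 1))) (v : (ℝ ∙ e)ᗮ) :
    graphDeriv m e v = (v : EuclideanSpace ℝ (Fin (n + 1))) - ((⟪m, e⟫)⁻¹ * ⟪m, v⟫) • e := rfl

theorem inner_graphDeriv {m e : EuclideanSpace ℝ (Fin (n + 1))} (hm : ⟪m, e⟫ ≠ 0)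
    (v : (ℝ ∙ e)ᗮ) : ⟪m, graphDeriv m e v⟫ = 0 := by
  rw [graphDeriv_apply, inner_sub_right, real_inner_smul_right]
  field_simp
  ring

/-- `Φ` parametrizes `S ∩ U` as a graph over the open set `D` of the hyperplane `e^⊥`. -/
structure IsGraphChart (S : Set (EuclideanSpace ℝ (Fin (n + 1))))
    (ν : EuclideanSpace ℝ (Fin (n + 1)) → EuclideanSpace ℝ (Fin (n + 1)))
    (e : EuclideanSpace ℝ (Fin (n + 1))) (D : Set (ℝ ∙ e)ᗮ)
    (U : Set (EuclideanSpace ℝ (Fin (n + 1))))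
    (Φ : (ℝ ∙ e)ᗮ → EuclideanSpace ℝ (Fin (n + 1))) : Prop where
  norm_eq_one : ‖e‖ = 1
  isOpen_domain : IsOpen D
  isOpen_range : IsOpen U
  mem : ∀ y ∈ D, Φ y ∈ S ∩ U
  proj : ∀ y ∈ D, (ℝ ∙ e)ᗮ.orthogonalProjectionOnto (Φ y) = y
  proj_mem : ∀ x ∈ S ∩ U, (ℝ ∙ e)ᗮ.orthogonalProjectionOnto x ∈ D
  apply_proj : ∀ x ∈ S ∩ U, Φ ((ℝ ∙ e)ᗮ.orthogonalProjectionOnto x) = x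
  angle : ∀ x ∈ S ∩ U, 1 / 2 < ⟪ν x, e⟫
  deriv : ∀ y ∈ D, HasStrictFDerivAt Φ (graphDeriv (ν (Φ y)) e) y

theorem coe_orthogonalProjectionOnto {e : EuclideanSpace ℝ (Fin (n + 1))} (he : ‖e‖ = 1)
    (x : EuclideanSpace ℝ (Fin (n + 1))) :
    ((ℝ ∙ e)ᗮ.orthogonalProjectionOnto x : EuclideanSpace ℝ (Fin (n + 1))) =
      x - ⟪e, x⟫ • e := by
  rw [← Submodule.starProjection_apply, Submodule.starProjection_orthogonal,
    sub_apply, Submodule.starProjection_unit_singleton ℝ he]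
  rfl

/-- Every point of `S` has a neighbourhood in which `S` is a graph over its tangent plane. -/
theorem IsOriented.exists_graphChart (h : IsOriented S ν) {p : EuclideanSpace ℝ (Fin (n + 1))}
    (hp : p ∈ S) {e : EuclideanSpace ℝ (Fin (n + 1))} (he : e = ν p) :
    ∃ (r : ℝ) (U : Set (EuclideanSpace ℝ (Fin (n + 1))))
      (Φ : (ℝ ∙ e)ᗮ → EuclideanSpace ℝ (Fin (n + 1))), 0 < r ∧ p ∈ U ∧
      IsGraphChart S ν e (Metric.ball ((ℝ ∙ e)ᗮ.orthogonalProjectionOnto p) r) U Φ := by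
  obtain ⟨U₀, F, hU₀, hpU₀, hF, hSU, hν⟩ := h.exists_local_defining hp
  have he1 : ‖e‖ = 1 := he ▸ h.norm_eq_one hp
  have hee : ⟪e, e⟫ = 1 := he ▸ h.inner_self hp
  set c := ‖∇ F p‖ with hc
  have hc0 : c ≠ 0 := (hν p ⟨hp, hpU₀⟩).1
  -- `Θ` replaces the e-coordinate of x by F(x)/c and keeps the projection to e^⊥. It therefore
  -- straightens S to e^⊥, and the factor c⁻¹ makes its derivative at p the identity.
  let Θ : EuclideanSpace ℝ (Fin (n + 1)) → EuclideanSpace ℝ (Fin (n + 1)) :=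
    fun x => x + (c⁻¹ * F x - ⟪e, x⟫) • e
  let dΘ : EuclideanSpace ℝ (Fin (n + 1)) → EuclideanSpace ℝ (Fin (n + 1)) →L[ℝ]
      EuclideanSpace ℝ (Fin (n + 1)) := fun x =>
    ContinuousLinearMap.id ℝ _ + (c⁻¹ • fderiv ℝ F x - innerSL ℝ e).smulRight e
  have hΘ : ∀ x ∈ U₀, HasStrictFDerivAt Θ (dΘ x) x := fun x hx =>
    (hasStrictFDerivAt_id x).add (((((hF.contDiffAt (hU₀.mem_nhds hx)).hasStrictFDerivAt
      (by simp)).const_mul c⁻¹).sub (innerSL ℝ e).hasStrictFDerivAt).smul_const e)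
  have hdp : dΘ p = (ContinuousLinearEquiv.refl ℝ (EuclideanSpace ℝ (Fin (n + 1))) :
      EuclideanSpace ℝ (Fin (n + 1)) →L[ℝ] EuclideanSpace ℝ (Fin (n + 1))) := by
    ext1 v
    have := (hν p ⟨hp, hpU₀⟩).2 v
    simp only [dΘ, add_apply, ContinuousLinearMap.id_apply, ContinuousLinearMap.smulRight_apply,
      sub_apply, smul_apply, innerSL_apply_apply, this, smul_eq_mul, ← hc,
      inv_mul_cancel_left₀ hc0, ← he, sub_self, zero_smul, add_zero]
    rfl
  have hsp : HasStrictFDerivAt Θ ((ContinuousLinearEquiv.refl ℝ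
      (EuclideanSpace ℝ (Fin (n + 1))) : EuclideanSpace ℝ (Fin (n + 1)) →L[ℝ] _)) p :=
    by rw [← hdp]; exact hΘ p hpU₀
  obtain ⟨G, hG, hpG⟩ : ∃ G : OpenPartialHomeomorph (EuclideanSpace ℝ (Fin (n + 1)))
      (EuclideanSpace ℝ (Fin (n + 1))), ⇑G = Θ ∧ p ∈ G.source :=
    ⟨hsp.toOpenPartialHomeomorph Θ, rfl, hsp.mem_toOpenPartialHomeomorph_source⟩
  have hN : {x | x ∈ U₀ ∧ 1 / 2 < ⟪ν x, e⟫} ∈ 𝓝 p := by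
    have h1 : ContinuousAt (fun x => ⟪ν x, e⟫) p :=
      (h.contDiffAt hp).continuousAt.inner continuousAt_const
    have h2 : (1 / 2 : ℝ) < ⟪ν p, e⟫ := by rw [← he, hee]; norm_num
    filter_upwards [hU₀.mem_nhds hpU₀, h1.eventually (lt_mem_nhds h2)] with x hx hx'
    exact ⟨hx, hx'⟩
  obtain ⟨N, hNsub, hNo, hpN⟩ := mem_nhds_iff.1 hN
  have hΘe (x) : ⟪e, Θ x⟫ = c⁻¹ * F x := by
    simp only [Θ, inner_add_right, real_inner_smul_right, hee]; ring
  have hPΘ (x) : (ℝ ∙ e)ᗮ.orthogonalProjectionOnto (Θ x) =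
      (ℝ ∙ e)ᗮ.orthogonalProjectionOnto x := by
    ext1
    rw [coe_orthogonalProjectionOnto he1, coe_orthogonalProjectionOnto he1, hΘe]
    simp only [Θ]
    module
  have hΘS : ∀ x ∈ S ∩ U₀, Θ x =
      ((ℝ ∙ e)ᗮ.orthogonalProjectionOnto x : EuclideanSpace ℝ (Fin (n + 1))) := fun x hx => by
    have : F x = 0 := (hSU.subset hx).2
    rw [coe_orthogonalProjectionOnto he1]
    simp only [Θ, this]
    module
  let T : Set (ℝ ∙ e)ᗮ := Subtype.val ⁻¹' (G.target ∩ G.symm ⁻¹' N)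
  have hTo : IsOpen T := (G.isOpen_inter_preimage_symm hNo).preimage continuous_subtype_val
  have hpT : (ℝ ∙ e)ᗮ.orthogonalProjectionOnto p ∈ T := by
    refine Set.mem_preimage.2 ?_
    rw [← hΘS p ⟨hp, hpU₀⟩, ← hG]
    refine ⟨G.map_source hpG, ?_⟩
    rw [Set.mem_preimage, G.left_inv hpG]
    exact hpN
  obtain ⟨r, hr, hrT⟩ := Metric.isOpen_iff.1 hTo _ hpT
  obtain ⟨D, hD⟩ : ∃ D, D = Metric.ball ((ℝ ∙ e)ᗮ.orthogonalProjectionOnto p) r := ⟨_, rfl⟩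
  rw [← hD] at hrT
  have hDo : IsOpen D := hD ▸ Metric.isOpen_ball
  obtain ⟨U, hU⟩ : ∃ U, U = (G.source ∩ N) ∩ (ℝ ∙ e)ᗮ.orthogonalProjectionOnto ⁻¹' D := ⟨_, rfl⟩
  have hmem : ∀ y ∈ D, G.symm y ∈ S ∩ U ∧
      (ℝ ∙ e)ᗮ.orthogonalProjectionOnto (G.symm y) = y := by
    intro y hy
    obtain ⟨hy1, hy2⟩ := hrT hy
    have h1 : Θ (G.symm y) = y := by rw [← hG]; exact G.right_inv hy1
    have h2 : (ℝ ∙ e)ᗮ.orthogonalProjectionOnto (G.symm y) = y := by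
      rw [← hPΘ, h1]
      exact Submodule.orthogonalProjectionOnto_mem_subspace_eq_self y
    have h3 : F (G.symm y) = 0 := by
      have := hΘe (G.symm y)
      rw [h1, Submodule.mem_orthogonal_singleton_iff_inner_right.1 y.2] at this
      exact (mul_eq_zero.1 this.symm).resolve_left (inv_ne_zero hc0)
    refine ⟨⟨(hSU.superset ⟨(hNsub hy2).1, h3⟩).1, hU ▸ ⟨⟨G.map_target hy1, hy2⟩, ?_⟩⟩, h2⟩
    rw [Set.mem_preimage, h2]
    exact hy
  have hpU : p ∈ U := by
    rw [hU, hD, Set.mem_inter_iff, Set.mem_preimage]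
    exact ⟨⟨hpG, hpN⟩, Metric.mem_ball_self hr⟩
  have hUo : IsOpen U := by
    rw [hU]
    exact (G.open_source.inter hNo).inter (hDo.preimage (ContinuousLinearMap.continuous _))
  rw [hU] at hpU hUo hmem
  refine ⟨r, _, fun y => G.symm y, hr, hpU, ?_⟩
  rw [← hD]
  refine ⟨he1, hDo, hUo, fun y hy => (hmem y hy).1,
    fun y hy => (hmem y hy).2, fun x hx => hx.2.2, fun x hx => ?_,
    fun x hx => (hNsub hx.2.1.2).2, fun y hy => ?_⟩
  · rw [← hΘS x ⟨hx.1, (hNsub hx.2.1.2).1⟩, ← hG, G.left_inv hx.2.1.1]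
  · obtain ⟨⟨hyS, hyU⟩, -⟩ := hmem y hy
    set x := G.symm y with hx
    have hxU : x ∈ U₀ := (hNsub hyU.1.2).1
    have hw : 1 / 2 < ⟪ν x, e⟫ := (hNsub hyU.1.2).2
    obtain ⟨k0, hk⟩ := hν x ⟨hyS, hxU⟩
    have hdx (v) : dΘ x v = v + (c⁻¹ * (‖∇ F x‖ * ⟪ν x, v⟫) - ⟪e, v⟫) • e := by
      simp [dΘ, hk, innerSL_apply_apply]
    -- A kernel vector is a multiple s e, and dΘ(s e) = s c⁻¹ |∇F| ⟨ν, e⟩ e vanishes only for s = 0,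
    -- because ⟨ν, e⟩ > 1/2.
    have hinj : Function.Injective (dΘ x).toLinearMap := by
      rw [injective_iff_map_eq_zero]
      intro v hv
      have hv' : v + (c⁻¹ * (‖∇ F x‖ * ⟪ν x, v⟫) - ⟪e, v⟫) • e = 0 := by rw [← hdx]; exact hv
      have h1 : v = (-(c⁻¹ * (‖∇ F x‖ * ⟪ν x, v⟫) - ⟪e, v⟫)) • e := by
        rw [neg_smul]; exact eq_neg_of_add_eq_zero_left hv'
      generalize -(c⁻¹ * (‖∇ F x‖ * ⟪ν x, v⟫) - ⟪e, v⟫) = s at h1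
      subst h1
      have h2 : (c⁻¹ * (‖∇ F x‖ * (s * ⟪ν x, e⟫))) • e = 0 := by
        simp only [real_inner_smul_right, hee] at hv'
        rw [← hv']; module
      have h3 : e ≠ 0 := norm_ne_zero_iff.1 (by rw [he1]; exact one_ne_zero)
      have h4 := (smul_eq_zero.1 h2).resolve_right h3
      simp only [mul_eq_zero, inv_eq_zero, hc0, k0, false_or] at h4
      rcases h4 with h4 | h4
      · rw [h4, zero_smul]
      · rw [h4] at hw; norm_num at hw
    let L := (LinearEquiv.ofInjectiveEndo _ hinj).toContinuousLinearEquiv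
    have hL : (L : EuclideanSpace ℝ (Fin (n + 1)) →L[ℝ] EuclideanSpace ℝ (Fin (n + 1))) = dΘ x := by
      ext1 v; rfl
    have hsx : HasStrictFDerivAt G (L : EuclideanSpace ℝ (Fin (n + 1)) →L[ℝ] _) (G.symm y) := by
      rw [hL, hG]; exact hΘ x hxU
    -- The vector `graphDeriv` v is tangent to S, so dF kills it, and dΘ merely removes its
    -- e-component and returns v.
    have hder : graphDeriv (ν x) e = (L.symm : EuclideanSpace ℝ (Fin (n + 1)) →L[ℝ]
        EuclideanSpace ℝ (Fin (n + 1))) ∘L (ℝ ∙ e)ᗮ.subtypeL := by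
      ext1 v
      rw [ContinuousLinearMap.comp_apply, ContinuousLinearEquiv.coe_coe,
        ContinuousLinearEquiv.eq_symm_apply]
      change dΘ x _ = v
      rw [hdx, inner_graphDeriv (by linarith), graphDeriv_apply, inner_sub_right,
        real_inner_smul_right, hee, Submodule.mem_orthogonal_singleton_iff_inner_right.1 v.2]
      module
    rw [hder]
    exact (G.hasStrictFDerivAt_symm (hrT hy).1 hsx).comp y
      (ℝ ∙ e)ᗮ.subtypeL.hasStrictFDerivAt

end Hypersurface

end

/-! ### Area formula for graph charts -/

noncomputable section

open Filter Topology
open scoped RealInnerProductSpace NNReal ENNReal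

/-- If `f` contracts distances at most `K` times as much as `g` does, then the image of `f` is at
most `K ^ d` times as large as the image of `g`. -/
theorem MeasureTheory.Measure.euclideanHausdorffMeasure_image_le_of_dist_le {X Y Z : Type*}
    [MetricSpace Y] [MeasurableSpace Y] [BorelSpace Y] [MetricSpace Z] [MeasurableSpace Z]
    [BorelSpace Z] {f : X → Y} {g : X → Z} {A : Set X} {K : ℝ≥0} (d : ℕ)
    (h : ∀ x ∈ A, ∀ y ∈ A, dist (f x) (f y) ≤ K * dist (g x) (g y)) :
    μHE[d] (f '' A) ≤ (K : ℝ≥0∞) ^ d * μHE[d] (g '' A) := by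
  rcases A.eq_empty_or_nonempty with rfl | ⟨a, -⟩
  · simp
  have : Nonempty X := ⟨a⟩
  have hspec : ∀ z ∈ g '' A, Function.invFunOn g A z ∈ A ∧ g (Function.invFunOn g A z) = z :=
    fun z hz => ⟨Function.invFunOn_mem hz, Function.invFunOn_eq hz⟩
  have hL : LipschitzOnWith K (f ∘ Function.invFunOn g A) (g '' A) := by
    refine LipschitzOnWith.of_dist_le_mul fun x hx y hy => ?_
    have := h _ (hspec x hx).1 _ (hspec y hy).1
    rwa [(hspec x hx).2, (hspec y hy).2] at this
  have himg : f '' A = (f ∘ Function.invFunOn g A) '' (g '' A) := by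
    rw [Set.image_image]
    refine Set.image_congr fun x hx => ?_
    have h1 := hspec (g x) (Set.mem_image_of_mem g hx)
    have h2 := h x hx _ h1.1
    rw [h1.2, dist_self, mul_zero] at h2
    exact dist_le_zero.1 h2
  rw [himg, euclideanHausdorffMeasure_def, euclideanHausdorffMeasure_def, Measure.smul_apply,
    Measure.smul_apply, mul_smul_comm]
  have := hL.hausdorffMeasure_image_le (d := d) (by positivity)
  rw [ENNReal.rpow_natCast] at this
  exact smul_le_smul_of_nonneg_left this zero_le

/-- By second countability, countably many of the neighbourhoods cover the space. `disjointed`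
refines them to a measurable partition, over which both measures add up. -/
theorem MeasureTheory.Measure.le_mul_of_forall_nhds {X : Type*} [TopologicalSpace X]
    [SecondCountableTopology X] [MeasurableSpace X] [OpensMeasurableSpace X] {μ₁ μ₂ : Measure X}
    {C : ℝ≥0∞} (h : ∀ x, ∃ s ∈ 𝓝 x, ∀ A ⊆ s, MeasurableSet A → μ₁ A ≤ C * μ₂ A) {A : Set X}
    (hA : MeasurableSet A) : μ₁ A ≤ C * μ₂ A := by
  choose s hs h using h
  obtain ⟨t, ht, htc⟩ := TopologicalSpace.countable_cover_nhds
    (fun x => isOpen_interior.mem_nhds (mem_interior_iff_mem_nhds.2 (hs x)))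
  rcases t.eq_empty_or_nonempty with rfl | hne
  · have : A = ∅ := by
      rw [← Set.subset_empty_iff]
      exact (Set.subset_univ A).trans (by rw [← htc]; simp)
    simp [this]
  obtain ⟨q, hq⟩ := ht.exists_eq_range hne
  let f : ℕ → Set X := fun k => interior (s (q k))
  have hf : ⋃ k, f k = Set.univ := by
    rw [← htc, hq]; simp [f]
  have hfm (k) : MeasurableSet (disjointed f k) :=
    MeasurableSet.disjointed (fun k => isOpen_interior.measurableSet) k
  have hdec : A = ⋃ k, A ∩ disjointed f k := by
    rw [← Set.inter_iUnion, iUnion_disjointed, hf, Set.inter_univ]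
  have hdis : Pairwise (Function.onFun Disjoint fun k => A ∩ disjointed f k) :=
    (disjoint_disjointed f).mono fun i j hij =>
      hij.mono Set.inter_subset_right Set.inter_subset_right
  rw [hdec, measure_iUnion hdis fun k => hA.inter (hfm k),
    measure_iUnion hdis fun k => hA.inter (hfm k), ← ENNReal.tsum_mul_left]
  exact ENNReal.tsum_le_tsum fun k => h (q k) _
    ((Set.inter_subset_right.trans (disjointed_subset f k)).trans interior_subset)
    (hA.inter (hfm k))

theorem ENNReal.le_of_forall_one_lt_le_pow_mul {a b : ℝ≥0∞} (d : ℕ)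
    (h : ∀ K : ℝ≥0, 1 < K → a ≤ (K : ℝ≥0∞) ^ d * b) : a ≤ b := by
  have h1 : Tendsto (fun K : ℝ≥0 => (K : ℝ≥0∞) ^ d * b) (𝓝[>] 1) (𝓝 (((1 : ℝ≥0) : ℝ≥0∞) ^ d * b)) := by
    refine ENNReal.Tendsto.mul_const ?_ (by simp)
    exact ((ENNReal.continuous_pow d).comp ENNReal.continuous_coe).continuousAt.tendsto.mono_left
      nhdsWithin_le_nhds
  have h2 := ge_of_tendsto h1 (by
    filter_upwards [self_mem_nhdsWithin] with K hK using h K hK)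
  simpa using h2

namespace Hypersurface

variable {n : ℕ} {S : Set (EuclideanSpace ℝ (Fin (n + 1)))}
  {ν : EuclideanSpace ℝ (Fin (n + 1)) → EuclideanSpace ℝ (Fin (n + 1))}

theorem finrank_orthogonal_span {e : EuclideanSpace ℝ (Fin (n + 1))} (he : ‖e‖ = 1) :
    Module.finrank ℝ (ℝ ∙ e)ᗮ = n := by
  have : Fact (Module.finrank ℝ (EuclideanSpace ℝ (Fin (n + 1))) = n + 1) := ⟨by simp⟩
  exact Submodule.finrank_orthogonal_span_singleton
    (norm_ne_zero_iff.1 (by rw [he]; exact one_ne_zero))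

theorem isAddHaarMeasure_orthogonal_span {e : EuclideanSpace ℝ (Fin (n + 1))} (he : ‖e‖ = 1) :
    (μHE[n] : Measure (ℝ ∙ e)ᗮ).IsAddHaarMeasure := by
  have h : (μHE[Module.finrank ℝ (ℝ ∙ e)ᗮ] : Measure (ℝ ∙ e)ᗮ).IsAddHaarMeasure := inferInstance
  rwa [finrank_orthogonal_span he] at h

/-- The volume distortion of a graph map is the inverse of the cosine of the angle between the
tangent plane and the base plane. -/
theorem normDet_graphDeriv {m e : EuclideanSpace ℝ (Fin (n + 1))} (hm : ‖m‖ = 1) (he : ‖e‖ = 1)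
    (hw : 0 < ⟪m, e⟫) : (graphDeriv m e).toLinearMap.normDet = (⟪m, e⟫)⁻¹ := by
  set k := (⟪m, e⟫)⁻¹ with hk
  have hk0 : 0 < k := inv_pos.2 hw
  let P := (ℝ ∙ e)ᗮ.orthogonalProjectionOnto
  let ℓ : (ℝ ∙ e)ᗮ →ₗ[ℝ] ℝ := ((k ^ 2) • (innerSL ℝ m ∘L (ℝ ∙ e)ᗮ.subtypeL)).toLinearMap
  have hℓ (v) : ℓ v = k ^ 2 * ⟪m, v⟫ := rfl
  have hPm (v : (ℝ ∙ e)ᗮ) : ⟪P m, v⟫ = ⟪m, v⟫ := by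
    rw [Submodule.coe_inner, coe_orthogonalProjectionOnto he, inner_sub_left,
      real_inner_smul_left, Submodule.mem_orthogonal_singleton_iff_inner_right.1 v.2]
    ring
  -- The Gram operator is a rank-one perturbation of the identity, so its determinant is 1 + k² (1 -
  -- ⟨m, e⟩²) = k².
  have hT : LinearMap.adjoint (graphDeriv m e).toLinearMap ∘ₗ (graphDeriv m e).toLinearMap =
      LinearMap.transvection ℓ (P m) := by
    refine LinearMap.ext fun v => ext_inner_right ℝ fun u => ?_
    rw [LinearMap.comp_apply, LinearMap.adjoint_inner_left, LinearMap.transvection.apply,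
      inner_add_left, real_inner_smul_left, hPm, hℓ]
    change ⟪graphDeriv m e v, graphDeriv m e u⟫ = _
    have hv := Submodule.mem_orthogonal_singleton_iff_inner_left.1 v.2
    have hu := Submodule.mem_orthogonal_singleton_iff_inner_right.1 u.2
    rw [graphDeriv_apply, graphDeriv_apply, inner_sub_left, inner_sub_right, inner_sub_right,
      real_inner_smul_left, real_inner_smul_left, real_inner_smul_right, real_inner_smul_right,
      hu, hv, real_inner_self_eq_norm_sq, he, Submodule.coe_inner]
    ring
  have hdet := (graphDeriv m e).toLinearMap.normDet_sq
  rw [hT, LinearMap.transvection.det, hℓ, coe_orthogonalProjectionOnto he, inner_sub_right,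
    real_inner_smul_right, real_inner_self_eq_norm_sq, hm, real_inner_comm m e] at hdet
  have : (graphDeriv m e).toLinearMap.normDet ^ 2 = k ^ 2 := by
    have h1 : k * ⟪m, e⟫ = 1 := inv_mul_cancel₀ hw.ne'
    have h2 : ((graphDeriv m e).toLinearMap.normDet ^ 2 : ℝ) =
      1 + k ^ 2 * (1 ^ 2 - ⟪m, e⟫ * ⟪m, e⟫) := hdet
    rw [h2]; linear_combination -(k * ⟪m, e⟫ + 1) * h1
  exact (sq_eq_sq₀ (LinearMap.normDet_nonneg _) hk0.le).1 this

theorem measure_image_graphDeriv {m e : EuclideanSpace ℝ (Fin (n + 1))} (hm : ‖m‖ = 1)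
    (he : ‖e‖ = 1) (hw : 0 < ⟪m, e⟫) (A : Set (ℝ ∙ e)ᗮ) :
    μHE[n] (graphDeriv m e '' A) = ENNReal.ofReal (⟪m, e⟫)⁻¹ * μHE[n] A := by
  have := (graphDeriv m e).toLinearMap.euclideanHausdorffMeasure_image A
  rwa [normDet_graphDeriv hm he hw, finrank_orthogonal_span he] at this

/-- The correction is along e, orthogonal to v. This turns the linearization error c ‖x - y‖ into a
relative error in `local_comparison`. -/
theorem norm_le_norm_graphDeriv (m : EuclideanSpace ℝ (Fin (n + 1)))
    {e : EuclideanSpace ℝ (Fin (n + 1))} (v : (ℝ ∙ e)ᗮ) : ‖v‖ ≤ ‖graphDeriv m e v‖ := by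
  have hv := Submodule.mem_orthogonal_singleton_iff_inner_left.1 v.2
  have h1 : ‖graphDeriv m e v‖ * ‖graphDeriv m e v‖ = ‖v‖ * ‖v‖ +
      ‖((⟪m, e⟫)⁻¹ * ⟪m, v⟫) • e‖ * ‖((⟪m, e⟫)⁻¹ * ⟪m, v⟫) • e‖ := by
    rw [graphDeriv_apply, norm_sub_sq_eq_norm_sq_add_norm_sq_real]
    · rfl
    · rw [real_inner_smul_right, hv, mul_zero]
  nlinarith [norm_nonneg v, norm_nonneg (graphDeriv m e v), mul_self_nonneg
    ‖((⟪m, e⟫)⁻¹ * ⟪m, v⟫) • e‖]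

namespace IsGraphChart

variable {e : EuclideanSpace ℝ (Fin (n + 1))} {D : Set (ℝ ∙ e)ᗮ}
  {U : Set (EuclideanSpace ℝ (Fin (n + 1)))} {Φ : (ℝ ∙ e)ᗮ → EuclideanSpace ℝ (Fin (n + 1))}

/-- By strict differentiability, distances under Φ and under its derivative at y₀ agree near y₀ up
to the factor K in both directions; the linear map scales area exactly by the inverse cosine. -/
theorem local_comparison (hc : IsGraphChart S ν e D U Φ) (h : IsOriented S ν) {y₀ : (ℝ ∙ e)ᗮ}
    (hy₀ : y₀ ∈ D) {K : ℝ≥0} (hK : 1 < K) : ∃ s ∈ 𝓝 y₀, ∀ A ⊆ s,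
    μHE[n] (Φ '' A) ≤ (K : ℝ≥0∞) ^ n * (ENNReal.ofReal (⟪ν (Φ y₀), e⟫)⁻¹ * μHE[n] A) ∧
    ENNReal.ofReal (⟪ν (Φ y₀), e⟫)⁻¹ * μHE[n] A ≤ (K : ℝ≥0∞) ^ n * μHE[n] (Φ '' A) := by
  have hK' : (1 : ℝ) < K := by exact_mod_cast hK
  have hw := hc.angle _ (hc.mem y₀ hy₀)
  have hm : ‖ν (Φ y₀)‖ = 1 := h.norm_eq_one (hc.mem y₀ hy₀).1
  -- The two Lipschitz constants are 1 + c and 1/(1 - c). Both are at most 1 + 2c ≤ K, the second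
  -- because c ≤ 1/2.
  let c : ℝ≥0 := min ((K - 1) / 2) (1 / 2)
  have hc0 : 0 < c := lt_min (div_pos (tsub_pos_of_lt hK) two_pos) (by norm_num)
  have hcK : 1 + 2 * (c : ℝ) ≤ K := by
    have h1 : c ≤ (K - 1) / 2 := min_le_left _ _
    have h2 : (c : ℝ) ≤ (K - 1) / 2 := by
      have := NNReal.coe_le_coe.2 h1
      rwa [NNReal.coe_div, NNReal.coe_sub hK.le] at this
    linarith
  have hc2 : (c : ℝ) ≤ 1 / 2 := by
    have : c ≤ 1 / 2 := min_le_right _ _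
    exact_mod_cast this
  obtain ⟨s, hs, hlin⟩ := (hc.deriv y₀ hy₀).approximates_deriv_on_nhds (c := c) (Or.inr hc0)
  refine ⟨s, hs, fun A hA => ?_⟩
  rw [← measure_image_graphDeriv hm hc.norm_eq_one (by linarith)]
  have hc0' : (0 : ℝ) ≤ c := c.2
  have key : ∀ x ∈ A, ∀ y ∈ A, ‖Φ x - Φ y - graphDeriv (ν (Φ y₀)) e (x - y)‖ ≤
      c * ‖graphDeriv (ν (Φ y₀)) e (x - y)‖ := fun x hx y hy =>
    (hlin x (hA hx) y (hA hy)).trans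
      (mul_le_mul_of_nonneg_left (norm_le_norm_graphDeriv _ _) hc0')
  constructor
  · refine Measure.euclideanHausdorffMeasure_image_le_of_dist_le n fun x hx y hy => ?_
    have h1 := key x hx y hy
    rw [dist_eq_norm, dist_eq_norm, ← map_sub]
    set a := Φ x - Φ y
    set b := graphDeriv (ν (Φ y₀)) e (x - y)
    have h2 : ‖a‖ ≤ ‖a - b‖ + ‖b‖ := by simpa using norm_add_le (a - b) b
    nlinarith [norm_nonneg b]
  · refine Measure.euclideanHausdorffMeasure_image_le_of_dist_le n fun x hx y hy => ?_
    have h1 := key x hx y hy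
    rw [dist_eq_norm, dist_eq_norm, ← map_sub]
    set a := Φ x - Φ y
    set b := graphDeriv (ν (Φ y₀)) e (x - y)
    have h2 : ‖b‖ ≤ ‖a‖ + ‖a - b‖ := norm_le_norm_add_norm_sub' b a |>.trans (by
      rw [norm_sub_rev b a])
    nlinarith [norm_nonneg b, norm_nonneg a, mul_nonneg hc0' (norm_nonneg b),
      mul_nonneg hc0' (norm_nonneg a), mul_nonneg (by linarith : 0 ≤ 1 / 2 - (c : ℝ))
        (mul_nonneg hc0' (norm_nonneg b))]

theorem continuousOn (hc : IsGraphChart S ν e D U Φ) : ContinuousOn Φ D := fun y hy =>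
  (hc.deriv y hy).continuousAt.continuousWithinAt

theorem continuousOn_angle (hc : IsGraphChart S ν e D U Φ) (h : IsOriented S ν) :
    ContinuousOn (fun y => ⟪ν (Φ y), e⟫) D := fun y hy =>
  (((h.contDiffAt (hc.mem y hy).1).continuousAt.comp
    (hc.deriv y hy).continuousAt).inner continuousAt_const).continuousWithinAt

theorem injOn (hc : IsGraphChart S ν e D U Φ) : Set.InjOn Φ D := fun x hx y hy hxy => by
  rw [← hc.proj x hx, ← hc.proj y hy, hxy]

theorem image_eq (hc : IsGraphChart S ν e D U Φ) : Φ '' D = S ∩ U :=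
  Set.Subset.antisymm (Set.image_subset_iff.2 hc.mem)
    fun x hx => ⟨_, hc.proj_mem x hx, hc.apply_proj x hx⟩

theorem measurableEmbedding (hc : IsGraphChart S ν e D U Φ) :
    MeasurableEmbedding (fun y : D => Φ y) :=
  ContinuousOn.measurableEmbedding hc.isOpen_domain.measurableSet hc.continuousOn hc.injOn

/-- The inverse cosine of the angle between tangent plane and base plane. -/
def density (_hc : IsGraphChart S ν e D U Φ) (y : D) : ℝ≥0 :=
  Real.toNNReal (⟪ν (Φ y), e⟫)⁻¹

theorem continuous_density (hc : IsGraphChart S ν e D U Φ) (h : IsOriented S ν) :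
    Continuous hc.density := by
  refine continuous_real_toNNReal.comp (Continuous.inv₀ ?_ fun y => ?_)
  · exact continuousOn_iff_continuous_domRestrict.1 (hc.continuousOn_angle h)
  · have := hc.angle _ (hc.mem y y.2)
    exact (by linarith : 0 < ⟪ν (Φ y), e⟫).ne'

theorem density_pos (hc : IsGraphChart S ν e D U Φ) (y : D) : 0 < hc.density y := by
  have := hc.angle _ (hc.mem y y.2)
  exact Real.toNNReal_pos.2 (inv_pos.2 (by linarith))

/-- The area formula in a graph chart. -/
theorem comap_eq (hc : IsGraphChart S ν e D U Φ) (h : IsOriented S ν) :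
    (μHE[n] : Measure (EuclideanSpace ℝ (Fin (n + 1)))).comap (fun y : D => Φ y) =
    ((μHE[n] : Measure (ℝ ∙ e)ᗮ).comap (Subtype.val : D → (ℝ ∙ e)ᗮ)).withDensity
      fun y => hc.density y := by
  have hemb := hc.measurableEmbedding
  have hval := MeasurableEmbedding.subtype_coe hc.isOpen_domain.measurableSet
  set m₁ := (μHE[n] : Measure (EuclideanSpace ℝ (Fin (n + 1)))).comap (fun y : D => Φ y) with hm₁
  set m₀ := (μHE[n] : Measure (ℝ ∙ e)ᗮ).comap (Subtype.val : D → (ℝ ∙ e)ᗮ) with hm₀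
  -- The exponent is n + 1: n factors of K come from the distance comparison, one from the
  -- oscillation of the density near y₀. Letting K tend to 1 yields equality.
  have key (K : ℝ≥0) (hK : 1 < K) (y₀ : D) : ∃ s ∈ 𝓝 y₀, ∀ A ⊆ s, MeasurableSet A →
      m₁ A ≤ (K : ℝ≥0∞) ^ (n + 1) * m₀.withDensity (fun y => hc.density y) A ∧
      m₀.withDensity (fun y => hc.density y) A ≤ (K : ℝ≥0∞) ^ (n + 1) * m₁ A := by
    obtain ⟨s, hs, hA⟩ := hc.local_comparison h y₀.2 hK
    have hpos := hc.density_pos y₀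
    have hcont := (hc.continuous_density h).continuousAt (x := y₀)
    have n1 : ∀ᶠ y in 𝓝 y₀, hc.density y ≤ K * hc.density y₀ := by
      refine (hcont.eventually (gt_mem_nhds ?_)).mono fun y hy => le_of_lt hy
      exact lt_mul_of_one_lt_left hpos hK
    have n2 : ∀ᶠ y in 𝓝 y₀, hc.density y₀ ≤ K * hc.density y := by
      refine ((hcont.const_mul K).eventually (lt_mem_nhds ?_)).mono fun y hy => le_of_lt hy
      exact lt_mul_of_one_lt_left hpos hK
    refine ⟨Subtype.val ⁻¹' s ∩ {y | hc.density y ≤ K * hc.density y₀ ∧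
      hc.density y₀ ≤ K * hc.density y}, inter_mem
        (continuousAt_subtype_val.preimage_mem_nhds hs) (n1.and n2), fun A hAs hAm => ?_⟩
    have hAs' : Subtype.val '' A ⊆ s := Set.image_subset_iff.2 fun y hy => (hAs hy).1
    obtain ⟨c1, c2⟩ := hA _ hAs'
    rw [Set.image_image] at c1 c2
    have e1 : m₁ A = μHE[n] ((fun y : D => Φ y) '' A) := hemb.comap_apply _ _
    have e0 : m₀ A = μHE[n] (Subtype.val '' A) := hval.comap_apply _ _
    rw [← e1, ← e0] at c1 c2
    have hd : ENNReal.ofReal (⟪ν (Φ y₀), e⟫)⁻¹ = (hc.density y₀ : ℝ≥0∞) := rfl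
    rw [hd] at c1 c2
    rw [withDensity_apply _ hAm]
    have i1 : (hc.density y₀ : ℝ≥0∞) * m₀ A ≤ K * ∫⁻ y in A, hc.density y ∂m₀ := by
      rw [← lintegral_const_mul' _ _ ENNReal.coe_ne_top, ← setLIntegral_const]
      exact setLIntegral_mono' hAm fun y hy => by exact_mod_cast (hAs hy).2.2
    have i2 : ∫⁻ y in A, hc.density y ∂m₀ ≤ K * ((hc.density y₀ : ℝ≥0∞) * m₀ A) := by
      rw [← mul_assoc, ← setLIntegral_const]
      exact setLIntegral_mono' hAm fun y hy => by exact_mod_cast (hAs hy).2.1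
    constructor
    · calc m₁ A ≤ (K : ℝ≥0∞) ^ n * (hc.density y₀ * m₀ A) := c1
        _ ≤ (K : ℝ≥0∞) ^ n * (K * ∫⁻ y in A, hc.density y ∂m₀) := by gcongr
        _ = _ := by rw [pow_succ]; ring
    · calc _ ≤ (K : ℝ≥0∞) * ((hc.density y₀ : ℝ≥0∞) * m₀ A) := i2
        _ ≤ (K : ℝ≥0∞) * ((K : ℝ≥0∞) ^ n * m₁ A) := by gcongr
        _ = _ := by rw [pow_succ]; ring
  refine Measure.ext fun A hA => le_antisymm ?_ ?_
  · refine ENNReal.le_of_forall_one_lt_le_pow_mul (n + 1) fun K hK =>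
      Measure.le_mul_of_forall_nhds (fun y => ?_) hA
    obtain ⟨s, hs, h1⟩ := key K hK y
    exact ⟨s, hs, fun A hAs hA => (h1 A hAs hA).1⟩
  · refine ENNReal.le_of_forall_one_lt_le_pow_mul (n + 1) fun K hK =>
      Measure.le_mul_of_forall_nhds (fun y => ?_) hA
    obtain ⟨s, hs, h1⟩ := key K hK y
    exact ⟨s, hs, fun A hAs hA => (h1 A hAs hA).2⟩

theorem setIntegral_eq (hc : IsGraphChart S ν e D U Φ) (h : IsOriented S ν)
    (G : EuclideanSpace ℝ (Fin (n + 1)) → ℝ) :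
    ∫ x in S ∩ U, G x ∂μHE[n] = ∫ y in D, (⟪ν (Φ y), e⟫)⁻¹ * G (Φ y) ∂μHE[n] := by
  have hemb := hc.measurableEmbedding
  have hr : Set.range (fun y : D => Φ y) = S ∩ U := by
    rw [← hc.image_eq]; exact Set.image_eq_range Φ D |>.symm
  rw [← hr, ← hemb.map_comap, hemb.integral_map, hc.comap_eq h,
    integral_withDensity_eq_integral_smul (hc.continuous_density h).measurable,
    ← integral_subtype_comap hc.isOpen_domain.measurableSet]
  refine integral_congr_ae (Eventually.of_forall fun y => ?_)
  have := hc.angle _ (hc.mem y y.2)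
  change (hc.density y : ℝ) * _ = _
  rw [density, Real.coe_toNNReal _ (inv_nonneg.2 (by linarith))]

theorem measure_lt_top (hc : IsGraphChart S ν e D U Φ) (h : IsOriented S ν)
    (hD : Bornology.IsBounded D) : μHE[n] (S ∩ U) < ⊤ := by
  have := isAddHaarMeasure_orthogonal_span hc.norm_eq_one
  have hval := MeasurableEmbedding.subtype_coe hc.isOpen_domain.measurableSet
  have e1 := hc.measurableEmbedding.comap_apply μHE[n] Set.univ
  rw [Set.image_univ, show Set.range (fun y : D => Φ y) = S ∩ U by
    rw [← hc.image_eq]; exact Set.image_eq_range Φ D |>.symm, hc.comap_eq h,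
    withDensity_apply _ MeasurableSet.univ, Measure.restrict_univ] at e1
  rw [← e1]
  calc _ ≤ ∫⁻ y : D, 2 ∂((μHE[n] : Measure (ℝ ∙ e)ᗮ).comap (Subtype.val : D → (ℝ ∙ e)ᗮ)) := by
        refine lintegral_mono fun y => ?_
        have h1 := hc.angle _ (hc.mem y y.2)
        have : hc.density y ≤ 2 := by
          rw [density, Real.toNNReal_le_iff_le_coe]
          exact (inv_le_comm₀ (by linarith) (by norm_num)).2 (by push_cast; linarith)
        exact ENNReal.coe_le_coe.2 this
    _ = 2 * μHE[n] D := by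
        rw [lintegral_const, hval.comap_apply]; simp
    _ < ⊤ := ENNReal.mul_lt_top (by simp) hD.measure_lt_top

theorem measure_pos (hc : IsGraphChart S ν e D U Φ) (h : IsOriented S ν)
    {O : Set (EuclideanSpace ℝ (Fin (n + 1)))} (hO : IsOpen O) (hne : (S ∩ U ∩ O).Nonempty) :
    0 < μHE[n] (S ∩ U ∩ O) := by
  have := isAddHaarMeasure_orthogonal_span hc.norm_eq_one
  obtain ⟨x, hx, hxO⟩ := hne
  rw [← hc.image_eq] at hx
  obtain ⟨y, hy, rfl⟩ := hx
  obtain ⟨s, hs, hA⟩ := hc.local_comparison h hy one_lt_two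
  have hN : s ∩ (D ∩ Φ ⁻¹' O) ∈ 𝓝 y := inter_mem hs (inter_mem (hc.isOpen_domain.mem_nhds hy)
    ((hc.deriv y hy).continuousAt.preimage_mem_nhds (hO.mem_nhds hxO)))
  have h1 := (hA (s ∩ (D ∩ Φ ⁻¹' O)) Set.inter_subset_left).2
  have h2 : μHE[n] (Φ '' (s ∩ (D ∩ Φ ⁻¹' O))) ≤ μHE[n] (S ∩ U ∩ O) :=
    measure_mono (Set.image_subset_iff.2 fun z hz => ⟨hc.mem z hz.2.1, hz.2.2⟩)
  have h3 : 0 < μHE[n] (s ∩ (D ∩ Φ ⁻¹' O)) := Measure.measure_pos_of_mem_nhds _ hN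
  have h4 : 0 < ENNReal.ofReal (⟪ν (Φ y), e⟫)⁻¹ :=
    ENNReal.ofReal_pos.2 (inv_pos.2 (by linarith [hc.angle _ (hc.mem y hy)]))
  refine lt_of_lt_of_le (pos_iff_ne_zero.2 fun h0 => ?_) h2
  rw [h0, mul_zero] at h1
  exact (ENNReal.mul_pos h4.ne' h3.ne').not_ge h1

end IsGraphChart

end Hypersurface

end

/-! ### Area measure and compactly supported fields -/

noncomputable section

open Filter Topology
open scoped RealInnerProductSpace NNReal ENNReal

theorem integral_fderiv_eq_zero {E : Type*} [NormedAddCommGroup E] [NormedSpace ℝ E]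
    [FiniteDimensional ℝ E] [MeasurableSpace E] [BorelSpace E] (μ : Measure E)
    [μ.IsAddHaarMeasure] {g : E → ℝ} (hg : ContDiff ℝ 1 g) (hc : HasCompactSupport g) (v : E) :
    Integrable (fun x => fderiv ℝ g x v) μ ∧ ∫ x, fderiv ℝ g x v ∂μ = 0 := by
  have h1 : Integrable (fun x => fderiv ℝ g x v) μ :=
    ((hg.continuous_fderiv one_ne_zero).clm_apply continuous_const).integrable_of_hasCompactSupport
      (hc.fderiv_apply ℝ v)
  refine ⟨h1, ?_⟩
  have := integral_mul_fderiv_eq_neg_fderiv_mul_of_integrable (μ := μ) (f := fun _ : E => (1 : ℝ))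
    (g := g) (v := v) (by simp) (by simpa using h1)
    (by simpa using hg.continuous.integrable_of_hasCompactSupport hc)
    (fun x _ => differentiableAt_const _) (fun x _ => hg.differentiable one_ne_zero x)
  simpa using this

namespace Hypersurface

open smoothFunctions

variable {n : ℕ} {S : Set (EuclideanSpace ℝ (Fin (n + 1)))}
  {ν : EuclideanSpace ℝ (Fin (n + 1)) → EuclideanSpace ℝ (Fin (n + 1))}

/-- The `n`-dimensional area on `S`. -/
def areaMeasure (S : Set (EuclideanSpace ℝ (Fin (n + 1)))) : Measure S :=
  μHE[n].comap Subtype.val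

theorem areaMeasure_preimage (hS : MeasurableSet S) (A : Set (EuclideanSpace ℝ (Fin (n + 1)))) :
    areaMeasure S (Subtype.val ⁻¹' A) = μHE[n] (S ∩ A) := by
  rw [areaMeasure, (MeasurableEmbedding.subtype_coe hS).comap_apply,
    Subtype.image_preimage_coe]

theorem IsOriented.isLocallyFiniteMeasure (h : IsOriented S ν) (hS : MeasurableSet S) :
    IsLocallyFiniteMeasure (areaMeasure S) := by
  refine ⟨fun x => ?_⟩
  obtain ⟨r, U, Φ, hr, hxU, hc⟩ := h.exists_graphChart x.2 rfl
  refine ⟨Subtype.val ⁻¹' U, continuousAt_subtype_val.preimage_mem_nhds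
    (hc.isOpen_range.mem_nhds hxU), ?_⟩
  rw [areaMeasure_preimage hS]
  exact hc.measure_lt_top h Metric.isBounded_ball

/-- Needed at the end, to pass from the sign of a weighted integral of |II|² to pointwise vanishing.
-/
theorem IsOriented.isOpenPosMeasure (h : IsOriented S ν) (hS : MeasurableSet S) :
    (areaMeasure S).IsOpenPosMeasure := by
  refine ⟨fun O hO hne => ?_⟩
  obtain ⟨O', hO', rfl⟩ := isOpen_induced_iff.1 hO
  obtain ⟨x, hx⟩ := hne
  obtain ⟨r, U, Φ, hr, hxU, hc⟩ := h.exists_graphChart x.2 rfl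
  rw [areaMeasure_preimage hS]
  refine ((hc.measure_pos h hO' ⟨x, ⟨x.2, hxU⟩, hx⟩).trans_le (measure_mono ?_)).ne'
  exact fun y hy => ⟨hy.1.1, hy.2⟩

theorem IsOriented.integrable (h : IsOriented S ν) (hS : MeasurableSet S) {f : S → ℝ}
    (hf : Continuous f) (hc : HasCompactSupport f) : Integrable f (areaMeasure S) := by
  have := h.isLocallyFiniteMeasure hS
  exact hf.integrable_of_hasCompactSupport hc

theorem IsOriented.tsupport_tangentialDeriv_subset (h : IsOriented S ν) (i : Fin (n + 1))
    (f : smoothFunctions S) :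
    tsupport (h.tangentialDeriv i f : S → ℝ) ⊆ tsupport (f : S → ℝ) := by
  refine closure_minimal (fun x hx => ?_) (isClosed_tsupport _)
  by_contra hxf
  refine hx ?_
  rw [h.tangentialDeriv_apply i f x (g := fun _ => 0) contDiffAt_const ?_]
  · simp
  · filter_upwards [(isClosed_tsupport (f : S → ℝ)).isOpen_compl.mem_nhds hxf] with y hy
    exact (image_eq_zero_of_notMem_tsupport hy).symm

theorem IsOriented.hasCompactSupport_tangentialDeriv (h : IsOriented S ν) (i : Fin (n + 1))
    {f : smoothFunctions S} (hf : HasCompactSupport (f : S → ℝ)) :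
    HasCompactSupport (h.tangentialDeriv i f : S → ℝ) :=
  hf.of_isClosed_subset (isClosed_tsupport _) (h.tsupport_tangentialDeriv_subset i f)

theorem hasCompactSupport_finset_sum {X ι : Type*} [TopologicalSpace X] (s : Finset ι)
    {f : ι → X → ℝ} (hf : ∀ i ∈ s, HasCompactSupport (f i)) :
    HasCompactSupport (fun x => ∑ i ∈ s, f i x) := by
  classical
  induction s using Finset.induction_on with
  | empty =>
    simp only [Finset.sum_empty]
    exact (HasCompactSupport.zero : HasCompactSupport (0 : X → ℝ))
  | insert a s ha ih =>
    simp only [Finset.sum_insert ha]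
    exact (hf a (Finset.mem_insert_self a s)).add
      (ih fun i hi => hf i (Finset.mem_insert_of_mem hi))

/-- The divergence of a tangential vector field. -/
def IsOriented.div (h : IsOriented S ν) (X : Fin (n + 1) → smoothFunctions S) :
    smoothFunctions S := ∑ i, h.tangentialDeriv i (X i)

theorem IsOriented.div_apply (h : IsOriented S ν) (X : Fin (n + 1) → smoothFunctions S) (x : S) :
    (h.div X : S → ℝ) x = ∑ i, (h.tangentialDeriv i (X i) : S → ℝ) x := by
  change eval x (h.div X) = _
  simp only [div, map_sum, eval_apply]

theorem IsOriented.hasCompactSupport_div (h : IsOriented S ν)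
    {X : Fin (n + 1) → smoothFunctions S} (hX : ∀ i, HasCompactSupport (X i : S → ℝ)) :
    HasCompactSupport (h.div X : S → ℝ) := by
  have : (h.div X : S → ℝ) = fun x => ∑ i, (h.tangentialDeriv i (X i) : S → ℝ) x :=
    funext (h.div_apply X)
  rw [this]
  exact hasCompactSupport_finset_sum _ fun i _ => h.hasCompactSupport_tangentialDeriv i (hX i)

theorem IsOriented.div_eq_zero_of_notMem (h : IsOriented S ν)
    {X : Fin (n + 1) → smoothFunctions S} {x : S} (hx : ∀ i, x ∉ tsupport (X i : S → ℝ)) :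
    (h.div X : S → ℝ) x = 0 := by
  rw [h.div_apply]
  exact Finset.sum_eq_zero fun i _ => image_eq_zero_of_notMem_tsupport fun hxi =>
    hx i (h.tsupport_tangentialDeriv_subset i (X i) hxi)

namespace IsGraphChart

variable {e : EuclideanSpace ℝ (Fin (n + 1))} {D : Set (ℝ ∙ e)ᗮ}
  {U : Set (EuclideanSpace ℝ (Fin (n + 1)))} {Φ : (ℝ ∙ e)ᗮ → EuclideanSpace ℝ (Fin (n + 1))}

theorem contDiffOn (hc : IsGraphChart S ν e D U Φ) (h : IsOriented S ν) :
    ContDiffOn ℝ 1 Φ D := by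
  have hd : ∀ y ∈ D, HasFDerivAt Φ (graphDeriv (ν (Φ y)) e) y := fun y hy =>
    (hc.deriv y hy).hasFDerivAt
  have : (1 : WithTop ℕ∞) = 0 + 1 := by simp
  rw [this, contDiffOn_succ_iff_fderiv_of_isOpen hc.isOpen_domain]
  refine ⟨fun y hy => (hd y hy).differentiableAt.differentiableWithinAt, by simp, ?_⟩
  rw [contDiffOn_zero]
  refine ContinuousOn.congr (f := fun y => graphDeriv (ν (Φ y)) e) ?_ fun y hy => (hd y hy).fderiv
  intro y hy
  have h1 : ContinuousAt (fun y => ν (Φ y)) y :=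
    (h.contDiffAt (hc.mem y hy).1).continuousAt.comp (hc.deriv y hy).continuousAt
  have h2 : ⟪ν (Φ y), e⟫ ≠ 0 := (by linarith [hc.angle _ (hc.mem y hy)] : 0 < ⟪ν (Φ y), e⟫).ne'
  have h3 : ContinuousAt (fun y => (⟪ν (Φ y), e⟫)⁻¹) y := (h1.inner continuousAt_const).inv₀ h2
  have h4 : ContinuousAt (fun y => innerSL ℝ (ν (Φ y))) y :=
    (innerSL ℝ).continuous.continuousAt.comp h1
  have h5 : ContinuousAt (fun y => innerSL ℝ (ν (Φ y)) ∘L (ℝ ∙ e)ᗮ.subtypeL) y :=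
    h4.clm_comp continuousAt_const
  have h6 : ContinuousAt (fun y => (⟪ν (Φ y), e⟫)⁻¹ •
    (innerSL ℝ (ν (Φ y)) ∘L (ℝ ∙ e)ᗮ.subtypeL)) y := h3.smul h5
  have h7 : Continuous fun ℓ : (ℝ ∙ e)ᗮ →L[ℝ] ℝ => ℓ.smulRight e :=
    (ContinuousLinearMap.smulRightL ℝ (ℝ ∙ e)ᗮ (EuclideanSpace ℝ (Fin (n + 1)))).flip e |>.continuous
  exact (continuousAt_const.sub (h7.continuousAt.comp h6)).continuousWithinAt

end IsGraphChart

end Hypersurface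

end

/-! ### Divergence theorem -/

noncomputable section

open Filter Topology
open scoped RealInnerProductSpace NNReal ENNReal Manifold

namespace Hypersurface

open smoothFunctions

variable {n : ℕ} {S : Set (EuclideanSpace ℝ (Fin (n + 1)))}
  {ν : EuclideanSpace ℝ (Fin (n + 1)) → EuclideanSpace ℝ (Fin (n + 1))}

/-- The function `⟨ν, e⟩` on `S`. -/
def IsOriented.angleFun (h : IsOriented S ν) (e : EuclideanSpace ℝ (Fin (n + 1))) :
    smoothFunctions S := ∑ k, e k • h.normalFun k

theorem IsOriented.angleFun_apply (h : IsOriented S ν) (e : EuclideanSpace ℝ (Fin (n + 1)))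
    (x : S) : (h.angleFun e : S → ℝ) x = ⟪ν x, e⟫ := by
  change eval x (h.angleFun e) = _
  rw [angleFun, map_sum, PiLp.inner_apply]
  rfl

/-- The direction on the left is the image under the chart's derivative of the i-th coordinate
vector projected to e^⊥ (`graphDeriv_single`). It is tangential, so its derivative expands in the
δ_k. -/
theorem IsOriented.fderiv_extension_oblique (h : IsOriented S ν) (f : smoothFunctions S) (x : S)
    {e : EuclideanSpace ℝ (Fin (n + 1))} (hw : ⟪ν x, e⟫ ≠ 0) (i : Fin (n + 1)) :
    fderiv ℝ (extension f) x (EuclideanSpace.single i 1 - ((⟪ν x, e⟫)⁻¹ * ν x i) • e) =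
      (h.tangentialDeriv i f : S → ℝ) x -
        (⟪ν x, e⟫)⁻¹ * ν x i * ∑ k, e k * (h.tangentialDeriv k f : S → ℝ) x := by
  rw [← h.sum_mul_tangentialDeriv f x]
  · simp only [PiLp.sub_apply, PiLp.smul_apply, smul_eq_mul, sub_mul, Finset.sum_sub_distrib,
      mul_assoc, ← Finset.mul_sum]
    simp [PiLp.single_apply]
  · rw [inner_sub_right, real_inner_smul_right, EuclideanSpace.inner_single_right]
    field_simp
    simp

/-- The pointwise identity behind the divergence theorem in a graph chart. -/
theorem IsOriented.sum_oblique_deriv (h : IsOriented S ν) (X : Fin (n + 1) → smoothFunctions S)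
    (hX : ∑ i, X i * h.normalFun i = 0) (x : S) (e : EuclideanSpace ℝ (Fin (n + 1)))
    (w : ℝ) :
    ∑ i, (w⁻¹ * ((h.tangentialDeriv i (X i) : S → ℝ) x -
        w⁻¹ * ν x i * ∑ k, e k * (h.tangentialDeriv k (X i) : S → ℝ) x) -
      (w ^ 2)⁻¹ * ((h.tangentialDeriv i (h.angleFun e) : S → ℝ) x -
        w⁻¹ * ν x i * ∑ k, e k * (h.tangentialDeriv k (h.angleFun e) : S → ℝ) x) *
        (X i : S → ℝ) x) = w⁻¹ * (h.div X : S → ℝ) x := by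
  have hXx : ∑ i, (X i : S → ℝ) x * ν x i = 0 := by
    have := congrArg (eval x) hX
    simpa only [map_sum, map_mul, map_zero, eval_apply, h.normalFun_apply] using this
  have hXd (k) : ∑ i, ν x i * (h.tangentialDeriv k (X i) : S → ℝ) x =
      - ∑ i, (X i : S → ℝ) x * (h.tangentialDeriv i (h.normalFun k) : S → ℝ) x := by
    have := congrArg (fun f => eval x (h.tangentialDeriv k f)) hX
    simp only [map_sum, map_zero, Derivation.leibniz, smul_eq_mul, map_add, map_mul, eval_apply,
      Finset.sum_add_distrib, h.normalFun_apply, h.tangentialDeriv_normalFun_symm k] at this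
    linarith
  have hW (i) : (h.tangentialDeriv i (h.angleFun e) : S → ℝ) x =
      ∑ k, e k * (h.tangentialDeriv i (h.normalFun k) : S → ℝ) x := by
    rw [← eval_apply]
    simp only [angleFun, map_sum, Derivation.map_smul]
    rfl
  -- Differentiating X · ν = 0 and using the symmetry of the shape operator moves the derivative
  -- from X to ν. The result cancels the contribution from differentiating the weight w⁻¹.
  have e1 : ∑ i, ν x i * ∑ k, e k * (h.tangentialDeriv k (X i) : S → ℝ) x =
      - ∑ i, (X i : S → ℝ) x * (h.tangentialDeriv i (h.angleFun e) : S → ℝ) x := by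
    calc _ = ∑ k, e k * ∑ i, ν x i * (h.tangentialDeriv k (X i) : S → ℝ) x := by
          simp_rw [Finset.mul_sum]
          rw [Finset.sum_comm]
          exact Finset.sum_congr rfl fun _ _ => Finset.sum_congr rfl fun _ _ => by ring
      _ = _ := by
          simp_rw [hXd, hW, Finset.mul_sum, mul_neg, Finset.sum_neg_distrib]
          rw [neg_inj]
          simp_rw [Finset.mul_sum]
          rw [Finset.sum_comm]
          exact Finset.sum_congr rfl fun _ _ => Finset.sum_congr rfl fun _ _ => by ring
  set q := ∑ k, e k * (h.tangentialDeriv k (h.angleFun e) : S → ℝ) x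
  have e2 : ∑ i, (w⁻¹ * ((h.tangentialDeriv i (X i) : S → ℝ) x -
        w⁻¹ * ν x i * ∑ k, e k * (h.tangentialDeriv k (X i) : S → ℝ) x) -
      (w ^ 2)⁻¹ * ((h.tangentialDeriv i (h.angleFun e) : S → ℝ) x -
        w⁻¹ * ν x i * q) * (X i : S → ℝ) x) =
      w⁻¹ * ∑ i, (h.tangentialDeriv i (X i) : S → ℝ) x
      - (w ^ 2)⁻¹ * ∑ i, ν x i * ∑ k, e k * (h.tangentialDeriv k (X i) : S → ℝ) x
      - (w ^ 2)⁻¹ * ∑ i, (X i : S → ℝ) x * (h.tangentialDeriv i (h.angleFun e) : S → ℝ) x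
      + (w ^ 2)⁻¹ * w⁻¹ * q * ∑ i, (X i : S → ℝ) x * ν x i := by
    simp only [Finset.mul_sum _ _ w⁻¹, Finset.mul_sum _ _ (w ^ 2)⁻¹,
      Finset.mul_sum _ _ ((w ^ 2)⁻¹ * w⁻¹ * q), ← Finset.sum_add_distrib, ← Finset.sum_sub_distrib]
    refine Finset.sum_congr rfl fun i _ => ?_
    ring
  rw [e2, e1, hXx, h.div_apply]
  ring

namespace IsGraphChart

variable {e : EuclideanSpace ℝ (Fin (n + 1))} {D : Set (ℝ ∙ e)ᗮ}
  {U : Set (EuclideanSpace ℝ (Fin (n + 1)))} {Φ : (ℝ ∙ e)ᗮ → EuclideanSpace ℝ (Fin (n + 1))}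

theorem graphDeriv_single (he : ‖e‖ = 1) {m : EuclideanSpace ℝ (Fin (n + 1))} (hm : ⟪m, e⟫ ≠ 0)
    (i : Fin (n + 1)) : graphDeriv m e ((ℝ ∙ e)ᗮ.orthogonalProjectionOnto
      (EuclideanSpace.single i 1)) = EuclideanSpace.single i 1 - ((⟪m, e⟫)⁻¹ * m i) • e := by
  rw [graphDeriv_apply, coe_orthogonalProjectionOnto he, inner_sub_right, real_inner_smul_right,
    EuclideanSpace.inner_single_right, EuclideanSpace.inner_single_right]
  simp only [one_mul, conj_trivial, mul_sub]
  rw [mul_comm (e i), inv_mul_cancel_left₀ hm]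
  module

/-- In the chart the area density is w⁻¹ with w = ⟨ν, e⟩, and by `sum_oblique_deriv` w⁻¹ div X is
the sum of the derivatives of w⁻¹ X_i along the projected coordinate vectors. Each summand is a
directional derivative of a compactly supported function on e^⊥ and integrates to zero. -/
theorem integral_div_eq_zero (hc : IsGraphChart S ν e D U Φ) (h : IsOriented S ν)
    (hS : MeasurableSet S) (X : Fin (n + 1) → smoothFunctions S)
    (hX : ∑ i, X i * h.normalFun i = 0) (hXc : ∀ i, HasCompactSupport (X i : S → ℝ))
    (hXU : ∀ i, tsupport (X i : S → ℝ) ⊆ Subtype.val ⁻¹' U) :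
    ∫ x, (h.div X : S → ℝ) x ∂areaMeasure S = 0 := by
  have := isAddHaarMeasure_orthogonal_span hc.norm_eq_one
  let W : smoothFunctions S := h.angleFun e
  let Z : Fin (n + 1) → (ℝ ∙ e)ᗮ → ℝ := fun i =>
    D.indicator fun y => (extension W (Φ y))⁻¹ * extension (X i) (Φ y)
  let v : Fin (n + 1) → (ℝ ∙ e)ᗮ := fun i =>
    (ℝ ∙ e)ᗮ.orthogonalProjectionOnto (EuclideanSpace.single i 1)
  let C : Fin (n + 1) → Set (ℝ ∙ e)ᗮ := fun i =>
    (fun x : S => (ℝ ∙ e)ᗮ.orthogonalProjectionOnto (x : EuclideanSpace ℝ (Fin (n + 1)))) ''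
      tsupport (X i : S → ℝ)
  have hCc (i) : IsCompact (C i) := (hXc i).image
    ((ContinuousLinearMap.continuous _).comp continuous_subtype_val)
  have hCD (i) : C i ⊆ D := by
    rintro _ ⟨x, hx, rfl⟩
    exact hc.proj_mem x ⟨x.2, hXU i hx⟩
  have hZ0 (i) : ∀ y ∉ C i, Z i y = 0 := by
    intro y hy
    by_cases hyD : y ∈ D
    · simp only [Z, Set.indicator_of_mem hyD]
      rw [extension_apply (X i) ⟨Φ y, (hc.mem y hyD).1⟩,
        image_eq_zero_of_notMem_tsupport fun hs => hy ⟨_, hs, hc.proj y hyD⟩, mul_zero]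
    · exact Set.indicator_of_notMem hyD _
  have hZev (i) {y} (hy : y ∈ D) :
      Z i =ᶠ[𝓝 y] fun y => (extension W (Φ y))⁻¹ * extension (X i) (Φ y) := by
    filter_upwards [hc.isOpen_domain.mem_nhds hy] with z hz
    exact Set.indicator_of_mem hz _
  have hWx {y} (hy : y ∈ D) : extension W (Φ y) = ⟪ν (Φ y), e⟫ := by
    rw [extension_apply W ⟨Φ y, (hc.mem y hy).1⟩, h.angleFun_apply]
  have hW0 {y} (hy : y ∈ D) : extension W (Φ y) ≠ 0 := by
    rw [hWx hy]
    exact (by linarith [hc.angle _ (hc.mem y hy)] : 0 < ⟪ν (Φ y), e⟫).ne'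
  have hΦ {y} (hy : y ∈ D) : ContDiffAt ℝ 1 Φ y :=
    (hc.contDiffOn h).contDiffAt (hc.isOpen_domain.mem_nhds hy)
  have hext (f : smoothFunctions S) {y} (hy : y ∈ D) : ContDiffAt ℝ 1 (extension f) (Φ y) :=
    (contDiffAt_extension f ⟨Φ y, (hc.mem y hy).1⟩).of_le (by simp)
  have hZd (i) : ContDiff ℝ 1 (Z i) := by
    rw [contDiff_iff_contDiffAt]
    intro y
    by_cases hy : y ∈ C i
    · have hyD := hCD i hy
      exact ((((hext W hyD).comp y (hΦ hyD)).inv (hW0 hyD)).mul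
        ((hext (X i) hyD).comp y (hΦ hyD))).congr_of_eventuallyEq (hZev i hyD)
    · refine (contDiffAt_const (c := (0 : ℝ))).congr_of_eventuallyEq ?_
      filter_upwards [(hCc i).isClosed.isOpen_compl.mem_nhds hy] with z hz using hZ0 i z hz
  have hZc (i) : HasCompactSupport (Z i) := HasCompactSupport.intro (hCc i) (hZ0 i)
  have hder {y} (hy : y ∈ D) : ∑ i, fderiv ℝ (Z i) y (v i) =
      (⟪ν (Φ y), e⟫)⁻¹ * extension (h.div X) (Φ y) := by
    have hw0 : ⟪ν (Φ y), e⟫ ≠ 0 := hWx hy ▸ hW0 hy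
    have hcomp (f : smoothFunctions S) : HasFDerivAt (fun y => extension f (Φ y))
        (fderiv ℝ (extension f) (Φ y) ∘L graphDeriv (ν (Φ y)) e) y :=
      ((hext f hy).differentiableAt one_ne_zero).hasFDerivAt.comp y (hc.deriv y hy).hasFDerivAt
    have hi (i) : fderiv ℝ (Z i) y (v i) =
        (⟪ν (Φ y), e⟫)⁻¹ * fderiv ℝ (extension (X i)) (Φ y)
          (EuclideanSpace.single i 1 - ((⟪ν (Φ y), e⟫)⁻¹ * ν (Φ y) i) • e) -
        (⟪ν (Φ y), e⟫ ^ 2)⁻¹ * fderiv ℝ (extension W) (Φ y)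
          (EuclideanSpace.single i 1 - ((⟪ν (Φ y), e⟫)⁻¹ * ν (Φ y) i) • e) *
          extension (X i) (Φ y) := by
      have hd : HasFDerivAt (fun y => (extension W (Φ y))⁻¹ * extension (X i) (Φ y)) _ y :=
        ((hasDerivAt_inv (hW0 hy)).comp_hasFDerivAt y (hcomp W)).mul (hcomp (X i))
      rw [(hZev i hy).fderiv_eq, hd.fderiv]
      simp only [add_apply, smul_apply, ContinuousLinearMap.comp_apply, Function.comp_apply,
        smul_eq_mul, v, graphDeriv_single hc.norm_eq_one hw0, hWx hy]
      ring
    set x : S := ⟨Φ y, (hc.mem y hy).1⟩ with hx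
    have h1 := h.sum_oblique_deriv X hX x e ⟪ν (Φ y), e⟫
    rw [extension_apply _ x, ← h1]
    refine Finset.sum_congr rfl fun i _ => ?_
    rw [hi, ← h.fderiv_extension_oblique _ x hw0, ← h.fderiv_extension_oblique _ x hw0,
      extension_apply _ x]
  have hdiv : ∀ x : S, (x : EuclideanSpace ℝ (Fin (n + 1))) ∉ U → (h.div X : S → ℝ) x = 0 :=
    fun x hx => h.div_eq_zero_of_notMem fun i hi => hx (hXU i hi)
  calc ∫ x, (h.div X : S → ℝ) x ∂areaMeasure S
      = ∫ x : S, extension (h.div X) x ∂areaMeasure S := by simp only [extension_apply]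
    _ = ∫ x in S, extension (h.div X) x ∂μHE[n] := integral_subtype_comap hS _
    _ = ∫ x in S ∩ U, extension (h.div X) x ∂μHE[n] := by
        refine setIntegral_eq_of_subset_of_forall_sdiff_eq_zero hS Set.inter_subset_left
          fun x hx => ?_
        rw [extension_apply _ ⟨x, hx.1⟩]
        exact hdiv _ fun hxU => hx.2 ⟨hx.1, hxU⟩
    _ = ∫ y in D, ∑ i, fderiv ℝ (Z i) y (v i) ∂μHE[n] := by
        rw [hc.setIntegral_eq h]
        exact setIntegral_congr_fun hc.isOpen_domain.measurableSet fun y hy => (hder hy).symm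
    _ = ∫ y, ∑ i, fderiv ℝ (Z i) y (v i) ∂μHE[n] := by
        refine setIntegral_eq_integral_of_forall_compl_eq_zero fun y hy => ?_
        refine Finset.sum_eq_zero fun i _ => ?_
        have : Z i =ᶠ[𝓝 y] fun _ => 0 := by
          filter_upwards [(hCc i).isClosed.isOpen_compl.mem_nhds fun hyC => hy (hCD i hyC)]
            with z hz using hZ0 i z hz
        rw [this.fderiv_eq]
        simp
    _ = 0 := by
        rw [integral_finsetSum _ fun i _ => (integral_fderiv_eq_zero _ (hZd i) (hZc i) (v i)).1]
        exact Finset.sum_eq_zero fun i _ => (integral_fderiv_eq_zero _ (hZd i) (hZc i) (v i)).2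

end IsGraphChart

/-- The divergence theorem for compactly supported tangential vector fields. -/
theorem IsOriented.integral_div_eq_zero (h : IsOriented S ν) (hS : MeasurableSet S)
    (X : Fin (n + 1) → smoothFunctions S) (hX : ∑ i, X i * h.normalFun i = 0)
    (hXc : ∀ i, HasCompactSupport (X i : S → ℝ)) :
    ∫ x, (h.div X : S → ℝ) x ∂areaMeasure S = 0 := by
  choose r U Φ hr hU hc using fun p : S => h.exists_graphChart p.2 rfl
  set C : Set S := ⋃ i, tsupport (X i : S → ℝ) with hC
  have hCc : IsCompact C := isCompact_iUnion hXc
  have hCc' : IsCompact (Subtype.val '' C) := hCc.image continuous_subtype_val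
  obtain ⟨t, ht⟩ := hCc'.elim_finite_subcover U (fun p => (hc p).isOpen_range) (by
    rintro _ ⟨x, -, rfl⟩
    exact Set.mem_iUnion.2 ⟨x, hU x⟩)
  -- The functions need to sum to one only on the compact set carrying X, so finitely many charts
  -- suffice.
  obtain ⟨ρ, hρ⟩ := SmoothPartitionOfUnity.exists_isSubordinate
    𝓘(ℝ, EuclideanSpace ℝ (Fin (n + 1))) hCc'.isClosed (fun p : t => U p)
    (fun p => (hc p).isOpen_range) (fun x hx => by
      obtain ⟨p, hp, hxp⟩ := Set.mem_iUnion₂.1 (ht hx)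
      exact Set.mem_iUnion.2 ⟨⟨p, hp⟩, hxp⟩)
  let R : t → smoothFunctions S := fun p => restrict (ρ p) isOpen_univ (Set.subset_univ _)
    (ρ p).contMDiff.contDiff.contDiffOn
  have hR (p : t) (x : S) : (R p : S → ℝ) x = ρ p x := rfl
  have hsum : h.div X = ∑ p, h.div (fun i => R p * X i) := by
    have hXi (i) : X i = ∑ p, R p * X i := by
      ext x
      change _ = eval x _
      rw [← Finset.sum_mul, map_mul, map_sum, eval_apply]
      simp only [eval_apply, hR]
      by_cases hx : x ∈ C
      · have := ρ.sum_eq_one (Set.mem_image_of_mem _ hx)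
        rw [finsum_eq_sum_of_fintype] at this
        rw [this, one_mul]
      · rw [image_eq_zero_of_notMem_tsupport fun hxi => hx (Set.mem_iUnion.2 ⟨i, hxi⟩), mul_zero]
    simp only [div]
    rw [Finset.sum_comm]
    refine Finset.sum_congr rfl fun i _ => ?_
    conv_lhs => rw [hXi i, map_sum]
  have hmul (p : t) (i) : ((R p * X i : smoothFunctions S) : S → ℝ) =
    (R p : S → ℝ) * (X i : S → ℝ) := rfl
  have hcs (p : t) (i) : HasCompactSupport ((R p * X i : smoothFunctions S) : S → ℝ) := by
    rw [hmul]; exact (hXc i).mul_left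
  have hpt (x : S) : (h.div X : S → ℝ) x = ∑ p, (h.div (fun i => R p * X i) : S → ℝ) x := by
    rw [hsum]
    change eval x _ = _
    rw [map_sum]
    rfl
  simp_rw [hpt]
  rw [integral_finsetSum _ fun p _ => h.integrable hS (smoothFunctions.continuous _)
    (h.hasCompactSupport_div (hcs p))]
  refine Finset.sum_eq_zero fun p _ => (hc p).integral_div_eq_zero h hS _ ?_ (hcs p) fun i => ?_
  · simp_rw [mul_assoc, ← Finset.mul_sum, hX, mul_zero]
  · rw [hmul]
    have h1 : tsupport ((R p : S → ℝ) * (X i : S → ℝ)) ⊆ tsupport (R p : S → ℝ) :=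
      tsupport_mul_subset_left
    refine h1.trans (Set.Subset.trans ?_ (Set.preimage_mono (hρ p)))
    exact closure_minimal (fun x hx => subset_tsupport _ hx)
      ((isClosed_tsupport _).preimage continuous_subtype_val)

end Hypersurface

end

/-! ### Test functions on the punctured cone -/

noncomputable section

open Filter Topology
open scoped RealInnerProductSpace NNReal ENNReal Manifold

namespace Hypersurface

open smoothFunctions

variable {n : ℕ} {K : Set (EuclideanSpace ℝ (Fin (n + 1)))}
  {ν : EuclideanSpace ℝ (Fin (n + 1)) → EuclideanSpace ℝ (Fin (n + 1))}

/-- Smooth functions with compact support on a punctured closed set extend to test functions. -/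
theorem exists_contDiff_extension (hK : IsClosed K) (f : smoothFunctions (K \ {0}))
    (hf : HasCompactSupport (f : ↥(K \ {0}) → ℝ)) :
    ∃ φ : EuclideanSpace ℝ (Fin (n + 1)) → ℝ, ContDiff ℝ ∞ φ ∧ HasCompactSupport φ ∧
      IsCompact ((K \ {0}) ∩ tsupport φ) ∧ ∀ x : ↥(K \ {0}), φ x = (f : ↥(K \ {0}) → ℝ) x := by
  obtain ⟨V, hV, hSV, hfV, hfx⟩ := extension_spec f
  have hC : IsCompact (Subtype.val '' tsupport (f : ↥(K \ {0}) → ℝ)) :=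
    IsCompact.image hf continuous_subtype_val
  -- The cutoff lives in a compact `L` inside the domain of the extension and away from the origin.
  -- Removing 0 from K therefore changes nothing on the support, and closedness of K gives
  -- compactness.
  obtain ⟨L, hL, hCL, hLV⟩ := exists_compact_between hC (hV.inter isOpen_compl_singleton) (by
    rintro _ ⟨x, -, rfl⟩
    exact ⟨hSV x.2, x.2.2⟩ : _ ⊆ V ∩ {0}ᶜ)
  obtain ⟨χ, hχ1, hχ0, -⟩ := exists_contMDiffMap_one_nhds_of_subset_interior (n := (⊤ : ℕ∞))
    𝓘(ℝ, EuclideanSpace ℝ (Fin (n + 1))) hC.isClosed hCL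
  have hχL : tsupport χ ⊆ L := closure_minimal
    (fun x hx => by_contra fun hxL => hx (hχ0 x hxL)) hL.isClosed
  set φ : EuclideanSpace ℝ (Fin (n + 1)) → ℝ := fun x => χ x * extension f x with hφ
  have hφL : tsupport φ ⊆ L := (tsupport_mul_subset_left (f := χ) (g := extension f)).trans hχL
  refine ⟨φ, ?_, hL.of_isClosed_subset (isClosed_tsupport _) hφL, ?_, fun x => ?_⟩
  · rw [contDiff_iff_contDiffAt]
    intro x
    by_cases hx : x ∈ L
    · exact χ.contMDiff.contDiff.contDiffAt.mul (hfV.contDiffAt (hV.mem_nhds (hLV hx).1))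
    · refine (contDiffAt_const (c := (0 : ℝ))).congr_of_eventuallyEq ?_
      filter_upwards [hL.isClosed.isOpen_compl.mem_nhds hx] with y hy
      rw [hφ]
      simp only [hχ0 y hy, zero_mul]
  · have : (K \ {0}) ∩ tsupport φ = K ∩ tsupport φ := by
      ext x
      exact ⟨fun hx => ⟨hx.1.1, hx.2⟩, fun hx => ⟨⟨hx.1, (hLV (hφL hx.2)).2⟩, hx.2⟩⟩
    rw [this]
    exact hL.of_isClosed_subset (hK.inter (isClosed_tsupport _))
      (Set.inter_subset_right.trans hφL)
  · simp only [hφ, hfx]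
    by_cases hx : x ∈ tsupport (f : ↥(K \ {0}) → ℝ)
    · rw [hχ1.self_of_nhdsSet _ (Set.mem_image_of_mem _ hx), one_mul]
    · rw [image_eq_zero_of_notMem_tsupport hx, mul_zero]

theorem IsOriented.stability (h : IsOriented (K \ {0}) ν) (hK : IsClosed K)
    (hst : IsStable (K \ {0}) ν) (f : smoothFunctions (K \ {0}))
    (hf : HasCompactSupport (f : ↥(K \ {0}) → ℝ)) :
    0 ≤ ∫ x : ↥(K \ {0}), (∑ i, (h.tangentialDeriv i f : ↥(K \ {0}) → ℝ) x ^ 2 -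
      curvatureSq ν x * (f : ↥(K \ {0}) → ℝ) x ^ 2) ∂areaMeasure (K \ {0}) := by
  obtain ⟨φ, hφ, hc, hcS, hφf⟩ := exists_contDiff_extension hK f hf
  have := hst φ hφ hc hcS
  rw [← integral_subtype_comap (hK.measurableSet.diff (measurableSet_singleton 0))] at this
  refine this.trans_eq (integral_congr_ae (Eventually.of_forall fun x => ?_))
  simp only
  rw [h.norm_tangentialGradient_sq f x (hφ.contDiffAt.of_le (by simp))
    (Eventually.of_forall hφf), hφf]

/-- The radial function `x ↦ Q (log ‖x‖)` on a punctured set. -/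
def radialFun (K : Set (EuclideanSpace ℝ (Fin (n + 1)))) {Q : ℝ → ℝ} (hQ : ContDiff ℝ ∞ Q) :
    smoothFunctions (K \ {0}) :=
  restrict (fun x => Q (Real.log ‖x‖)) (V := {0}ᶜ) isOpen_compl_singleton (fun _ hx => hx.2)
    fun x hx => (hQ.contDiffAt.comp x ((contDiffAt_norm ℝ hx).log
      (norm_ne_zero_iff.2 hx))).contDiffWithinAt

theorem radialFun_apply {Q : ℝ → ℝ} (hQ : ContDiff ℝ ∞ Q) (x : ↥(K \ {0})) :
    (radialFun K hQ : ↥(K \ {0}) → ℝ) x =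
      Q (Real.log ‖(x : EuclideanSpace ℝ (Fin (n + 1)))‖) := rfl

theorem hasCompactSupport_radialFun (hK : IsClosed K) {Q : ℝ → ℝ} (hQ : ContDiff ℝ ∞ Q)
    (hQc : HasCompactSupport Q) : HasCompactSupport (radialFun K hQ : ↥(K \ {0}) → ℝ) := by
  obtain ⟨R, hR⟩ := hQc.isCompact.isBounded.subset_closedBall 0
  have hc : IsCompact (K ∩ (Metric.closedBall 0 (Real.exp R) \
      Metric.ball 0 (Real.exp (-R)))) :=
    ((isCompact_closedBall _ _).diff Metric.isOpen_ball).inter_left hK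
  have hc' : IsCompact (Subtype.val ⁻¹' (K ∩ (Metric.closedBall 0 (Real.exp R) \
      Metric.ball 0 (Real.exp (-R)))) : Set ↥(K \ {0})) := by
    refine Topology.IsInducing.subtypeVal.isCompact_preimage_iff ?_ |>.2 hc
    rw [Subtype.range_coe]
    refine fun x hx => ⟨hx.1, ?_⟩
    rintro rfl
    exact hx.2.2 (Metric.mem_ball_self (Real.exp_pos _))
  refine HasCompactSupport.intro hc' fun x hx => ?_
  rw [radialFun_apply]
  refine image_eq_zero_of_notMem_tsupport fun hxQ => hx ?_
  have hx0 : 0 < ‖(x : EuclideanSpace ℝ (Fin (n + 1)))‖ := norm_pos_iff.2 x.2.2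
  have h1 := hR hxQ
  rw [Metric.mem_closedBall, dist_zero_right, Real.norm_eq_abs, abs_le] at h1
  refine ⟨x.2.1, ?_, ?_⟩
  · rw [mem_closedBall_zero_iff, ← Real.log_le_iff_le_exp hx0]
    exact h1.2
  · rw [mem_ball_zero_iff, not_lt, ← Real.le_log_iff_exp_le hx0]
    exact h1.1

/-- The position vector is tangential on a cone, so projection to the tangent space leaves the
gradient x/|x|² of log |x| unchanged. -/
theorem IsOriented.tangentialDeriv_radialFun (h : IsOriented (K \ {0}) ν)
    (hS : ∀ t : ℝ, 0 < t → ∀ x ∈ K \ {0}, t • x ∈ K \ {0}) {Q : ℝ → ℝ} (hQ : ContDiff ℝ ∞ Q)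
    (i : Fin (n + 1)) (x : ↥(K \ {0})) :
    (h.tangentialDeriv i (radialFun K hQ) : ↥(K \ {0}) → ℝ) x =
      deriv Q (Real.log ‖(x : EuclideanSpace ℝ (Fin (n + 1)))‖) *
        ((x : EuclideanSpace ℝ (Fin (n + 1))) i /
          ‖(x : EuclideanSpace ℝ (Fin (n + 1)))‖ ^ 2) := by
  have hx0 : (x : EuclideanSpace ℝ (Fin (n + 1))) ≠ 0 := x.2.2
  have hn : ‖(x : EuclideanSpace ℝ (Fin (n + 1)))‖ ≠ 0 := norm_ne_zero_iff.2 hx0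
  rw [h.tangentialDeriv_apply i _ x (g := fun x => Q (Real.log ‖x‖))
    ((hQ.of_le (by simp)).contDiffAt.comp (x : EuclideanSpace ℝ (Fin (n + 1)))
      ((contDiffAt_norm ℝ hx0).log hn)) (Eventually.of_forall fun _ => rfl)]
  have h1 : (fun x : EuclideanSpace ℝ (Fin (n + 1)) => Q (Real.log ‖x‖)) =
      fun x => Q (2⁻¹ * Real.log (‖x‖ ^ 2)) := by
    funext y
    rw [Real.log_pow]
    congr 1
    push_cast
    ring
  have hd : HasFDerivAt (fun x : EuclideanSpace ℝ (Fin (n + 1)) => 2⁻¹ * Real.log (‖x‖ ^ 2))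
      _ (x : EuclideanSpace ℝ (Fin (n + 1))) :=
    ((hasStrictFDerivAt_norm_sq (x : EuclideanSpace ℝ (Fin (n + 1)))).hasFDerivAt.log
      (pow_ne_zero 2 hn)).const_mul 2⁻¹
  have hQ' : HasDerivAt Q (deriv Q (2⁻¹ * Real.log (‖(x : EuclideanSpace ℝ (Fin (n + 1)))‖ ^ 2)))
      (2⁻¹ * Real.log (‖(x : EuclideanSpace ℝ (Fin (n + 1)))‖ ^ 2)) :=
    (hQ.differentiable (by simp)).differentiableAt.hasDerivAt
  have hQd := hQ'.comp_hasFDerivAt (x : EuclideanSpace ℝ (Fin (n + 1))) hd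
  rw [h1]
  have hin : ⟪(x : EuclideanSpace ℝ (Fin (n + 1))), tangentVector ν i x⟫ =
      (x : EuclideanSpace ℝ (Fin (n + 1))) i := by
    rw [tangentVector, inner_sub_right, real_inner_smul_right,
      real_inner_comm, real_inner_comm (ν x), h.inner_position hS x.2,
      EuclideanSpace.inner_single_left]
    simp
  rw [show fderiv ℝ (fun x : EuclideanSpace ℝ (Fin (n + 1)) => Q (2⁻¹ * Real.log (‖x‖ ^ 2))) x = _
    from hQd.fderiv, Real.log_pow]
  simp only [smul_apply, smul_eq_mul, innerSL_apply_apply, hin, nsmul_eq_mul]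
  push_cast
  rw [inv_mul_cancel_left₀ two_ne_zero]
  ring

end Hypersurface

end

/-! ### Stability and homogeneity for radial weights -/

noncomputable section

open Filter Topology
open scoped RealInnerProductSpace NNReal ENNReal Manifold

namespace Hypersurface

open smoothFunctions

variable {n : ℕ} {K : Set (EuclideanSpace ℝ (Fin (n + 1)))}
  {ν : EuclideanSpace ℝ (Fin (n + 1)) → EuclideanSpace ℝ (Fin (n + 1))}

/-- Applied to |II|² + ε, whose square root is smooth even where the curvature vanishes. -/
theorem smoothFunctions.exists_mul_self {S : Set (EuclideanSpace ℝ (Fin (n + 1)))}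
    (f : smoothFunctions S) (hf : ∀ x, 0 < (f : S → ℝ) x) :
    ∃ g : smoothFunctions S, g * g = f := by
  obtain ⟨V, hV, hSV, hfV, hfx⟩ := extension_spec f
  refine ⟨restrict (fun x => √(extension f x)) (V := V ∩ extension f ⁻¹' Set.Ioi 0)
    (hfV.continuousOn.isOpen_inter_preimage hV isOpen_Ioi)
    (fun x hx => ⟨hSV hx, (hf ⟨x, hx⟩).trans_eq (hfx ⟨x, hx⟩).symm⟩)
    ((hfV.mono Set.inter_subset_left).sqrt fun x hx => (Set.mem_Ioi.1 hx.2).ne'), ?_⟩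
  ext x
  change √(extension f x) * √(extension f x) = _
  rw [hfx, Real.mul_self_sqrt (hf x).le]

/-- The integral of `|II|²` against a radial function. -/
def radialIntegral (K : Set (EuclideanSpace ℝ (Fin (n + 1))))
    (ν : EuclideanSpace ℝ (Fin (n + 1)) → EuclideanSpace ℝ (Fin (n + 1))) (Q : ℝ → ℝ) : ℝ :=
  ∫ x : ↥(K \ {0}), curvatureSq ν x *
    Q (Real.log ‖(x : EuclideanSpace ℝ (Fin (n + 1)))‖) ∂areaMeasure (K \ {0})

theorem IsOriented.integrable_radial (h : IsOriented (K \ {0}) ν) (hK : IsClosed K) {Q : ℝ → ℝ}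
    (hQ : ContDiff ℝ ∞ Q) (hQc : HasCompactSupport Q) :
    Integrable (fun x : ↥(K \ {0}) => curvatureSq ν x *
      Q (Real.log ‖(x : EuclideanSpace ℝ (Fin (n + 1)))‖)) (areaMeasure (K \ {0})) := by
  simp_rw [h.curvatureSq_eq]
  exact h.integrable (hK.measurableSet.diff (measurableSet_singleton 0))
    (smoothFunctions.continuous (shapeNormSq h.tangentialDeriv h.normalFun * radialFun K hQ))
    (HasCompactSupport.mul_left (hasCompactSupport_radialFun hK hQ hQc))

/-- Here F = √(u + ε), E = Q(log r), the vectors a, b, d are the gradients of F, E, u, and L = Δu,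
while `r` stands for |x|². Since (U + ε)|a|² = |d|²/4, Kato's inequality gives |a|² ≤ L/2 + U² -
2U/r; replacing the factor U by U + ε requires the right side to be nonnegative, which is `h1`. -/
theorem add_sq_sub_le_of_kato {ι : Type*} [Fintype ι] {a b d : ι → ℝ} {F E U L ε r : ℝ}
    (hε : 0 < ε) (hU : 0 ≤ U) (hF : F * F = U + ε) (hd : ∀ i, 2 * F * a i = d i)
    (h1 : 2 * U / r ≤ L / 2 + U ^ 2)
    (h2 : ∑ i, d i ^ 2 ≤ 4 * (U * (L / 2 + U ^ 2) - 2 * U ^ 2 / r)) :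
    ∑ i, (F * b i + E * a i) ^ 2 - U * (F * E) ^ 2 ≤
      (E * ∑ i, b i * d i + 2⁻¹ * E ^ 2 * L) + ((U + ε) * ∑ i, b i ^ 2 - 2 * U * E ^ 2 / r) := by
  have e1 : ∑ i, (F * b i + E * a i) ^ 2 =
      (U + ε) * ∑ i, b i ^ 2 + E * ∑ i, b i * d i + E ^ 2 * ∑ i, a i ^ 2 := by
    simp only [Finset.mul_sum, ← Finset.sum_add_distrib, ← hF, ← hd]
    exact Finset.sum_congr rfl fun i _ => by ring
  have e2 : ∑ i, d i ^ 2 = 4 * ((U + ε) * ∑ i, a i ^ 2) := by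
    simp only [Finset.mul_sum, ← hF, ← hd]
    exact Finset.sum_congr rfl fun i _ => by ring
  have e3 : 2 * U ^ 2 / r = U * (2 * U / r) := by ring
  have e4 : ∑ i, a i ^ 2 ≤ L / 2 + U ^ 2 - 2 * U / r := by
    have h0 : 0 < U + ε := by linarith
    refine le_of_mul_le_mul_left ?_ h0
    rw [e2, e3] at h2
    nlinarith [mul_nonneg hε.le (sub_nonneg.2 h1)]
  have e5 : 2 * U * E ^ 2 / r = E ^ 2 * (2 * U / r) := by ring
  have e6 : (F * E) ^ 2 = (U + ε) * E ^ 2 := by rw [← hF]; ring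
  rw [e1, e5, e6]
  nlinarith [mul_le_mul_of_nonneg_left e4 (sq_nonneg E),
    mul_nonneg (mul_nonneg hU hε.le) (sq_nonneg E)]

theorem sum_coord_sq (x : EuclideanSpace ℝ (Fin (n + 1))) : ∑ i, x i * x i = ‖x‖ ^ 2 := by
  rw [EuclideanSpace.real_norm_sq_eq]
  exact Finset.sum_congr rfl fun i _ => by ring

theorem exp_neg_two_mul_log_norm {x : EuclideanSpace ℝ (Fin (n + 1))} (hx : x ≠ 0) :
    Real.exp (-2 * Real.log ‖x‖) = (‖x‖ ^ 2)⁻¹ := by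
  rw [show -2 * Real.log ‖x‖ = -(Real.log (‖x‖ ^ 2)) by rw [Real.log_pow]; push_cast; ring,
    Real.exp_neg, Real.exp_log (by positivity)]

/-- The vector field `½ Q(log r)² ∇|II|²`. -/
def IsOriented.stabilityField (h : IsOriented (K \ {0}) ν) {Q : ℝ → ℝ} (hQ : ContDiff ℝ ∞ Q)
    (i : Fin (n + 1)) : smoothFunctions (K \ {0}) :=
  (2⁻¹ : ℝ) • (radialFun K hQ * radialFun K hQ *
    h.tangentialDeriv i (shapeNormSq h.tangentialDeriv h.normalFun))

theorem IsOriented.div_stabilityField (h : IsOriented (K \ {0}) ν) {Q : ℝ → ℝ}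
    (hQ : ContDiff ℝ ∞ Q) {u : smoothFunctions (K \ {0})}
    (hu : u = shapeNormSq h.tangentialDeriv h.normalFun) (x : ↥(K \ {0})) :
    (h.div (h.stabilityField hQ) : ↥(K \ {0}) → ℝ) x =
      eval x (radialFun K hQ) * ∑ i, eval x (h.tangentialDeriv i (radialFun K hQ)) *
        eval x (h.tangentialDeriv i u) +
      2⁻¹ * eval x (radialFun K hQ) ^ 2 *
        eval x (∑ k, h.tangentialDeriv k (h.tangentialDeriv k u)) := by
  have e (i) : eval x (h.tangentialDeriv i (h.stabilityField hQ i)) = eval x (radialFun K hQ) *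
      (eval x (h.tangentialDeriv i (radialFun K hQ)) * eval x (h.tangentialDeriv i u)) +
      2⁻¹ * eval x (radialFun K hQ) ^ 2 *
        eval x (h.tangentialDeriv i (h.tangentialDeriv i u)) := by
    have : eval x (h.tangentialDeriv i (h.stabilityField hQ i)) = 2⁻¹ * eval x
        (h.tangentialDeriv i (radialFun K hQ * radialFun K hQ * h.tangentialDeriv i u)) := by
      simp only [stabilityField, Derivation.map_smul, hu]
      rfl
    rw [this]
    simp only [Derivation.leibniz, smul_eq_mul, map_add, map_mul]
    ring
  rw [h.div_apply, map_sum, Finset.mul_sum, Finset.mul_sum, ← Finset.sum_add_distrib]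
  exact Finset.sum_congr rfl fun i _ => e i

theorem IsOriented.sum_sq_tangentialDeriv_radialFun (h : IsOriented (K \ {0}) ν)
    (hS : ∀ t : ℝ, 0 < t → ∀ x ∈ K \ {0}, t • x ∈ K \ {0}) {Q : ℝ → ℝ} (hQ : ContDiff ℝ ∞ Q)
    (x : ↥(K \ {0})) : ∑ i, eval x (h.tangentialDeriv i (radialFun K hQ)) ^ 2 =
      deriv Q (Real.log ‖(x : EuclideanSpace ℝ (Fin (n + 1)))‖) ^ 2 *
        (‖(x : EuclideanSpace ℝ (Fin (n + 1)))‖ ^ 2)⁻¹ := by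
  have hn : ‖(x : EuclideanSpace ℝ (Fin (n + 1)))‖ ≠ 0 := norm_ne_zero_iff.2 x.2.2
  simp_rw [eval_apply, h.tangentialDeriv_radialFun hS hQ, mul_pow, div_pow,
    ← Finset.mul_sum, ← Finset.sum_div, sq ((x : EuclideanSpace ℝ (Fin (n + 1))).ofLp _),
    sum_coord_sq]
  field_simp

/-- The divergence of ½Q²∇u contains the cross term Q∇Q · ∇u and the term ½Q²Δu coming from Simons'
identity. The terms in u² cancel, leaving the radial expression and an error linear in ε. -/
theorem IsOriented.stability_integrand_le (h : IsOriented (K \ {0}) ν)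
    (hS : ∀ t : ℝ, 0 < t → ∀ x ∈ K \ {0}, t • x ∈ K \ {0}) (hmin : IsMinimal (K \ {0}) ν)
    {Q : ℝ → ℝ} (hQ : ContDiff ℝ ∞ Q) {u f : smoothFunctions (K \ {0})}
    (hu : u = shapeNormSq h.tangentialDeriv h.normalFun) {ε : ℝ} (hε : 0 < ε)
    (hf : f * f = u + algebraMap ℝ (smoothFunctions (K \ {0})) ε) (x : ↥(K \ {0})) :
    ∑ i, (h.tangentialDeriv i (f * radialFun K hQ) : ↥(K \ {0}) → ℝ) x ^ 2 -
      curvatureSq ν x * ((f * radialFun K hQ : smoothFunctions (K \ {0})) : ↥(K \ {0}) → ℝ) x ^ 2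
    ≤ (h.div (h.stabilityField hQ) : ↥(K \ {0}) → ℝ) x + curvatureSq ν x *
      (Real.exp (-2 * Real.log ‖(x : EuclideanSpace ℝ (Fin (n + 1)))‖) *
        (deriv Q (Real.log ‖(x : EuclideanSpace ℝ (Fin (n + 1)))‖) ^ 2 -
          2 * Q (Real.log ‖(x : EuclideanSpace ℝ (Fin (n + 1)))‖) ^ 2)) +
      ε * (Real.exp (-2 * Real.log ‖(x : EuclideanSpace ℝ (Fin (n + 1)))‖) *
        deriv Q (Real.log ‖(x : EuclideanSpace ℝ (Fin (n + 1)))‖) ^ 2) := by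
  have hx0 : (x : EuclideanSpace ℝ (Fin (n + 1))) ≠ 0 := x.2.2
  have hn : ‖(x : EuclideanSpace ℝ (Fin (n + 1)))‖ ≠ 0 := norm_ne_zero_iff.2 hx0
  have hr : ∑ i, eval x (coordFun (K \ {0}) i) * eval x (coordFun (K \ {0}) i) =
    ‖(x : EuclideanSpace ℝ (Fin (n + 1)))‖ ^ 2 := sum_coord_sq _
  have hk := (h.isMinimalConeCalculus hS hmin).kato (eval x) (by rw [hr]; positivity)
  rw [hr, ← hu] at hk
  have hff := congrArg (eval x) hf
  have hdf (i) := congrArg (fun g => eval x (h.tangentialDeriv i g)) hf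
  simp only [Derivation.leibniz, map_add, Derivation.map_algebraMap, smul_eq_mul, map_mul,
    add_zero] at hff hdf
  have hu0 : 0 ≤ eval x u := by
    rw [eval_apply, hu, ← h.curvatureSq_eq]
    exact Finset.sum_nonneg fun i _ => sq_nonneg _
  have hp := add_sq_sub_le_of_kato (a := fun i => eval x (h.tangentialDeriv i f))
    (b := fun i => eval x (h.tangentialDeriv i (radialFun K hQ)))
    (E := eval x (radialFun K hQ)) hε hu0 hff (fun i => by rw [← hdf i]; ring) hk.1 hk.2
  have hlhs : ∑ i, (h.tangentialDeriv i (f * radialFun K hQ) : ↥(K \ {0}) → ℝ) x ^ 2 =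
      ∑ i, (eval x f * eval x (h.tangentialDeriv i (radialFun K hQ)) +
        eval x (radialFun K hQ) * eval x (h.tangentialDeriv i f)) ^ 2 := by
    refine Finset.sum_congr rfl fun i _ => ?_
    rw [← eval_apply, Derivation.leibniz]
    simp only [smul_eq_mul, map_add, map_mul]
  rw [hlhs, h.div_stabilityField hQ hu, h.curvatureSq_eq, ← hu, exp_neg_two_mul_log_norm hx0,
    ← eval_apply x (f * radialFun K hQ), map_mul, ← eval_apply x u]
  refine hp.trans (le_of_eq ?_)
  conv_rhs => rw [add_assoc]
  rw [h.sum_sq_tangentialDeriv_radialFun hS hQ, eval_apply x (radialFun K hQ), radialFun_apply]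
  congr 1
  generalize deriv Q (Real.log ‖(x : EuclideanSpace ℝ (Fin (n + 1)))‖) = q'
  generalize Q (Real.log ‖(x : EuclideanSpace ℝ (Fin (n + 1)))‖) = q
  generalize eval x u = U
  ring

/-- Testing the stability inequality with `√(|II|² + ε) Q(log r)` and letting `ε → 0`. -/
theorem IsOriented.radialIntegral_stability (h : IsOriented (K \ {0}) ν) (hcone : IsClosedCone K)
    (hmin : IsMinimal (K \ {0}) ν) (hst : IsStable (K \ {0}) ν) {Q : ℝ → ℝ}
    (hQ : ContDiff ℝ ∞ Q) (hQc : HasCompactSupport Q) :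
    0 ≤ radialIntegral K ν (fun t => Real.exp (-2 * t) * (deriv Q t ^ 2 - 2 * Q t ^ 2)) := by
  have hS : ∀ t : ℝ, 0 < t → ∀ x ∈ K \ {0}, t • x ∈ K \ {0} := fun t ht x hx =>
    ⟨hcone.2 t ht x hx.1, smul_ne_zero ht.ne' hx.2⟩
  have hSm : MeasurableSet (K \ {0}) := hcone.1.measurableSet.diff (measurableSet_singleton 0)
  have hcalc := h.isMinimalConeCalculus hS hmin
  set u : smoothFunctions (K \ {0}) := shapeNormSq h.tangentialDeriv h.normalFun with hu
  set η : smoothFunctions (K \ {0}) := radialFun K hQ with hη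
  have hηc : HasCompactSupport (η : ↥(K \ {0}) → ℝ) := hasCompactSupport_radialFun hcone.1 hQ hQc
  have hu0 (x) : 0 ≤ (u : ↥(K \ {0}) → ℝ) x := by
    rw [← h.curvatureSq_eq]
    exact Finset.sum_nonneg fun i _ => sq_nonneg _
  have hQ' : ContDiff ℝ ∞ (deriv Q) := (contDiff_infty_iff_deriv.1 hQ).2
  have hQ'c : HasCompactSupport (deriv Q) := hQc.deriv
  have hexp : ContDiff ℝ ∞ fun t : ℝ => Real.exp (-2 * t) := by fun_prop
  have hq1 : ContDiff ℝ ∞ fun t => Real.exp (-2 * t) * (deriv Q t ^ 2 - 2 * Q t ^ 2) :=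
    hexp.mul ((hQ'.pow 2).sub (contDiff_const.mul (hQ.pow 2)))
  have hq2 : ContDiff ℝ ∞ fun t => Real.exp (-2 * t) * deriv Q t ^ 2 := hexp.mul (hQ'.pow 2)
  have hq2c : HasCompactSupport fun t => Real.exp (-2 * t) * deriv Q t ^ 2 :=
    HasCompactSupport.mul_left (hQ'c.comp_left (g := fun t => t ^ 2) (by simp))
  have hq1c : HasCompactSupport fun t => Real.exp (-2 * t) * (deriv Q t ^ 2 - 2 * Q t ^ 2) :=
    HasCompactSupport.mul_left ((hQ'c.comp_left (g := fun t => t ^ 2) (by simp)).sub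
      (hQc.comp_left (g := fun t => 2 * t ^ 2) (by simp)))
  have hI1 := h.integrable_radial hcone.1 hq1 hq1c
  have hI2 : Integrable (fun x : ↥(K \ {0}) => Real.exp (-2 * Real.log
      ‖(x : EuclideanSpace ℝ (Fin (n + 1)))‖) *
      deriv Q (Real.log ‖(x : EuclideanSpace ℝ (Fin (n + 1)))‖) ^ 2) (areaMeasure (K \ {0})) :=
    h.integrable hSm (smoothFunctions.continuous (radialFun K hq2))
      (hasCompactSupport_radialFun hcone.1 hq2 hq2c)
  let X : Fin (n + 1) → smoothFunctions (K \ {0}) := h.stabilityField hQ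
  have hXc (i) : HasCompactSupport (X i : ↥(K \ {0}) → ℝ) :=
    HasCompactSupport.mul_left (f := fun _ => (2⁻¹ : ℝ)) (HasCompactSupport.mul_right
      (f := (η : ↥(K \ {0}) → ℝ) * (η : ↥(K \ {0}) → ℝ)) hηc.mul_left)
  have hXν : ∑ i, X i * h.normalFun i = 0 := by
    have e (i) : X i * h.normalFun i =
        ((2⁻¹ : ℝ) • (η * η)) * (h.normalFun i * h.tangentialDeriv i u) := by
      simp only [X, stabilityField, Algebra.smul_mul_assoc]
      congr 1
      ring
    simp_rw [e, ← Finset.mul_sum, hcalc.normal u, mul_zero]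
  have hdiv0 := h.integral_div_eq_zero hSm X hXν hXc
  have key : ∀ ε : ℝ, 0 < ε → 0 ≤
      radialIntegral K ν (fun t => Real.exp (-2 * t) * (deriv Q t ^ 2 - 2 * Q t ^ 2)) +
      ε * ∫ x : ↥(K \ {0}), Real.exp (-2 * Real.log ‖(x : EuclideanSpace ℝ (Fin (n + 1)))‖) *
        deriv Q (Real.log ‖(x : EuclideanSpace ℝ (Fin (n + 1)))‖) ^ 2
        ∂areaMeasure (K \ {0}) := by
    intro ε hε
    obtain ⟨f, hf⟩ := smoothFunctions.exists_mul_self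
      (u + algebraMap ℝ (smoothFunctions (K \ {0})) ε) (fun x => by
        change 0 < (u : ↥(K \ {0}) → ℝ) x + ε
        linarith [hu0 x])
    have hφc : HasCompactSupport ((f * η : smoothFunctions (K \ {0})) : ↥(K \ {0}) → ℝ) :=
      HasCompactSupport.mul_left hηc
    have hstab := h.stability hcone.1 hst (f * η) hφc
    have hdI := h.integrable hSm (smoothFunctions.continuous (h.div X)) (h.hasCompactSupport_div hXc)
    have e1 := integral_add hdI hI1
    have e2 := integral_add (hdI.add hI1) (hI2.const_mul ε)
    simp only [Pi.add_apply] at e2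
    rw [e1, hdiv0, zero_add, integral_const_mul] at e2
    rw [radialIntegral, ← e2]
    refine hstab.trans (integral_mono ?_ ((hdI.add hI1).add (hI2.const_mul ε)) fun x => ?_)
    · have hsc : HasCompactSupport (fun x => ∑ i, (h.tangentialDeriv i (f * η) :
          ↥(K \ {0}) → ℝ) x ^ 2) := hasCompactSupport_finset_sum _ fun i _ =>
        (h.hasCompactSupport_tangentialDeriv i hφc).comp_left (g := fun t => t ^ 2) (by simp)
      refine (h.integrable hSm ?_ hsc).sub (h.integrable hSm ?_ ?_)
      · exact continuous_finsetSum _ fun i _ => (smoothFunctions.continuous _).pow 2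
      · simp_rw [h.curvatureSq_eq]
        exact (smoothFunctions.continuous _).mul ((smoothFunctions.continuous _).pow 2)
      · exact HasCompactSupport.mul_left (hφc.comp_left (g := fun t => t ^ 2) (by simp))
    · exact h.stability_integrand_le hS hmin hQ hu hε hf x
  -- The factor c of ε does not depend on ε; the choice ε = δ/(c + 1) keeps the error below δ even
  -- when c = 0.
  refine le_of_forall_pos_lt_add fun δ hδ => ?_
  set c := ∫ x : ↥(K \ {0}), Real.exp (-2 * Real.log ‖(x : EuclideanSpace ℝ (Fin (n + 1)))‖) *
        deriv Q (Real.log ‖(x : EuclideanSpace ℝ (Fin (n + 1)))‖) ^ 2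
        ∂areaMeasure (K \ {0})
  have hc : 0 ≤ c := integral_nonneg fun x => mul_nonneg (Real.exp_pos _).le (sq_nonneg _)
  have h1 := key (δ / (c + 1)) (by positivity)
  have h2 : δ / (c + 1) * c < δ := by
    rw [div_mul_eq_mul_div, div_lt_iff₀ (by positivity)]
    nlinarith
  linarith

/-- The divergence theorem for the field `|II|² H(log r) x` on a minimal cone. -/
theorem IsOriented.radialIntegral_homogeneity (h : IsOriented (K \ {0}) ν)
    (hcone : IsClosedCone K) (hmin : IsMinimal (K \ {0}) ν) {H : ℝ → ℝ}
    (hH : ContDiff ℝ ∞ H) (hHc : HasCompactSupport H) :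
    radialIntegral K ν (fun t => (n - 2) * H t + deriv H t) = 0 := by
  have hS : ∀ t : ℝ, 0 < t → ∀ x ∈ K \ {0}, t • x ∈ K \ {0} := fun t ht x hx =>
    ⟨hcone.2 t ht x hx.1, smul_ne_zero ht.ne' hx.2⟩
  have hSm : MeasurableSet (K \ {0}) := hcone.1.measurableSet.diff (measurableSet_singleton 0)
  have hcalc := h.isMinimalConeCalculus hS hmin
  set u : smoothFunctions (K \ {0}) := shapeNormSq h.tangentialDeriv h.normalFun with hu
  set η : smoothFunctions (K \ {0}) := radialFun K hH with hη
  have hηc : HasCompactSupport (η : ↥(K \ {0}) → ℝ) := hasCompactSupport_radialFun hcone.1 hH hHc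
  let X : Fin (n + 1) → smoothFunctions (K \ {0}) := fun i => u * η * coordFun (K \ {0}) i
  have hXc (i) : HasCompactSupport (X i : ↥(K \ {0}) → ℝ) :=
    HasCompactSupport.mul_right (f := (u : ↥(K \ {0}) → ℝ) * (η : ↥(K \ {0}) → ℝ)) hηc.mul_left
  have hXν : ∑ i, X i * h.normalFun i = 0 := by
    simp only [X, mul_assoc, ← Finset.mul_sum, hcalc.cone, mul_zero]
  rw [← h.integral_div_eq_zero hSm X hXν hXc, radialIntegral]
  refine integral_congr_ae (Eventually.of_forall fun x => ?_)
  simp only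
  have hn : ‖(x : EuclideanSpace ℝ (Fin (n + 1)))‖ ≠ 0 := norm_ne_zero_iff.2 x.2.2
  have e (i) : eval x (h.tangentialDeriv i (X i)) =
      eval x η * (eval x (coordFun (K \ {0}) i) * eval x (h.tangentialDeriv i u)) +
      eval x u * (eval x (coordFun (K \ {0}) i) * eval x (h.tangentialDeriv i η)) +
      eval x u * eval x η * (1 - ν x i * ν x i) := by
    simp only [X, Derivation.leibniz, smul_eq_mul, map_add, map_mul, hcalc.position, if_true,
      map_sub, map_one, eval_apply x (h.normalFun i), h.normalFun_apply]
    ring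
  -- The coefficient n - 2 is composed of -2 from the homogeneity of |II|² and n from the tangential
  -- divergence of the position vector (`e3`).
  have e1 := congrArg (eval x) hcalc.sum_position_mul_deriv_shapeNormSq
  simp only [map_sum, map_mul, map_neg, map_ofNat, ← hu] at e1
  have e2 : ∑ i, eval x (coordFun (K \ {0}) i) * eval x (h.tangentialDeriv i η) =
      deriv H (Real.log ‖(x : EuclideanSpace ℝ (Fin (n + 1)))‖) := by
    simp_rw [eval_apply, hη, h.tangentialDeriv_radialFun hS hH, coordFun_apply]
    simp_rw [mul_left_comm _ (deriv H _), ← Finset.mul_sum, ← mul_div_assoc, ← Finset.sum_div,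
      sum_coord_sq]
    field_simp
  have e3 : ∑ i, (1 - ν x i * ν x i) = (n : ℝ) := by
    rw [Finset.sum_sub_distrib, sum_coord_sq, h.norm_eq_one x.2]
    simp
  rw [h.div_apply]
  simp_rw [← eval_apply, e, Finset.sum_add_distrib, ← Finset.mul_sum, e1, e2, e3]
  rw [h.curvatureSq_eq, ← hu, ← eval_apply, hη, eval_apply x (radialFun K hH), radialFun_apply]
  ring

end Hypersurface

end

/-! ### One-dimensional problem and vanishing of the curvature -/

noncomputable section

open Filter Topology
open scoped RealInnerProductSpace NNReal ENNReal Manifold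

/-- A test function with vanishing integral is the derivative of a test function. -/
theorem exists_deriv_eq_of_integral_eq_zero {w : ℝ → ℝ} (hw : ContDiff ℝ ∞ w)
    (hc : HasCompactSupport w) (h0 : ∫ t, w t = 0) :
    ∃ θ : ℝ → ℝ, ContDiff ℝ ∞ θ ∧ HasCompactSupport θ ∧ deriv θ = w := by
  obtain ⟨R, hR⟩ := hc.isCompact.isBounded.subset_closedBall 0
  have hw0 (t : ℝ) (ht : t ∉ Set.Icc (-R) R) : w t = 0 :=
    image_eq_zero_of_notMem_tsupport fun h => ht (by
      simpa [Real.closedBall_eq_Icc] using hR h)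
  have hint (a b : ℝ) : IntervalIntegrable w volume a b := hw.continuous.intervalIntegrable a b
  have hd (t) : HasDerivAt (fun t => ∫ s in (-R)..t, w s) (w t) t :=
    intervalIntegral.integral_hasDerivAt_right (hint _ _)
      (hw.continuous.stronglyMeasurableAtFilter _ _) hw.continuous.continuousAt
  have hder : deriv (fun t => ∫ s in (-R)..t, w s) = w := funext fun t => (hd t).deriv
  refine ⟨fun t => ∫ s in (-R)..t, w s, ?_, ?_, hder⟩
  · rw [contDiff_infty_iff_deriv, hder]
    exact ⟨fun t => (hd t).differentiableAt, hw⟩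
  · refine HasCompactSupport.intro (isCompact_Icc (a := -R) (b := R)) fun t ht => ?_
    by_cases htR : t < -R
    · rw [intervalIntegral.integral_symm, intervalIntegral.integral_of_le htR.le]
      rw [setIntegral_eq_zero_of_ae_eq_zero, neg_zero]
      have : ∀ᵐ x, x ≠ -R := by simp [ae_iff, measure_singleton]
      filter_upwards [this] with x hx hxm
      exact hw0 x fun h => hx (le_antisymm hxm.2 h.1)
    · have htR' : R < t := by
        by_contra hle
        exact ht ⟨not_lt.1 htR, not_lt.1 hle⟩
      rw [intervalIntegral.integral_of_le (not_lt.1 htR), ← h0]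
      refine setIntegral_eq_integral_of_ae_compl_eq_zero ?_
      -- Interval integrals run over half-open intervals, which omit the left endpoint -R; it is a
      -- null set.
      have : ∀ᵐ x, x ≠ -R := by simp [ae_iff, measure_singleton]
      filter_upwards [this] with x hx hxm
      refine hw0 x fun h => hxm ⟨lt_of_le_of_ne h.1 (Ne.symm hx), h.2.trans htR'.le⟩

/-- There are test functions whose Dirichlet energy is smaller than their square norm. -/
theorem exists_integral_deriv_sq_lt : ∃ ψ : ℝ → ℝ, ContDiff ℝ ∞ ψ ∧ HasCompactSupport ψ ∧
    ∫ t, deriv ψ t ^ 2 < ∫ t, ψ t ^ 2 := by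
  let χ : ContDiffBump (0 : ℝ) := default
  have hχ : ContDiff ℝ ∞ χ := χ.contDiff
  set A := ∫ t, deriv χ t ^ 2
  set B := ∫ t, χ t ^ 2
  have hA : 0 ≤ A := integral_nonneg fun t => sq_nonneg _
  have hB : 0 < B := by
    refine Continuous.integral_pos_of_hasCompactSupport_nonneg_nonzero (x := 0)
      (hχ.continuous.pow 2) (χ.hasCompactSupport.comp_left (g := fun t => t ^ 2) (by simp))
      (fun t => sq_nonneg _) ?_
    rw [χ.one_of_mem_closedBall (by simp [χ.rIn_pos.le])]
    norm_num
  -- Stretching by 1/s multiplies the energy by s and the square norm by 1/s. The choice ensures s²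
  -- A ≤ s A < s (A + 1) ≤ B.
  set s := min 1 (B / (A + 1))
  have hs : 0 < s := lt_min one_pos (by positivity)
  have hsB : s * (A + 1) ≤ B := (le_div_iff₀ (by positivity)).1 (min_le_right _ _)
  have hs1 : s ≤ 1 := min_le_left _ _
  refine ⟨fun t => χ (s * t), hχ.comp (contDiff_const.mul contDiff_id),
    χ.hasCompactSupport.comp_homeomorph (Homeomorph.mulLeft₀ s hs.ne'), ?_⟩
  have e1 : ∫ t, deriv (fun t => χ (s * t)) t ^ 2 = s * A := by
    simp_rw [deriv_comp_mul_left, smul_eq_mul, mul_pow]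
    rw [integral_const_mul, Measure.integral_comp_mul_left (fun t => deriv χ t ^ 2) s,
      abs_of_pos (inv_pos.2 hs), smul_eq_mul]
    field_simp
    rfl
  have e2 : ∫ t, χ (s * t) ^ 2 = s⁻¹ * B := by
    rw [Measure.integral_comp_mul_left (fun t => χ t ^ 2) s, abs_of_pos (inv_pos.2 hs),
      smul_eq_mul]
  rw [e1, e2, inv_mul_eq_div, lt_div_iff₀ hs]
  nlinarith [mul_nonneg hs.le hA]

section OneDimensional

variable {T : (ℝ → ℝ) → ℝ}

/-- Inserting f = e^(-ct) θ in `hB` shows that g ↦ T(e^(-ct) g) kills derivatives of test functions,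
hence all test functions of integral zero. A linear functional with this property is a multiple of
the integral. -/
theorem exp_mul_integral_eq {c : ℝ}
    (hadd : ∀ f g : ℝ → ℝ, ContDiff ℝ ∞ f → HasCompactSupport f → ContDiff ℝ ∞ g →
      HasCompactSupport g → T (fun t => f t + g t) = T f + T g)
    (hsmul : ∀ (a : ℝ) (f : ℝ → ℝ), ContDiff ℝ ∞ f → HasCompactSupport f →
      T (fun t => a * f t) = a * T f)
    (hB : ∀ f : ℝ → ℝ, ContDiff ℝ ∞ f → HasCompactSupport f →
      T (fun t => c * f t + deriv f t) = 0) :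
    (∀ θ : ℝ → ℝ, ContDiff ℝ ∞ θ → HasCompactSupport θ →
      T (fun t => Real.exp (-c * t) * deriv θ t) = 0) ∧
    ∃ m : ℝ, ∀ g : ℝ → ℝ, ContDiff ℝ ∞ g → HasCompactSupport g →
      T (fun t => Real.exp (-c * t) * g t) = m * ∫ t, g t := by
  have hexp : ContDiff ℝ ∞ fun t : ℝ => Real.exp (-c * t) := by fun_prop
  have h1 (θ : ℝ → ℝ) (hθ : ContDiff ℝ ∞ θ) (hθc : HasCompactSupport θ) :
      T (fun t => Real.exp (-c * t) * deriv θ t) = 0 := by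
    rw [← hB (fun t => Real.exp (-c * t) * θ t) (hexp.mul hθ) (HasCompactSupport.mul_left hθc)]
    congr 1
    funext t
    have hd : HasDerivAt (fun t => Real.exp (-c * t) * θ t) _ t :=
      (((hasDerivAt_id t).const_mul (-c)).exp).mul
        (hθ.differentiable (by simp)).differentiableAt.hasDerivAt
    rw [hd.deriv]
    simp only [id]
    ring
  refine ⟨h1, ?_⟩
  let χ : ContDiffBump (0 : ℝ) := default
  have hχ : ContDiff ℝ ∞ χ := χ.contDiff
  have hχi : 0 < ∫ t, χ t := χ.integral_pos
  refine ⟨T (fun t => Real.exp (-c * t) * χ t) / ∫ t, χ t, fun g hg hgc => ?_⟩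
  -- Subtracting b χ makes the integral vanish, so that the remainder is a derivative.
  set b := (∫ t, g t) / ∫ t, χ t
  have hbc : HasCompactSupport fun t => b * χ t := HasCompactSupport.mul_left χ.hasCompactSupport
  obtain ⟨θ, hθ, hθc, hθd⟩ := exists_deriv_eq_of_integral_eq_zero
    (w := fun t => g t - b * χ t) (hg.sub (contDiff_const.mul hχ)) (hgc.sub hbc) (by
      rw [integral_sub (hg.continuous.integrable_of_hasCompactSupport hgc)
        ((hχ.continuous.integrable_of_hasCompactSupport χ.hasCompactSupport).const_mul b),
        integral_const_mul, div_mul_cancel₀ _ hχi.ne', sub_self])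
  have e : (fun t => Real.exp (-c * t) * g t) = fun t => Real.exp (-c * t) * deriv θ t +
      b * (Real.exp (-c * t) * χ t) := by
    funext t
    rw [hθd]
    ring
  have hθ' : ContDiff ℝ ∞ (deriv θ) := (contDiff_infty_iff_deriv.1 hθ).2
  rw [e, hadd _ _ (hexp.mul hθ') (HasCompactSupport.mul_left hθc.deriv)
    (contDiff_const.mul (hexp.mul hχ))
    (HasCompactSupport.mul_left (HasCompactSupport.mul_left χ.hasCompactSupport)),
    h1 θ hθ hθc, hsmul _ _ (hexp.mul hχ) (HasCompactSupport.mul_left χ.hasCompactSupport)]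
  simp only [b]
  field_simp
  ring

/-- The dimension enters here. By `exp_mul_integral_eq`, T has density m e^((n-2)t), and `hA` for f
= e^(-at) ψ reads m ∫ (ψ'² - (2 - a²) ψ²) ≥ 0. Since 2 - a² ≥ 1, a function ψ with small Dirichlet
energy forces m ≤ 0. -/
theorem exp_mul_sq_nonpos {n : ℕ} (hn2 : 2 ≤ n) (hn6 : n ≤ 6)
    (hadd : ∀ f g : ℝ → ℝ, ContDiff ℝ ∞ f → HasCompactSupport f → ContDiff ℝ ∞ g →
      HasCompactSupport g → T (fun t => f t + g t) = T f + T g)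
    (hsmul : ∀ (a : ℝ) (f : ℝ → ℝ), ContDiff ℝ ∞ f → HasCompactSupport f →
      T (fun t => a * f t) = a * T f)
    (hA : ∀ f : ℝ → ℝ, ContDiff ℝ ∞ f → HasCompactSupport f →
      0 ≤ T (fun t => Real.exp (-2 * t) * (deriv f t ^ 2 - 2 * f t ^ 2)))
    (hB : ∀ f : ℝ → ℝ, ContDiff ℝ ∞ f → HasCompactSupport f →
      T (fun t => (n - 2 : ℝ) * f t + deriv f t) = 0) {f : ℝ → ℝ} (hf : ContDiff ℝ ∞ f)
    (hfc : HasCompactSupport f) : T (fun t => Real.exp (-(n - 2 : ℝ) * t) * f t ^ 2) ≤ 0 := by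
  obtain ⟨h1, m, hm⟩ := exp_mul_integral_eq hadd hsmul hB
  have hsqc {f : ℝ → ℝ} (hfc : HasCompactSupport f) : HasCompactSupport fun t => f t ^ 2 :=
    hfc.comp_left (g := fun t => t ^ 2) (by simp)
  rw [hm _ (hf.pow 2) (hsqc hfc)]
  refine mul_nonpos_of_nonpos_of_nonneg ?_ (integral_nonneg fun t => sq_nonneg _)
  obtain ⟨ψ, hψ, hψc, hlt⟩ := exists_integral_deriv_sq_lt
  have hψ' : ContDiff ℝ ∞ (deriv ψ) := (contDiff_infty_iff_deriv.1 hψ).2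
  -- The exponent for which e^(-2t) e^(-2at) is the inverse of the density e^((n-2)t). The cross
  -- term -2aψψ' is then a multiple of the derivative of ψ², which T kills.
  set a : ℝ := (n - 4) / 2 with ha
  have ha1 : a ^ 2 ≤ 1 := by
    have e2 : (2 : ℝ) ≤ n := by exact_mod_cast hn2
    have e6 : (n : ℝ) ≤ 6 := by exact_mod_cast hn6
    rw [ha]
    nlinarith
  have hexp : ContDiff ℝ ∞ fun t : ℝ => Real.exp (-(n - 2 : ℝ) * t) := by fun_prop
  have hexp' : ContDiff ℝ ∞ fun t : ℝ => Real.exp (-a * t) := by fun_prop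
  have hst := hA (fun t => Real.exp (-a * t) * ψ t) (hexp'.mul hψ) (HasCompactSupport.mul_left hψc)
  have hsq : ContDiff ℝ ∞ fun t => ψ t ^ 2 := hψ.pow 2
  have hsq' : ContDiff ℝ ∞ (deriv fun t => ψ t ^ 2) := (contDiff_infty_iff_deriv.1 hsq).2
  have hg : ContDiff ℝ ∞ fun t => deriv ψ t ^ 2 - (2 - a ^ 2) * ψ t ^ 2 :=
    (hψ'.pow 2).sub (contDiff_const.mul hsq)
  have hgc : HasCompactSupport fun t => deriv ψ t ^ 2 - (2 - a ^ 2) * ψ t ^ 2 :=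
    (hsqc hψc.deriv).sub (HasCompactSupport.mul_left (hsqc hψc))
  have e : (fun t => Real.exp (-2 * t) * (deriv (fun t => Real.exp (-a * t) * ψ t) t ^ 2 -
      2 * (Real.exp (-a * t) * ψ t) ^ 2)) = fun t =>
      Real.exp (-(n - 2 : ℝ) * t) * (deriv ψ t ^ 2 - (2 - a ^ 2) * ψ t ^ 2) +
        (-a) * (Real.exp (-(n - 2 : ℝ) * t) * deriv (fun t => ψ t ^ 2) t) := by
    funext t
    have hdψ : HasDerivAt ψ (deriv ψ t) t :=
      (hψ.differentiable (by simp)).differentiableAt.hasDerivAt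
    have hd : HasDerivAt (fun t => Real.exp (-a * t) * ψ t) _ t :=
      (((hasDerivAt_id t).const_mul (-a)).exp).mul hdψ
    have hd2 : HasDerivAt (fun t => ψ t ^ 2) _ t := hdψ.pow 2
    have he : Real.exp (-(n - 2 : ℝ) * t) =
        Real.exp (-2 * t) * (Real.exp (-a * t) * Real.exp (-a * t)) := by
      rw [← Real.exp_add, ← Real.exp_add]
      congr 1
      rw [ha]
      ring
    rw [hd.deriv, hd2.deriv, he]
    simp only [id]
    push_cast
    ring
  rw [e, hadd _ _ (hexp.mul hg) (HasCompactSupport.mul_left hgc)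
    (contDiff_const.mul (hexp.mul hsq'))
    (HasCompactSupport.mul_left (HasCompactSupport.mul_left (hsqc hψc).deriv)),
    hsmul _ _ (hexp.mul hsq') (HasCompactSupport.mul_left (hsqc hψc).deriv),
    h1 _ hsq (hsqc hψc), mul_zero, add_zero, hm _ hg hgc,
    integral_sub ((hψ'.pow 2).continuous.integrable_of_hasCompactSupport (hsqc hψc.deriv))
      ((hsq.continuous.integrable_of_hasCompactSupport (hsqc hψc)).const_mul _),
    integral_const_mul] at hst
  have hpos : 0 ≤ ∫ t, ψ t ^ 2 := integral_nonneg fun t => sq_nonneg _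
  by_contra! hm0
  nlinarith [mul_pos hm0 (sub_pos.2 hlt), mul_nonneg hm0.le (mul_nonneg (sub_nonneg.2 ha1) hpos)]

end OneDimensional

namespace Hypersurface

open smoothFunctions

variable {n : ℕ} {K : Set (EuclideanSpace ℝ (Fin (n + 1)))}
  {ν : EuclideanSpace ℝ (Fin (n + 1)) → EuclideanSpace ℝ (Fin (n + 1))}

/-- A stable minimal hypercone of dimension at most six is totally geodesic. -/
theorem IsOriented.curvatureSq_eq_zero (h : IsOriented (K \ {0}) ν) (hn2 : 2 ≤ n) (hn6 : n ≤ 6)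
    (hcone : IsClosedCone K) (hmin : IsMinimal (K \ {0}) ν) (hst : IsStable (K \ {0}) ν)
    (x : ↥(K \ {0})) : curvatureSq ν x = 0 := by
  have hSm : MeasurableSet (K \ {0}) := hcone.1.measurableSet.diff (measurableSet_singleton 0)
  have := h.isOpenPosMeasure hSm
  have := h.isLocallyFiniteMeasure hSm
  let χ : ContDiffBump (Real.log ‖(x : EuclideanSpace ℝ (Fin (n + 1)))‖) := default
  have hχ : ContDiff ℝ ∞ χ := χ.contDiff
  have key := exp_mul_sq_nonpos (T := radialIntegral K ν) hn2 hn6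
    (fun f g hf hfc hg hgc => by
      simp only [radialIntegral, mul_add]
      exact integral_add (h.integrable_radial hcone.1 hf hfc) (h.integrable_radial hcone.1 hg hgc))
    (fun a f _ _ => by
      simp only [radialIntegral, mul_left_comm _ a]
      exact integral_const_mul _ _)
    (fun f => h.radialIntegral_stability hcone hmin hst)
    (fun f => h.radialIntegral_homogeneity hcone hmin) hχ χ.hasCompactSupport
  have hg : ContDiff ℝ ∞ fun t => Real.exp (-(n - 2 : ℝ) * t) * χ t ^ 2 :=
    ContDiff.mul (by fun_prop) (hχ.pow 2)
  have hgc : HasCompactSupport fun t => Real.exp (-(n - 2 : ℝ) * t) * χ t ^ 2 :=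
    HasCompactSupport.mul_left (χ.hasCompactSupport.comp_left (g := fun t => t ^ 2) (by simp))
  -- If the curvature were nonzero at x, the integrand in `key` would be continuous, nonnegative and
  -- positive at x, because χ is 1 at log |x|; its integral would be positive.
  by_contra hx
  refine key.not_gt ?_
  have hcont : Continuous fun x : ↥(K \ {0}) => curvatureSq ν x *
      (Real.exp (-(n - 2 : ℝ) * Real.log ‖(x : EuclideanSpace ℝ (Fin (n + 1)))‖) *
        χ (Real.log ‖(x : EuclideanSpace ℝ (Fin (n + 1)))‖) ^ 2) := by
    simp_rw [h.curvatureSq_eq]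
    exact smoothFunctions.continuous
      (shapeNormSq h.tangentialDeriv h.normalFun * radialFun K hg)
  have hu0 (x) : 0 ≤ curvatureSq ν x := Finset.sum_nonneg fun i _ => sq_nonneg _
  refine hcont.integral_pos_of_hasCompactSupport_nonneg_nonzero (x := x)
    (HasCompactSupport.mul_left (hasCompactSupport_radialFun hcone.1 hg hgc))
    (fun y => mul_nonneg (hu0 _) (mul_nonneg (Real.exp_pos _).le (sq_nonneg _))) ?_
  simpa [χ.one_of_mem_closedBall (Metric.mem_closedBall_self χ.rIn_pos.le)] using hx

end Hypersurface

end

/-! ### Totally geodesic cones are hyperplanes -/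

noncomputable section

open Filter Topology
open scoped RealInnerProductSpace NNReal ENNReal Manifold

namespace Hypersurface

open smoothFunctions

variable {n : ℕ} {S K : Set (EuclideanSpace ℝ (Fin (n + 1)))}
  {ν : EuclideanSpace ℝ (Fin (n + 1)) → EuclideanSpace ℝ (Fin (n + 1))}

theorem IsOriented.fderiv_normal_eq_zero (h : IsOriented S ν) (x : S) (hx : curvatureSq ν x = 0)
    {v : EuclideanSpace ℝ (Fin (n + 1))} (hv : ⟪ν x, v⟫ = 0) : fderiv ℝ ν x v = 0 := by
  have h1 (i) : fderiv ℝ ν x (tangentVector ν i x) = 0 := by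
    have := (Finset.sum_eq_zero_iff_of_nonneg fun i _ => sq_nonneg _).1 hx i (Finset.mem_univ i)
    rwa [EuclideanSpace.basisFun_apply, h.secondFundamentalForm_single, sq_eq_zero_iff,
      norm_neg, norm_eq_zero] at this
  have h2 := sum_apply_smul_tangentVector (ν := ν) (x := x) v
  rw [hv, zero_smul, sub_zero] at h2
  rw [← h2, map_sum]
  exact Finset.sum_eq_zero fun i _ => by rw [map_smul, h1, smul_zero]

/-- A totally geodesic cone contains a neighbourhood of each of its points in the tangent plane. -/
theorem IsOriented.exists_ball_subset (h : IsOriented S ν)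
    (hS : ∀ t : ℝ, 0 < t → ∀ x ∈ S, t • x ∈ S) (hu : ∀ x : S, curvatureSq ν x = 0)
    {p : EuclideanSpace ℝ (Fin (n + 1))} (hp : p ∈ S) :
    ∃ r > 0, ∀ q, ⟪ν p, q⟫ = 0 → dist q p < r → q ∈ S ∧ ν q = ν p := by
  obtain ⟨e, he⟩ : ∃ e, e = ν p := ⟨_, rfl⟩
  obtain ⟨r, U, Φ, hr, hpU, hc⟩ := h.exists_graphChart hp he
  have hcoe (q : EuclideanSpace ℝ (Fin (n + 1))) (hq : ⟪e, q⟫ = 0) :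
      ((ℝ ∙ e)ᗮ.orthogonalProjectionOnto q : EuclideanSpace ℝ (Fin (n + 1))) = q := by
    rw [coe_orthogonalProjectionOnto hc.norm_eq_one, hq, zero_smul, sub_zero]
  have hd {y} (hy : y ∈ Metric.ball ((ℝ ∙ e)ᗮ.orthogonalProjectionOnto p) r) :
      HasFDerivAt (fun y => ν (Φ y)) (fderiv ℝ ν (Φ y) ∘L graphDeriv (ν (Φ y)) e) y :=
    (((h.contDiffAt (hc.mem y hy).1).differentiableAt (by simp)).hasFDerivAt).comp y
      (hc.deriv y hy).hasFDerivAt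
  have hconst {y} (hy : y ∈ Metric.ball ((ℝ ∙ e)ᗮ.orthogonalProjectionOnto p) r) :
      ν (Φ y) = e := by
    have hy0 := Metric.mem_ball_self (x := (ℝ ∙ e)ᗮ.orthogonalProjectionOnto p) hr
    have := (convex_ball ((ℝ ∙ e)ᗮ.orthogonalProjectionOnto p) r).is_const_of_fderivWithin_eq_zero
      (𝕜 := ℝ) (f := fun y => ν (Φ y)) (fun z hz => (hd hz).differentiableAt.differentiableWithinAt)
      (fun z hz => by
        rw [fderivWithin_of_isOpen Metric.isOpen_ball hz, (hd hz).fderiv]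
        ext1 v
        have hw : ⟪ν (Φ z), e⟫ ≠ 0 :=
          (by linarith [hc.angle _ (hc.mem z hz)] : 0 < ⟪ν (Φ z), e⟫).ne'
        exact h.fderiv_normal_eq_zero ⟨Φ z, (hc.mem z hz).1⟩ (hu _) (inner_graphDeriv hw v))
      hy hy0
    rw [this, hc.apply_proj p ⟨hp, hpU⟩, he]
  rw [← he]
  refine ⟨r, hr, fun q hq hqp => ?_⟩
  have hpe : ⟪e, p⟫ = 0 := he ▸ h.inner_position hS hp
  have hqD : (ℝ ∙ e)ᗮ.orthogonalProjectionOnto q ∈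
      Metric.ball ((ℝ ∙ e)ᗮ.orthogonalProjectionOnto p) r := by
    rw [Metric.mem_ball, Subtype.dist_eq, hcoe q hq, hcoe p hpe]
    exact hqp
  have hΦS := (hc.mem _ hqD).1
  -- The normal at the graph point is e, and on a cone the position is orthogonal to the normal. The
  -- graph point thus lies in e^⊥ and equals its own projection q.
  have hΦ : Φ ((ℝ ∙ e)ᗮ.orthogonalProjectionOnto q) = q := by
    have h1 := h.inner_position hS hΦS
    rw [hconst hqD] at h1
    rw [← hcoe _ h1, hc.proj _ hqD, hcoe q hq]
  have h2 := hconst hqD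
  rw [hΦ] at hΦS h2
  exact ⟨hΦS, h2⟩

/-- A totally geodesic closed cone contains the tangent planes at its points. -/
theorem IsOriented.tangentPlane_subset (hn2 : 2 ≤ n) (h : IsOriented (K \ {0}) ν)
    (hcone : IsClosedCone K) (hu : ∀ x : ↥(K \ {0}), curvatureSq ν x = 0)
    {p : EuclideanSpace ℝ (Fin (n + 1))} (hp : p ∈ K \ {0})
    {q : EuclideanSpace ℝ (Fin (n + 1))} (hq : ⟪ν p, q⟫ = 0) (hq0 : q ≠ 0) :
    q ∈ K \ {0} ∧ ν q = ν p := by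
  have hS : ∀ t : ℝ, 0 < t → ∀ x ∈ K \ {0}, t • x ∈ K \ {0} := fun t ht x hx =>
    ⟨hcone.2 t ht x hx.1, smul_ne_zero ht.ne' hx.2⟩
  obtain ⟨e, he⟩ : ∃ e, e = ν p := ⟨_, rfl⟩
  rw [← he] at hq ⊢
  have hmem {x : EuclideanSpace ℝ (Fin (n + 1))} : x ∈ (ℝ ∙ e)ᗮ ↔ ⟪e, x⟫ = 0 :=
    Submodule.mem_orthogonal_singleton_iff_inner_right
  -- Recording the normal along with membership makes A open by `exists_ball_subset`. It is closed
  -- away from 0 because K is closed and ν is continuous on the punctured cone.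
  let A : Set (ℝ ∙ e)ᗮ := {x | (x : EuclideanSpace ℝ (Fin (n + 1))) ∈ K \ {0} ∧ ν x = e}
  have hA : IsOpen A := by
    rw [Metric.isOpen_iff]
    rintro x ⟨hx, hxe⟩
    obtain ⟨r, hr, hrS⟩ := h.exists_ball_subset hS hu hx
    refine ⟨r, hr, fun y hy => ?_⟩
    rw [hxe] at hrS
    exact hrS y (hmem.1 y.2) hy
  have hAc : closure A ∩ {0}ᶜ ⊆ A := by
    rintro x ⟨hx, hx0⟩
    have hxK : (x : EuclideanSpace ℝ (Fin (n + 1))) ∈ K :=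
      closure_minimal (fun y hy => hy.1.1) (hcone.1.preimage continuous_subtype_val) hx
    have hxS : (x : EuclideanSpace ℝ (Fin (n + 1))) ∈ K \ {0} :=
      ⟨hxK, fun h0 => hx0 (Subtype.ext h0)⟩
    refine ⟨hxS, ?_⟩
    have hcont : ContinuousAt (fun y : (ℝ ∙ e)ᗮ => ν y) x :=
      (h.contDiffAt hxS).continuousAt.comp continuousAt_subtype_val
    have := mem_closure_iff_nhdsWithin_neBot.1 hx
    refine tendsto_nhds_unique (hcont.mono_left nhdsWithin_le_nhds) (b := e)
      (l := 𝓝[A] x) (tendsto_const_nhds.congr' ?_)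
    filter_upwards [self_mem_nhdsWithin] with y hy using hy.2.symm
  -- Here n ≥ 2 is essential: a line minus a point is disconnected.
  have hconn : IsPreconnected ({0}ᶜ : Set (ℝ ∙ e)ᗮ) := by
    refine (isConnected_compl_singleton_of_one_lt_rank ?_ 0).isPreconnected
    rw [← Module.finrank_eq_rank, finrank_orthogonal_span (he ▸ h.norm_eq_one hp)]
    exact_mod_cast hn2
  have hpA : (⟨p, hmem.2 (he ▸ h.inner_position hS hp)⟩ : (ℝ ∙ e)ᗮ) ∈ A := ⟨hp, he.symm⟩
  have hsub := hconn.subset_of_closure_inter_subset hA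
    ⟨⟨p, _⟩, fun h0 => hp.2 (Submodule.mk_eq_zero _ _ |>.1 h0), hpA⟩ hAc
  exact hsub (show (⟨q, hmem.2 hq⟩ : (ℝ ∙ e)ᗮ) ∈ ({0}ᶜ : Set _) from
    fun h0 => hq0 (congrArg Subtype.val h0))

/-- Since n + 1 > 2, the tangent planes at p and q share a nonzero vector z. By
`tangentPlane_subset` the single value ν z equals both ν p and ν q. -/
theorem IsOriented.normal_eq (hn2 : 2 ≤ n) (h : IsOriented (K \ {0}) ν)
    (hcone : IsClosedCone K) (hu : ∀ x : ↥(K \ {0}), curvatureSq ν x = 0)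
    {p q : EuclideanSpace ℝ (Fin (n + 1))} (hp : p ∈ K \ {0}) (hq : q ∈ K \ {0}) :
    ν q = ν p := by
  let ℓ : EuclideanSpace ℝ (Fin (n + 1)) →ₗ[ℝ] ℝ × ℝ :=
    ((innerSL ℝ (ν p)).prod (innerSL ℝ (ν q))).toLinearMap
  have hker : LinearMap.ker ℓ ≠ ⊥ := LinearMap.ker_ne_bot_of_finrank_lt (by
    rw [Module.finrank_prod, finrank_euclideanSpace_fin, Module.finrank_self]
    omega)
  obtain ⟨z, hz, hz0⟩ := Submodule.exists_mem_ne_zero_of_ne_bot hker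
  have hz' : ((⟪ν p, z⟫, ⟪ν q, z⟫) : ℝ × ℝ) = (0, 0) := hz
  rw [Prod.mk.injEq] at hz'
  rw [← (h.tangentPlane_subset hn2 hcone hu hp hz'.1 hz0).2,
    (h.tangentPlane_subset hn2 hcone hu hq hz'.2 hz0).2]

theorem IsClosedCone.zero_mem (hcone : IsClosedCone K) (hne : K.Nonempty) :
    (0 : EuclideanSpace ℝ (Fin (n + 1))) ∈ K := by
  obtain ⟨p, hp⟩ := hne
  have ht : Tendsto (fun t : ℝ => t • p) (𝓝[>] 0) (𝓝 0) := by
    have : Tendsto (fun t : ℝ => t • p) (𝓝 0) (𝓝 ((0 : ℝ) • p)) :=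
      (continuous_id.smul continuous_const).tendsto 0
    rw [zero_smul] at this
    exact this.mono_left nhdsWithin_le_nhds
  refine hcone.1.mem_of_tendsto ht ?_
  filter_upwards [self_mem_nhdsWithin] with t h0 using hcone.2 t h0 p hp

/-- A totally geodesic closed hypercone is a hyperplane. -/
theorem IsOriented.eq_orthogonal_span (hn2 : 2 ≤ n) (h : IsOriented (K \ {0}) ν)
    (hcone : IsClosedCone K) (hu : ∀ x : ↥(K \ {0}), curvatureSq ν x = 0)
    {p : EuclideanSpace ℝ (Fin (n + 1))} (hp : p ∈ K \ {0}) :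
    K = ((ℝ ∙ ν p)ᗮ : Submodule ℝ (EuclideanSpace ℝ (Fin (n + 1)))) := by
  have hS : ∀ t : ℝ, 0 < t → ∀ x ∈ K \ {0}, t • x ∈ K \ {0} := fun t ht x hx =>
    ⟨hcone.2 t ht x hx.1, smul_ne_zero ht.ne' hx.2⟩
  ext q
  rw [SetLike.mem_coe, Submodule.mem_orthogonal_singleton_iff_inner_right]
  by_cases hq0 : q = 0
  · simp [hq0, hcone.zero_mem ⟨p, hp.1⟩]
  · refine ⟨fun hq => ?_, fun hq => (h.tangentPlane_subset hn2 hcone hu hp hq hq0).1.1⟩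
    rw [← h.normal_eq hn2 hcone hu hp ⟨hq, hq0⟩]
    exact h.inner_position hS ⟨hq, hq0⟩

end Hypersurface

end

/-- **Simons' theorem**: stable minimal hypercones of dimension between 2 and 6 are hyperplanes. -/
theorem mainTheorem2 (n : ℕ) (hn2 : 2 ≤ n) (hn6 : n ≤ 6)
    (K : Set (EuclideanSpace ℝ (Fin (n + 1))))
    (ν : EuclideanSpace ℝ (Fin (n + 1)) → EuclideanSpace ℝ (Fin (n + 1)))
    (hcone : Hypersurface.IsClosedCone K)
    (hne : (K \ {0}).Nonempty)
    (hsmooth : Hypersurface.IsOriented (K \ {0}) ν)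
    (hmin : Hypersurface.IsMinimal (K \ {0}) ν)
    (hstable : Hypersurface.IsStable (K \ {0}) ν) :
    ∃ W : Submodule ℝ (EuclideanSpace ℝ (Fin (n + 1))),
      Module.finrank ℝ W = n ∧ K = (W : Set (EuclideanSpace ℝ (Fin (n + 1)))) := by
  obtain ⟨p, hp⟩ := hne
  exact ⟨(ℝ ∙ ν p)ᗮ, Hypersurface.finrank_orthogonal_span (hsmooth.norm_eq_one hp),
    hsmooth.eq_orthogonal_span hn2 hcone
      (hsmooth.curvatureSq_eq_zero hn2 hn6 hcone hmin hstable) hp⟩
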